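/- **Theorem 4.3.** Let $G=(V,E)$ be a finite simple graph with maximum degree $\Delta$ whose vertex set is partitioned into blocks $V_1\sqcup\dots\sqcup V_l$, each of size $b\ge 1$, and let $w:V\to[0,\infty)$ be vertex weights; write $w(U)=\sum_{v\in U}w(v)$ and $n=|V|$. An independent transversal is an independent set containing exactly one vertex of each block. (i) If $4\Delta\le b\le 4.5\Delta$, then there is an independent transversal $I$ with $$w(I)\ \ge\ w(V)\,\frac{\sqrt b+\sqrt{b-4\Delta}}{\sqrt b\,(2b-1)+\sqrt{b-4\Delta}}\ \ge\ \frac{w(V)}{8\Delta-1}.$$ (ii) If $b\ge 4.5\Delta$, then there is an independent transversal $I$ with $$w(I)\ \ge\ w(V)\cdot\min\Bigl(\frac1b,\ \frac{4}{27\Delta-2}\Bigr),$$ where the minimum is read as $1/b$ if $\Delta=0$. (iii) For every constant $c\in\mathbb N$ there is a randomized algorithm which, given $G$, the partition and nonnegative rational weights $w$ in binary, always halts in time polynomial in the bit length of the input whenever $b\ge 4\Delta$, and which satisfies: if $4\Delta\le b\le 4.5\Delta$, then with probability at least $1-n^{-c}$ it outputs an independent transversal of weight at least $(1-n^{-c})$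 times the first lower bound in (i); if $b\ge 4.5\Delta$, then with probability at least $1-n^{-c}$ it outputs an independent transversal of weight at least $(1-n^{-c})$ times the lower bound in (ii). -/

import Mathlib

open Finset

/-! ### Independent transversals -/

/-- `blk : V → ι` assigns to each vertex its block. A transversal contains exactly one vertex of
each block; it is independent if no two of its vertices are adjacent. -/
def IsIndepTransversal {V ι : Type*} (G : SimpleGraph V) (blk : V → ι) (I : Finset V) : Prop :=
  (∀ i, ∃! v, v ∈ I ∧ blk v = i) ∧ G.IsIndepSet (I : Set V)

/-- The guaranteed fraction of the total weight for `4 Δ ≤ b ≤ 4.5 Δ`. -/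
noncomputable def factorSmall (b Δ : ℕ) : ℝ :=
  (√(b : ℝ) + √((b : ℝ) - 4 * Δ)) / (√(b : ℝ) * (2 * b - 1) + √((b : ℝ) - 4 * Δ))

/-- The guaranteed fraction of the total weight for `b ≥ 4.5 Δ`. For an edgeless graph (`Δ = 0`)
the second term of the minimum imposes nothing. -/
noncomputable def factorLarge (b Δ : ℕ) : ℝ :=
  if Δ = 0 then 1 / (b : ℝ) else min (1 / (b : ℝ)) (4 / (27 * (Δ : ℝ) - 2))

/-! ### A randomized random access machine

Registers and memory cells, both indexed by natural numbers, hold natural numbers. A program names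
its registers directly and addresses memory cells indirectly. Programs are built from assignments,
fair coin flips, sequencing, branching and loops. Every elementary operation costs one unit, except
that a multiplication or division also costs the bit lengths of its operands. Since the bit length
of the longest number held therefore grows by at most a constant (depending on the program) per unit
of cost, this cost is polynomially related to (probabilistic) Turing machine time. -/

namespace RandRAM

/-- The registers, the memory, and the number of coins flipped so far. -/
structure State where
  reg : ℕ → ℕ
  mem : ℕ → ℕ
  coins : ℕ

/-- Expressions. `cell a` is the content of the memory cell whose address is the value of `a`;
`sub` is truncated subtraction, `div` is the quotient rounded down (zero for the divisor zero). -/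
inductive Expr where
  | const (k : ℕ)
  | reg (i : ℕ)
  | cell (a : Expr)
  | add (a b : Expr)
  | sub (a b : Expr)
  | mul (a b : Expr)
  | div (a b : Expr)

/-- The value of an expression. -/
def Expr.eval (s : State) : Expr → ℕ
  | .const k => k
  | .reg i => s.reg i
  | .cell a => s.mem (a.eval s)
  | .add a b => a.eval s + b.eval s
  | .sub a b => a.eval s - b.eval s
  | .mul a b => a.eval s * b.eval s
  | .div a b => a.eval s / b.eval s

/-- The cost of evaluating an expression; `Nat.size` is the bit length. -/
def Expr.cost (s : State) : Expr → ℕ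
  | .const _ => 1
  | .reg _ => 1
  | .cell a => a.cost s + 1
  | .add a b => a.cost s + b.cost s + 1
  | .sub a b => a.cost s + b.cost s + 1
  | .mul a b => a.cost s + b.cost s + ((a.eval s).size + (b.eval s).size + 1)
  | .div a b => a.cost s + b.cost s + ((a.eval s).size + (b.eval s).size + 1)

/-- Programs. `set i e` writes the value of `e` to the register `i`, `store a e` writes it to the
memory cell with address `a`, and `flip i` writes a fresh random bit to the register `i`. A
condition holds if its value is not zero. -/
inductive Prog where
  | set (i : ℕ) (e : Expr)
  | store (a e : Expr)
  | flip (i : ℕ)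
  | seq (p q : Prog)
  | ite (e : Expr) (p q : Prog)
  | loop (e : Expr) (p : Prog)

/-- `Exec ω p s s' t`: when the coin flips come out as `ω 0, ω 1, …`, the program `p`, started in
the state `s`, halts in the state `s'`, at total cost `t`. -/
inductive Exec (ω : ℕ → Bool) : Prog → State → State → ℕ → Prop
  | set (i : ℕ) (e : Expr) (s : State) :
      Exec ω (.set i e) s { s with reg := Function.update s.reg i (e.eval s) } (e.cost s + 1)
  | store (a e : Expr) (s : State) :
      Exec ω (.store a e) s { s with mem := Function.update s.mem (a.eval s) (e.eval s) }
        (a.cost s + e.cost s + 1)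
  | flip (i : ℕ) (s : State) :
      Exec ω (.flip i) s
        { s with reg := Function.update s.reg i (ω s.coins).toNat, coins := s.coins + 1 } 1
  | seq {p q : Prog} {s₁ s₂ s₃ : State} {t₁ t₂ : ℕ} :
      Exec ω p s₁ s₂ t₁ → Exec ω q s₂ s₃ t₂ → Exec ω (.seq p q) s₁ s₃ (t₁ + t₂)
  | iteTrue {e : Expr} {p q : Prog} {s₁ s₂ : State} {t : ℕ} :
      e.eval s₁ ≠ 0 → Exec ω p s₁ s₂ t → Exec ω (.ite e p q) s₁ s₂ (e.cost s₁ + 1 + t)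
  | iteFalse {e : Expr} {p q : Prog} {s₁ s₂ : State} {t : ℕ} :
      e.eval s₁ = 0 → Exec ω q s₁ s₂ t → Exec ω (.ite e p q) s₁ s₂ (e.cost s₁ + 1 + t)
  | loopTrue {e : Expr} {p : Prog} {s₁ s₂ s₃ : State} {t₁ t₂ : ℕ} :
      e.eval s₁ ≠ 0 → Exec ω p s₁ s₂ t₁ → Exec ω (.loop e p) s₂ s₃ t₂ →
      Exec ω (.loop e p) s₁ s₃ (e.cost s₁ + 1 + t₁ + t₂)
  | loopFalse {e : Expr} {p : Prog} {s : State} :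
      e.eval s = 0 → Exec ω (.loop e p) s s (e.cost s + 1)

/-- The initial state on the input list `x`: its entries stand in the memory cells `0, 1, 2, …`; all
other cells and all registers are zero. -/
def init (x : List ℕ) : State := ⟨fun _ => 0, fun i => x.getD i 0, 0⟩

/-- The size of an input in bits (with one separator for each entry). -/
def inputSize (x : List ℕ) : ℕ := (x.map fun a => a.size + 1).sum

/-- `T` coin flips as a sequence. (A run of cost at most `T` does not read beyond them.) -/
def tape {T : ℕ} (ω : Fin T → Bool) (k : ℕ) : Bool := if h : k < T then ω ⟨k, h⟩ else false

/-- On input `x` the program `p` halts at cost at most `T`, whatever the coin flips. -/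
def HaltsWithin (p : Prog) (x : List ℕ) (T : ℕ) : Prop :=
  ∀ ω : Fin T → Bool, ∃ s t, Exec (tape ω) p (init x) s t ∧ t ≤ T

open Classical in
/-- The probability, over `T` fair coin flips, that on input `x` the program `p` halts at cost at
most `T` with a final memory satisfying `good`. -/
noncomputable def successProb (p : Prog) (x : List ℕ) (T : ℕ) (good : (ℕ → ℕ) → Prop) : ℝ :=
  (#{ω : Fin T → Bool | ∃ s t, Exec (tape ω) p (init x) s t ∧ t ≤ T ∧ good s.mem} : ℝ) / 2 ^ T

end RandRAM

/-! ### Weighted transversal instances as inputs and outputs -/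

open Classical in
/-- The input that describes a graph on `n` vertices, given by its adjacency matrix, a division of
the vertices into `l` blocks, and nonnegative rational weights, given by numerators and
denominators. -/
noncomputable def encodeInstance {n l : ℕ} (G : SimpleGraph (Fin n)) (blk : Fin n → Fin l)
    (w : Fin n → ℚ≥0) : List ℕ :=
  [n, l] ++ List.ofFn (fun v => (blk v : ℕ))
    ++ (List.ofFn fun u => List.ofFn fun v => if G.Adj u v then 1 else 0).flatten
    ++ List.ofFn (fun v => (w v).num) ++ List.ofFn (fun v => (w v).den)

/-- The set of vertices that a final memory describes: those whose cell is not zero. -/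
def outputSet (n : ℕ) (m : ℕ → ℕ) : Finset (Fin n) := {v | m v ≠ 0}

/-- The final memory `m` describes an independent transversal of weight at least `B`. -/
def OutputsTransversal {n l : ℕ} (G : SimpleGraph (Fin n)) (blk : Fin n → Fin l)
    (w : Fin n → ℚ≥0) (B : ℝ) (m : ℕ → ℕ) : Prop :=
  IsIndepTransversal G blk (outputSet n m) ∧ B ≤ ∑ v ∈ outputSet n m, (w v : ℝ)

/-! ### Resampling logs and their witness trees -/

/-! The proof analyses Moser-Tardos resampling. Each block owns a row of independent random
vertices, and these rows form the table `R`. Each block shows one entry, at first the first one. As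
long as two shown vertices are adjacent, both of their blocks move on to their next entries. When no
shown vertices are adjacent, they form an independent transversal. Two estimates are needed: the
process rarely takes many steps, and a vertex of probability `β` is shown at the end with
probability at least about `theta β Δ`.

Both rest on witness trees. Resampled conflicts with disjoint blocks commute, so from the log of the
process one can pull to the front exactly the conflicts on which the state of a block `i` depends
(`exists_tree_append`). They form a binary tree: its root is the last conflict at `i`, the left
subtree is the earlier history of `i`, and the right subtree is what else the other block of the
root needs. Written in postorder, the tree is again a valid log. A valid log reads each table cell
at most once, so its probability is at most the product of the probabilities of its vertices
(`prob_valid_le`). If these are at most `β`, the trees at a block have total weight at most `1 + y`,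
where `y = Δβ(1 + y)²`; this is solvable because `4Δβ ≤ 1`. A log of length `S` yields `2S`
different trees, so Markov's inequality gives `prob_long_le`. If the entry finally shown by the
block of `v` is not `v`, then the first entry other than `v` was reached. Its tree has only `v` on
the left spine; such trees form a geometric series of sum at most `1 / (1 - Δβ²(1 + y))`, and the
next entry differs from `v` with probability `1 - β` (`prob_leave_le`).

The vertex distribution gives probability `β` to the heaviest vertices of each block. The main term
`β(1 + √(1 - 4Δβ))` of `theta` is largest at `β = 2/(9Δ)`, but `β` cannot be less than `1/b`; this
explains the two ranges of `b`. Whatever a block shows weighs at least as much as its lightest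
vertex in use, and the excess of a heavier vertex is collected with probability about `theta`. This
suffices for a fraction `τ ≤ theta` with `τ b ≤ 1` (`le_sum_weight`, `le_prob_good`). Existence
follows by letting all losses tend to zero, since there are finitely many transversals.

For the algorithm, a round stops after polynomially many steps and draws its table from fair coins,
uniform up to a factor `a` close to one. As no outcome weighs more than the whole graph, the
expectation forces success with probability at least `1/(4n^(c+1))`. Independent rounds, of which
the best result is kept, amplify this. The program is written in a small language with arrays and
bounded loops; a verified compiler (`exec_compile`), a loop rule (`run_for`) and a frame rule
(`fr_run`) reduce correctness and running time to loop invariants. -/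

namespace Resampling

/-- Binary trees whose nodes carry conflicts (ordered pairs of vertices). -/
inductive WTree (α : Type*) where
  | nil
  | node (d : α) (l r : WTree α)

namespace WTree
variable {α : Type*}

/-- The labels in postorder. -/
def post : WTree α → List α
  | nil => []
  | node d l r => l.post ++ (r.post ++ [d])

/-- The number of nodes. -/
def size : WTree α → ℕ
  | nil => 0
  | node _ l r => l.size + r.size + 1

theorem length_post (t : WTree α) : t.post.length = t.size := by
  induction t with
  | nil => rfl
  | node d l r hl hr => simp [post, size, hl, hr]; ring

end WTree

section Logs
set_option linter.unusedSectionVars false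
variable {V ι : Type*} [DecidableEq ι] (G : SimpleGraph V) (blk : V → ι)

/-- The conflict `d` involves the block `i`. -/
def Touches (d : V × V) (i : ι) : Prop := blk d.1 = i ∨ blk d.2 = i

instance (d : V × V) (i : ι) : Decidable (Touches blk d i) := by
  unfold Touches; infer_instance

/-- Advance the counters of the two blocks of a conflict. -/
def bump (c : ι → ℕ) (d : V × V) : ι → ℕ := fun i => c i + if Touches blk d i then 1 else 0

/-- The number of conflicts in a log that involve the block `i`. -/
def cnt (s : List (V × V)) (i : ι) : ℕ := s.countP fun d => Touches blk d i

/-- A conflict that is present when the block `i` shows the entry `R i (c i)`. -/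
def Conflict (R : ι → ℕ → V) (c : ι → ℕ) (d : V × V) : Prop :=
  G.Adj d.1 d.2 ∧ blk d.1 ≠ blk d.2 ∧ R (blk d.1) (c (blk d.1)) = d.1 ∧
    R (blk d.2) (c (blk d.2)) = d.2

/-- A log of successively resampled conflicts, for the table `R` and starting at the counters `c`. -/
def Valid (R : ι → ℕ → V) : (ι → ℕ) → List (V × V) → Prop
  | _, [] => True
  | c, d :: s => Conflict G blk R c d ∧ Valid R (bump blk c d) s

variable {G blk}

@[simp] theorem cnt_nil (i : ι) : cnt blk [] i = 0 := rfl

theorem cnt_cons (d : V × V) (s : List (V × V)) (i : ι) :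
    cnt blk (d :: s) i = (if Touches blk d i then 1 else 0) + cnt blk s i := by
  simp [cnt, List.countP_cons, add_comm]

theorem cnt_append (s t : List (V × V)) (i : ι) :
    cnt blk (s ++ t) i = cnt blk s i + cnt blk t i := by
  simp [cnt]

theorem cnt_eq_zero {s : List (V × V)} {i : ι} :
    cnt blk s i = 0 ↔ ∀ d ∈ s, ¬ Touches blk d i := by
  simp [cnt]

theorem valid_append {R : ι → ℕ → V} (s t : List (V × V)) : ∀ c : ι → ℕ,
    Valid G blk R c (s ++ t) ↔
      Valid G blk R c s ∧ Valid G blk R (fun i => c i + cnt blk s i) t := by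
  induction s with
  | nil => intro c; simp [Valid]
  | cons d s ih =>
    intro c
    have : (fun i => bump blk c d i + cnt blk s i) = fun i => c i + cnt blk (d :: s) i := by
      funext i; simp only [bump, cnt_cons]; ring
    simp only [List.cons_append, Valid, ih, this, and_assoc]

theorem Conflict.congr {R : ι → ℕ → V} {c c' : ι → ℕ} {d : V × V}
    (h : Conflict G blk R c d) (h₁ : c (blk d.1) = c' (blk d.1))
    (h₂ : c (blk d.2) = c' (blk d.2)) : Conflict G blk R c' d := by
  obtain ⟨a, b, p, q⟩ := h
  exact ⟨a, b, h₁ ▸ p, h₂ ▸ q⟩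

theorem Conflict.swap {R : ι → ℕ → V} {c : ι → ℕ} {d : V × V}
    (h : Conflict G blk R c d) : Conflict G blk R c d.swap := by
  obtain ⟨a, b, p, q⟩ := h
  exact ⟨a.symm, b.symm, q, p⟩

theorem touches_swap {d : V × V} {i : ι} : Touches blk d.swap i ↔ Touches blk d i := by
  simp [Touches, or_comm]

/-- A conflict may be moved in front of conflicts that involve neither of its blocks. -/
theorem valid_commute {R : ι → ℕ → V} {e : V × V} (s : List (V × V))
    (h₁ : ∀ d ∈ s, ¬ Touches blk d (blk e.1)) (h₂ : ∀ d ∈ s, ¬ Touches blk d (blk e.2)) :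
    ∀ c : ι → ℕ, Valid G blk R c (s ++ [e]) → Valid G blk R c (e :: s) := by
  induction s with
  | nil => intro c h; exact h
  | cons d s ih =>
    intro c h
    simp only [List.mem_cons, forall_eq_or_imp] at h₁ h₂
    obtain ⟨hd, hs⟩ := h
    obtain ⟨he, hs⟩ := ih h₁.2 h₂.2 _ hs
    refine ⟨he.congr ?_ ?_, hd.congr ?_ ?_, ?_⟩
    · simp [bump, h₁.1]
    · simp [bump, h₂.1]
    · have : ¬ Touches blk e (blk d.1) := fun h => h.elim
        (fun h => h₁.1 (Or.inl h.symm)) (fun h => h₂.1 (Or.inl h.symm))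
      simp [bump, this]
    · have : ¬ Touches blk e (blk d.2) := fun h => h.elim
        (fun h => h₁.1 (Or.inr h.symm)) (fun h => h₂.1 (Or.inr h.symm))
      simp [bump, this]
    · have : bump blk (bump blk c d) e = bump blk (bump blk c e) d := by
        funext i; simp only [bump]; ring
      rwa [this] at hs

variable (G blk)

/-- Witness trees for the block `i`: the root involves `i`, the left subtree belongs to the same
block, the right subtree to the block of the other vertex of the root. -/
def IsTree : ι → WTree (V × V) → Prop
  | _, .nil => True
  | i, .node d l r => blk d.1 = i ∧ G.Adj d.1 d.2 ∧ IsTree i l ∧ IsTree (blk d.2) r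

/-- Witness trees whose left spine only involves the vertex `v`. -/
def IsSpine (v : V) : WTree (V × V) → Prop
  | .nil => True
  | .node d l r => d.1 = v ∧ G.Adj d.1 d.2 ∧ IsSpine v l ∧ IsTree G blk (blk d.2) r

variable {G blk}

theorem IsTree.isSpine {v : V} {t : WTree (V × V)} (h : IsTree G blk (blk v) t)
    (hv : ∀ d ∈ t.post, blk d.1 = blk v → d.1 = v) : IsSpine G blk v t := by
  induction t with
  | nil => trivial
  | node d l r hl hr =>
    obtain ⟨h1, h2, h3, h4⟩ := h
    refine ⟨hv d (by simp [WTree.post]) h1, h2, hl h3 fun d' hd' => hv d' ?_, h4⟩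
    simp [WTree.post, hd']

/-- Every log can be rearranged so that it begins with a witness tree (in postorder) for a given
block, and continues with conflicts that do not involve this block. -/
theorem exists_tree_append {R : ι → ℕ → V} : ∀ (n : ℕ) (s : List (V × V)), s.length ≤ n →
    ∀ (c : ι → ℕ) (i : ι), Valid G blk R c s →
    ∃ t s', IsTree G blk i t ∧ Valid G blk R c (WTree.post t ++ s') ∧
      (∀ d ∈ s', ¬ Touches blk d i) ∧ (WTree.post t ++ s').length = s.length ∧
      ∀ j, cnt blk (WTree.post t ++ s') j = cnt blk s j := by
  intro n
  induction n with
  | zero =>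
    intro s hs c i _
    obtain rfl : s = [] := by simpa using hs
    exact ⟨.nil, [], by simp [IsTree, WTree.post, Valid]⟩
  | succ n ih =>
    intro s hs c i hv
    rcases List.eq_nil_or_concat s with rfl | ⟨s₀, e, rfl⟩
    · exact ⟨.nil, [], by simp [IsTree, WTree.post, Valid]⟩
    simp only [List.concat_eq_append] at *
    replace hs : s₀.length ≤ n := by simpa using hs
    obtain ⟨hv₀, he, -⟩ := (valid_append _ _ _).1 hv
    by_cases hei : Touches blk e i
    -- A conflict can be read in either order; the root of a tree for `i` has to name the vertex of
    -- `i` first.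
    · obtain ⟨d, hdi, hd, hde⟩ : ∃ d : V × V, blk d.1 = i ∧
          Conflict G blk R (fun j => c j + cnt blk s₀ j) d ∧
          ∀ j, Touches blk d j ↔ Touches blk e j := by
        rcases hei with h | h
        · exact ⟨e, h, he, fun _ => Iff.rfl⟩
        · exact ⟨e.swap, h, he.swap, fun _ => touches_swap⟩
      -- The history of `i` before the last conflict becomes the left subtree. From what is left
      -- over, the history of the other block becomes the right subtree. The rest `s₂` then involves
      -- neither block, and `d` can be moved in front of it.
      obtain ⟨l, s₁, hl, hv₁, hs₁, hlen₁, hc₁⟩ := ih s₀ hs c i hv₀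
      obtain ⟨hvl, hvs₁⟩ := (valid_append _ _ _).1 hv₁
      have hl₁ : s₁.length ≤ n := by
        simp only [List.length_append] at hlen₁; omega
      obtain ⟨r, s₂, hr, hv₂, hs₂, hlen₂, hc₂⟩ := ih s₁ hl₁ _ (blk d.2) hvs₁
      -- Rearranging preserves all counts, and `s₁` has no conflict at `i`; hence neither has its
      -- part `s₂`.
      have hi₂ : ∀ d' ∈ s₂, ¬ Touches blk d' i := by
        have h0 := hc₂ i
        rw [cnt_eq_zero.2 hs₁, cnt_append] at h0
        exact cnt_eq_zero.1 (by omega)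
      obtain ⟨hvr, hvs₂⟩ := (valid_append _ _ _).1 hv₂
      have hcount : ∀ j, cnt blk l.post j + (cnt blk r.post j + cnt blk s₂ j) = cnt blk s₀ j := by
        intro j
        rw [← hc₁, cnt_append, ← hc₂, cnt_append]
      have hvd : Valid G blk R (fun j => c j + cnt blk l.post j + cnt blk r.post j)
          (s₂ ++ [d]) := by
        refine (valid_append _ _ _).2 ⟨hvs₂, hd.congr ?_ ?_, trivial⟩
        · simp only [← hcount]; ring
        · simp only [← hcount]; ring
      have hvd' := valid_commute s₂ (hdi ▸ hi₂) hs₂ _ hvd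
      refine ⟨.node d l r, s₂, ⟨hdi, hd.1, hl, hr⟩, ?_, hi₂, ?_, ?_⟩
      · simp only [WTree.post, List.append_assoc, List.singleton_append]
        exact (valid_append _ _ _).2 ⟨hvl, (valid_append _ _ _).2 ⟨hvr, hvd'⟩⟩
      · simp only [WTree.post, List.length_append, List.length_singleton] at *
        omega
      · intro j
        simp only [WTree.post, cnt_append, cnt_cons, cnt_nil, hde, ← hcount]
        ring
    -- The last conflict does not involve `i` and simply stays at the end.
    · obtain ⟨t, s', ht, hv', hs', hlen, hc⟩ := ih s₀ hs c i hv₀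
      refine ⟨t, s' ++ [e], ht, ?_, ?_, ?_, ?_⟩
      · rw [← List.append_assoc]
        refine (valid_append _ _ _).2 ⟨hv', he.congr ?_ ?_, trivial⟩ <;> simp [hc]
      · simpa [or_imp, forall_and, hei] using hs'
      · rw [← List.append_assoc, List.length_append, hlen, List.length_append]
      · intro j
        rw [← List.append_assoc, cnt_append, hc, cnt_append]

/-- A conflict raises the count by at most one, so no value is skipped. -/
theorem exists_prefix_cnt (i : ι) (s : List (V × V)) :
    ∀ k ≤ cnt blk s i, ∃ p, p <+: s ∧ cnt blk p i = k := by
  induction s using List.reverseRecOn with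
  | nil => intro k hk; exact ⟨[], List.prefix_rfl, by simp at hk; simp [hk]⟩
  | append_singleton s e ih =>
    intro k hk
    rcases hk.eq_or_lt with rfl | hk
    · exact ⟨_, List.prefix_rfl, rfl⟩
    · obtain ⟨p, hp, hc⟩ := ih k (by
        rw [cnt_append, cnt_cons] at hk; simp only [cnt_nil] at hk; split_ifs at hk <;> omega)
      exact ⟨p, hp.trans (List.prefix_append _ _), hc⟩

/-- The `k`-th entry of the block `i` being reached is witnessed by a tree. -/
theorem exists_tree {R : ι → ℕ → V} {s : List (V × V)} (hs : Valid G blk R (fun _ => 0) s)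
    {i : ι} {k : ℕ} (hk : k ≤ cnt blk s i) :
    ∃ t, IsTree G blk i t ∧ t.size ≤ s.length ∧ Valid G blk R (fun _ => 0) t.post ∧
      cnt blk t.post i = k := by
  obtain ⟨p, ⟨q, rfl⟩, hc⟩ := exists_prefix_cnt i s k hk
  obtain ⟨t, s', ht, hv, hs', hlen, hcnt⟩ :=
    exists_tree_append p.length p le_rfl _ i ((valid_append _ _ _).1 hs).1
  refine ⟨t, ht, ?_, ((valid_append _ _ _).1 hv).1, ?_⟩
  · rw [← WTree.length_post]
    simp only [List.length_append] at *
    omega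
  · rw [← hc, ← hcnt, cnt_append, cnt_eq_zero.2 hs', add_zero]

/-- Ties the labels of a log to table entries before the final counter. If all those entries equal
`v`, so do the labels in the block of `v`, which turns a tree into a spine. -/
theorem Valid.entry {R : ι → ℕ → V} {s : List (V × V)} : ∀ {c : ι → ℕ},
    Valid G blk R c s → ∀ d ∈ s,
    ∃ k, k < c (blk d.1) + cnt blk s (blk d.1) ∧ R (blk d.1) k = d.1 := by
  induction s with
  | nil => simp
  | cons e s ih =>
    intro c h d hd
    rcases List.mem_cons.1 hd with rfl | hd
    · exact ⟨_, by simp [cnt_cons, Touches], h.1.2.2.1⟩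
    · obtain ⟨k, hk, hR⟩ := ih h.2 d hd
      exact ⟨k, by simpa [bump, cnt_cons, add_assoc] using hk, hR⟩

/-- An entry of the block of `v` that differs from `v`, while the earlier ones equal `v`, is
witnessed by a tree with left spine `v`. -/
theorem exists_spine {R : ι → ℕ → V} {s : List (V × V)} (hs : Valid G blk R (fun _ => 0) s)
    {v : V} {k : ℕ} (hk : k ≤ cnt blk s (blk v)) (hv : R (blk v) k ≠ v) :
    ∃ t, IsSpine G blk v t ∧ t.size ≤ s.length ∧ Valid G blk R (fun _ => 0) t.post ∧
      R (blk v) (cnt blk t.post (blk v)) ≠ v := by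
  classical
  -- The tree is taken at the first entry that differs from `v`; it is reached, since a later one
  -- is.
  have hex : ∃ k, R (blk v) k ≠ v := ⟨k, hv⟩
  obtain ⟨t, h1, h2, h3, h4⟩ := exists_tree hs ((Nat.find_min' hex hv).trans hk)
  refine ⟨t, h1.isSpine fun d hd hb => ?_, h2, h3, ?_⟩
  · obtain ⟨k', hk', hR⟩ := h3.entry d hd
    rw [hb, h4, zero_add] at hk'
    have := Nat.find_min hex hk'
    rw [hb] at hR
    rw [← hR]; exact not_not.1 this
  · rw [h4]; exact Nat.find_spec hex

end Logs
end Resampling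

namespace Resampling

/-! ### Uniform probability on finite types -/

section Prob
variable {Ω : Type*} [Fintype Ω]

open Classical in
/-- The probability of an event under the uniform distribution. -/
noncomputable def prob (p : Ω → Prop) : ℝ := (#{x | p x} : ℝ) / Fintype.card Ω

theorem prob_eq (p : Ω → Prop) [DecidablePred p] :
    prob p = (#{x | p x} : ℝ) / Fintype.card Ω := by
  unfold prob; congr!

theorem prob_nonneg (p : Ω → Prop) : 0 ≤ prob p := by unfold prob; positivity

theorem prob_mono {p q : Ω → Prop} (h : ∀ x, p x → q x) : prob p ≤ prob q := by
  classical
  rw [prob_eq, prob_eq]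
  gcongr with x
  exact h x

theorem prob_congr {p q : Ω → Prop} (h : ∀ x, p x ↔ q x) : prob p = prob q :=
  le_antisymm (prob_mono fun x => (h x).1) (prob_mono fun x => (h x).2)

theorem prob_exists_le {α : Type*} (F : Finset α) (p : α → Ω → Prop) :
    prob (fun x => ∃ a ∈ F, p a x) ≤ ∑ a ∈ F, prob (p a) := by
  classical
  simp only [prob_eq]
  rw [← Finset.sum_div]
  gcongr
  have : (univ.filter fun x => ∃ a ∈ F, p a x) ⊆ F.biUnion fun a => univ.filter (p a) := by
    intro x; simp
  exact_mod_cast (card_le_card this).trans card_biUnion_le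

theorem prob_not [Nonempty Ω] (p : Ω → Prop) : prob (fun x => ¬ p x) = 1 - prob p := by
  classical
  rw [prob_eq, prob_eq, eq_sub_iff_add_eq, ← add_div, div_eq_one_iff_eq (by simp)]
  have := Finset.card_filter_add_card_filter_not (s := (univ : Finset Ω)) p
  rw [add_comm, card_univ] at this
  exact_mod_cast this

theorem prob_le_one (p : Ω → Prop) : prob p ≤ 1 := by
  classical
  unfold prob
  refine div_le_one_of_le₀ ?_ (by positivity)
  exact_mod_cast card_le_univ _

theorem prob_or_le (p q : Ω → Prop) : prob (fun x => p x ∨ q x) ≤ prob p + prob q := by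
  classical
  rw [prob_eq, prob_eq, prob_eq, ← add_div]
  gcongr
  rw [Finset.filter_or]
  exact_mod_cast card_union_le _ _

/-- Markov's inequality for the size of a random finite set. -/
theorem mul_prob_card_le {α : Type*} (F : Finset α) (p : α → Ω → Prop) (k : ℝ) (q : Ω → Prop)
    (h : ∀ x, q x → ∃ F' ⊆ F, (∀ a ∈ F', p a x) ∧ k ≤ #F') :
    k * prob q ≤ ∑ a ∈ F, prob (p a) := by
  classical
  unfold prob
  rw [← Finset.sum_div, ← mul_div_assoc]
  gcongr
  calc k * (#{x | q x} : ℝ) = ∑ x with q x, k := by simp [mul_comm]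
    _ ≤ ∑ x with q x, (#{a ∈ F | p a x} : ℝ) := by
      refine sum_le_sum fun x hx => ?_
      obtain ⟨F', hF, hp, hk⟩ := h x (by simpa using hx)
      refine hk.trans ?_
      gcongr
      intro a ha
      simp [hF ha, hp a ha]
    _ ≤ ∑ x, (#{a ∈ F | p a x} : ℝ) :=
      sum_le_sum_of_subset_of_nonneg (filter_subset _ _) fun _ _ _ => by positivity
    _ = ∑ a ∈ F, (#{x | p a x} : ℝ) := by
      simp only [card_filter, Nat.cast_sum]
      exact sum_comm

theorem prob_pi {C E : Type*} [Fintype C] [DecidableEq C] [Fintype E] (A : C → Finset E) :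
    prob (fun R : C → E => ∀ x, R x ∈ A x) = ∏ x, (#(A x) : ℝ) / Fintype.card E := by
  classical
  rw [prob_eq]
  have : (univ.filter fun R : C → E => ∀ x, R x ∈ A x) = Fintype.piFinset A := by
    ext; simp
  rw [this, Fintype.card_piFinset]
  simp [Finset.prod_div_distrib]

end Prob

/-! ### Random tables -/

section Table
set_option linter.unusedSectionVars false
variable {V ι E : Type*} [DecidableEq ι] [Fintype ι] [Fintype E] [Inhabited E]
  {G : SimpleGraph V} {blk : V → ι} {K : ℕ}

/-- The table of vertices that a finite table of random entries describes. -/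
def tab (val : ι → E → V) (R : ι × Fin K → E) (i : ι) (k : ℕ) : V :=
  val i (if h : k < K then R (i, ⟨k, h⟩) else default)

theorem tab_of_lt {val : ι → E → V} {R : ι × Fin K → E} {i : ι} {k : ℕ} (h : k < K) :
    tab val R i k = val i (R (i, ⟨k, h⟩)) := by simp [tab, h]

/-- A cell `x` with `A x = univ` is still unconstrained, so a condition on it contributes an
independent factor. -/
theorem prod_update_univ [DecidableEq E] {C : Type*} [Fintype C] [DecidableEq C]
    (A : C → Finset E) (x : C) (S : Finset E) (h : A x = univ) :
    ∏ y, (#(Function.update A x S y) : ℝ) / Fintype.card E =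
      (#S : ℝ) / Fintype.card E * ∏ y, (#(A y) : ℝ) / Fintype.card E := by
  rw [← mul_prod_erase univ _ (mem_univ x), ← mul_prod_erase univ
    (fun y => (#(A y) : ℝ) / Fintype.card E) (mem_univ x)]
  have h1 : ∀ y ∈ univ.erase x, (#(Function.update A x S y) : ℝ) / Fintype.card E =
      (#(A y) : ℝ) / Fintype.card E := by
    intro y hy
    rw [Function.update_of_ne (ne_of_mem_erase hy)]
  rw [prod_congr rfl h1, Function.update_self, h, card_univ, div_self (by simp), one_mul]

/-- The probability weight of the conflicts in a log. -/
noncomputable def listWeight (q : V → ℝ) (s : List (V × V)) : ℝ :=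
  (s.map fun d => q d.1 * q d.2).prod

/-- A conflict reads the cells of its two blocks at the current counters and then advances both
counters, so no cell is read twice. The cell `(i₀, k₀)`, just past all the cells of `i₀` that the
log reads, is still free for a last condition `U`. The first conclusion carries the induction: cells
before the counters stay unconstrained, so those read by the head of the log are free when the tail
is done. -/
theorem exists_constraints (val : ι → E → V) (q : V → ℝ) (hq : ∀ v, 0 ≤ q v)
    (hval : ∀ v, prob (fun e => val (blk v) e = v) ≤ q v) (i₀ : ι) (U : Finset E)
    (s : List (V × V)) : ∀ (c : ι → ℕ) (_ : ∀ i, c i + cnt blk s i < K)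
    (_ : ∀ d ∈ s, blk d.1 ≠ blk d.2) (k₀ : Fin K) (_ : (k₀ : ℕ) = c i₀ + cnt blk s i₀),
    ∃ A : ι × Fin K → Finset E, (∀ x, (x.2 : ℕ) < c x.1 → A x = univ) ∧
      (∀ R, Valid G blk (tab val R) c s ∧ R (i₀, k₀) ∈ U → ∀ x, R x ∈ A x) ∧
      ∏ x, (#(A x) : ℝ) / Fintype.card E ≤ listWeight q s * (#U / Fintype.card E) := by
  classical
  induction s with
  | nil =>
    intro c hc _ k₀ hk
    refine ⟨Function.update (fun _ => univ) (i₀, k₀) U, ?_, ?_, ?_⟩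
    · rintro ⟨i, k⟩ h
      refine Function.update_of_ne ?_ _ _
      rintro h'
      simp only [Prod.mk.injEq] at h'
      obtain ⟨rfl, rfl⟩ := h'
      simp at hk h
      omega
    · rintro R ⟨-, h⟩ x
      rcases eq_or_ne x (i₀, k₀) with rfl | hx
      · simpa using h
      · simp [Function.update_of_ne hx]
    · rw [prod_update_univ (fun _ => univ) _ _ rfl]
      simp [listWeight]
  | cons d s ih =>
    intro c hc hne k₀ hk
    simp only [List.mem_cons, forall_eq_or_imp] at hne
    have hcb : ∀ i, bump blk c d i + cnt blk s i = c i + cnt blk (d :: s) i := by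
      intro i; simp only [bump, cnt_cons]; ring
    obtain ⟨A, hA, hR, hw⟩ := ih (bump blk c d) (fun i => by rw [hcb]; exact hc i) hne.2 k₀
      (by rw [hcb]; exact hk)
    have b1 : bump blk c d (blk d.1) = c (blk d.1) + 1 := by simp [bump, Touches]
    have b2 : bump blk c d (blk d.2) = c (blk d.2) + 1 := by simp [bump, Touches]
    have l1 : c (blk d.1) < K := by have := hc (blk d.1); omega
    have l2 : c (blk d.2) < K := by have := hc (blk d.2); omega
    set x1 : ι × Fin K := (blk d.1, ⟨_, l1⟩) with hx1
    set x2 : ι × Fin K := (blk d.2, ⟨_, l2⟩) with hx2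
    have h12 : x2 ≠ x1 := fun h => hne.1 (congrArg Prod.fst h).symm
    set S1 : Finset E := {e | val (blk d.1) e = d.1}
    set S2 : Finset E := {e | val (blk d.2) e = d.2}
    have hA1 : A x1 = univ := hA _ (by simp [x1, b1])
    have hA2 : A x2 = univ := hA _ (by simp [x2, b2])
    refine ⟨Function.update (Function.update A x1 S1) x2 S2, ?_, ?_, ?_⟩
    · intro x hx
      have n1 : x ≠ x1 := fun h => by rw [h] at hx; exact lt_irrefl _ hx
      have n2 : x ≠ x2 := fun h => by rw [h] at hx; exact lt_irrefl _ hx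
      rw [Function.update_of_ne n2, Function.update_of_ne n1]
      exact hA x (hx.trans_le (by simp [bump]))
    · rintro R ⟨⟨⟨-, -, e1, e2⟩, hv⟩, hU⟩ x
      rcases eq_or_ne x x2 with rfl | n2
      · rw [Function.update_self]
        rw [tab_of_lt l2] at e2
        simpa [S2] using e2
      rw [Function.update_of_ne n2]
      rcases eq_or_ne x x1 with rfl | n1
      · rw [Function.update_self]
        rw [tab_of_lt l1] at e1
        simpa [S1] using e1
      rw [Function.update_of_ne n1]
      exact hR R ⟨hv, hU⟩ x
    · rw [prod_update_univ _ _ _ (by rw [Function.update_of_ne h12, hA2]),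
        prod_update_univ _ _ _ hA1]
      have p1 : (#S1 : ℝ) / Fintype.card E ≤ q d.1 := by
        simpa only [prob_eq] using hval d.1
      have p2 : (#S2 : ℝ) / Fintype.card E ≤ q d.2 := by
        simpa only [prob_eq] using hval d.2
      calc _ ≤ q d.2 * (q d.1 * (listWeight q s * (#U / Fintype.card E))) := by
            refine mul_le_mul p2 (mul_le_mul p1 hw (prod_nonneg fun _ _ => by positivity) (hq _))
              (mul_nonneg (by positivity) (prod_nonneg fun _ _ => by positivity)) (hq _)
        _ = _ := by simp only [listWeight, List.map_cons, List.prod_cons]; ring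

/-- The extra condition `p` concerns the entry shown after the log, which the log has not read and
which is therefore independent of it. -/
theorem prob_valid_le (val : ι → E → V) (q : V → ℝ) (hq : ∀ v, 0 ≤ q v)
    (hval : ∀ v, prob (fun e => val (blk v) e = v) ≤ q v) (i₀ : ι) (p : V → Prop)
    {s : List (V × V)} (hs : s.length < K) :
    prob (fun R : ι × Fin K → E => Valid G blk (tab val R) (fun _ => 0) s ∧
        p (tab val R i₀ (cnt blk s i₀))) ≤ listWeight q s * prob (fun e => p (val i₀ e)) := by
  classical
  have hc : ∀ i, cnt blk s i < K := fun i => (List.countP_le_length).trans_lt hs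
  by_cases hne : ∀ d ∈ s, blk d.1 ≠ blk d.2
  · obtain ⟨A, -, hR, hw⟩ := exists_constraints (G := G) val q hq hval i₀
      (univ.filter fun e => p (val i₀ e)) s (fun _ => 0) (by simpa using hc) hne
      ⟨cnt blk s i₀, hc i₀⟩ (by simp)
    rw [← prob_pi] at hw
    refine (prob_mono fun R hR' => hR R ⟨hR'.1, ?_⟩).trans (hw.trans (le_of_eq ?_))
    · have := hR'.2
      rw [tab_of_lt (hc i₀)] at this
      simpa using this
    · rw [prob_eq]
  -- A log with a conflict inside a single block is never valid, so its probability is zero.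
  · have hno : ∀ R : ι × Fin K → E, ∀ c, ¬ Valid G blk (tab val R) c s := by
      intro R c hv
      apply hne
      clear hne hs hc
      induction s generalizing c with
      | nil => simp
      | cons d s ih =>
        simp only [List.mem_cons, forall_eq_or_imp]
        exact ⟨hv.1.2.1, ih _ hv.2⟩
    have h0 : prob (fun R : ι × Fin K → E => Valid G blk (tab val R) (fun _ => 0) s ∧
        p (tab val R i₀ (cnt blk s i₀))) = 0 := by
      simp [prob, hno]
    rw [h0]
    refine mul_nonneg (List.prod_nonneg ?_) (prob_nonneg _)
    simp only [List.mem_map]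
    rintro _ ⟨d, -, rfl⟩
    exact mul_nonneg (hq _) (hq _)

end Table

/-! ### The total weight of the witness trees -/

section Weight
set_option linter.unusedSectionVars false
variable {V ι : Type*} [DecidableEq ι] [Fintype V] (G : SimpleGraph V) (blk : V → ι)

namespace WTree
/-- The probability weight of a witness tree. -/
noncomputable def weight (ϖ : V → ℝ) : WTree (V × V) → ℝ
  | nil => 1
  | node d l r => ϖ d.1 * ϖ d.2 * (l.weight ϖ * r.weight ϖ)

theorem weight_nonneg {ϖ : V → ℝ} (h : ∀ v, 0 ≤ ϖ v) (t : WTree (V × V)) : 0 ≤ t.weight ϖ := by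
  induction t with
  | nil => simp [weight]
  | node d l r hl hr =>
    have := h d.1; have := h d.2
    simp only [weight]; positivity

/-- Each node contributes two vertices, hence two factors `a`. -/
theorem listWeight_post (ϖ : V → ℝ) (a : ℝ) (t : WTree (V × V)) :
    listWeight (fun v => a * ϖ v) t.post = a ^ (2 * t.size) * t.weight ϖ := by
  induction t with
  | nil => simp [weight, listWeight, post, size]
  | node d l r hl hr =>
    simp only [listWeight, post, size, weight, List.map_append, List.prod_append, List.map_cons,
      List.map_nil, List.prod_cons, List.prod_nil] at *
    rw [hl, hr]; ring
end WTree

open Classical in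
/-- The witness trees for the block `i` of height at most `h`. -/
noncomputable def trees : ℕ → ι → Finset (WTree (V × V))
  | 0, _ => {.nil}
  | h + 1, i => insert .nil ((univ.filter fun d : V × V => blk d.1 = i ∧ G.Adj d.1 d.2).biUnion
      fun d => (trees h i ×ˢ trees h (blk d.2)).image fun p => .node d p.1 p.2)

open Classical in
/-- The witness trees with left spine `v` of height at most `h`. -/
noncomputable def spines (v : V) : ℕ → Finset (WTree (V × V))
  | 0 => {.nil}
  | h + 1 => insert .nil ((univ.filter fun d : V × V => d.1 = v ∧ G.Adj d.1 d.2).biUnion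
      fun d => (spines v h ×ˢ trees G blk h (blk d.2)).image fun p => .node d p.1 p.2)

variable {G blk}

theorem IsTree.mem_trees : ∀ {t : WTree (V × V)} {i : ι} (_ : IsTree G blk i t) {h : ℕ},
    t.size ≤ h → t ∈ trees G blk h i := by
  intro t
  induction t with
  | nil => intro i _ h _; cases h <;> simp [trees]
  | node d l r hl hr =>
    rintro i ⟨h1, h2, h3, h4⟩ h hh
    cases h with
    | zero => simp [WTree.size] at hh
    | succ h =>
      simp only [WTree.size] at hh
      simp only [trees, mem_insert, reduceCtorEq, mem_biUnion, mem_filter, mem_univ, true_and,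
        mem_image, mem_product, Prod.exists, false_or]
      exact ⟨d.1, d.2, ⟨h1, h2⟩, l, r, ⟨hl h3 (by omega), hr h4 (by omega)⟩, rfl⟩

theorem IsSpine.mem_spines {v : V} : ∀ {t : WTree (V × V)} (_ : IsSpine G blk v t) {h : ℕ},
    t.size ≤ h → t ∈ spines G blk v h := by
  intro t
  induction t with
  | nil => intro _ h _; cases h <;> simp [spines]
  | node d l r hl hr =>
    rintro ⟨h1, h2, h3, h4⟩ h hh
    cases h with
    | zero => simp [WTree.size] at hh
    | succ h =>
      simp only [WTree.size] at hh
      simp only [spines, mem_insert, reduceCtorEq, mem_biUnion, mem_filter, mem_univ, true_and,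
        mem_image, mem_product, Prod.exists, false_or]
      exact ⟨d.1, d.2, ⟨h1, h2⟩, l, r, ⟨hl h3 (by omega), h4.mem_trees (by omega)⟩, rfl⟩

/-- The recursion of the generating function: a tree determines its root and its two subtrees, so
the sum over trees factors. -/
theorem sum_node_eq {ϖ : V → ℝ} (D : Finset (V × V)) (S T : V × V → Finset (WTree (V × V)))
    [DecidableEq (WTree (V × V))] :
    ∑ t ∈ D.biUnion fun d => (S d ×ˢ T d).image fun p => WTree.node d p.1 p.2, t.weight ϖ =
      ∑ d ∈ D, ϖ d.1 * ϖ d.2 * ((∑ l ∈ S d, l.weight ϖ) * ∑ r ∈ T d, r.weight ϖ) := by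
  rw [sum_biUnion]
  · refine sum_congr rfl fun d _ => ?_
    rw [sum_image, sum_product, sum_mul_sum, mul_sum]
    · refine sum_congr rfl fun l _ => ?_
      rw [mul_sum]
      rfl
    · rintro ⟨a, b⟩ - ⟨a', b'⟩ - h
      simpa using h
  · intro d _ d' _ hne
    rw [Function.onFun, disjoint_left]
    simp only [mem_image, not_exists, not_and, forall_exists_index, and_imp]
    rintro _ p - rfl p' - h
    simp only [WTree.node.injEq] at h
    exact hne h.1.symm

variable {ϖ : V → ℝ} {β y : ℝ} {Δ : ℕ}

open Classical in
theorem sum_adj_le (hϖ : ∀ v, 0 ≤ ϖ v) (hβ : ∀ v, ϖ v ≤ β) (hΔ : ∀ v, #{z | G.Adj v z} ≤ Δ) (v : V) :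
    ∑ z with G.Adj v z, ϖ z ≤ Δ * β := by
  calc ∑ z with G.Adj v z, ϖ z ≤ ∑ z with G.Adj v z, β := sum_le_sum fun z _ => hβ z
    _ = #{z | G.Adj v z} * β := by rw [sum_const, nsmul_eq_mul]
    _ ≤ Δ * β := by
      gcongr
      · exact (hϖ v).trans (hβ v)
      · exact hΔ v

-- Induction on the height. The empty tree has weight 1. For the others, the two subtrees contribute
-- at most `(1 + y)²`, the first vertex of the root at most 1 in total, and its neighbours at most
-- `Δβ`. So `1 + y` is preserved as soon as `Δβ(1 + y)² ≤ y`.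
open Classical in
theorem sum_trees_le (hϖ : ∀ v, 0 ≤ ϖ v) (hβ : ∀ v, ϖ v ≤ β) (hΔ : ∀ v, #{z | G.Adj v z} ≤ Δ)
    (hsum : ∀ i, ∑ v with blk v = i, ϖ v = 1) (hy : 0 ≤ y) (hy' : Δ * β * (1 + y) ^ 2 ≤ y)
    (h : ℕ) : ∀ i, ∑ t ∈ trees G blk h i, t.weight ϖ ≤ 1 + y := by
  induction h with
  | zero => intro i; simp [trees, WTree.weight, hy]
  | succ h ih =>
    intro i
    rw [trees, sum_insert (by simp), sum_node_eq, WTree.weight]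
    gcongr
    calc _ ≤ ∑ d : V × V with blk d.1 = i ∧ G.Adj d.1 d.2,
            ϖ d.1 * ϖ d.2 * ((1 + y) * (1 + y)) := by
          refine sum_le_sum fun d _ => ?_
          have := hϖ d.1; have := hϖ d.2
          gcongr
          · exact sum_nonneg fun t _ => WTree.weight_nonneg hϖ t
          · exact ih _
          · exact ih _
      _ = ∑ u with blk u = i, ϖ u * (∑ z with G.Adj u z, ϖ z) * (1 + y) ^ 2 := by
          rw [sum_filter, Fintype.sum_prod_type, sum_filter]
          refine sum_congr rfl fun u _ => ?_
          split_ifs with hu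
          · rw [mul_sum, sum_mul, sum_filter]
            refine sum_congr rfl fun z _ => ?_
            simp only [hu, true_and]
            split_ifs <;> ring
          · simp [hu]
      _ ≤ ∑ u with blk u = i, ϖ u * (Δ * β) * (1 + y) ^ 2 := by
          refine sum_le_sum fun u _ => ?_
          have := hϖ u
          gcongr
          exact sum_adj_le hϖ hβ hΔ u
      _ = Δ * β * (1 + y) ^ 2 := by
          rw [← sum_mul, ← sum_mul, hsum, one_mul]
      _ ≤ y := hy'

-- Each node of the spine costs `β` for `v`, `Δβ` for its neighbour and `1 + y` for the right
-- subtree. Summing over the length of the spine gives a geometric series.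
open Classical in
theorem sum_spines_le (hϖ : ∀ v, 0 ≤ ϖ v) (hβ : ∀ v, ϖ v ≤ β) (hΔ : ∀ v, #{z | G.Adj v z} ≤ Δ)
    (hsum : ∀ i, ∑ v with blk v = i, ϖ v = 1) (hy : 0 ≤ y) (hy' : Δ * β * (1 + y) ^ 2 ≤ y)
    (v : V) (h1 : Δ * β ^ 2 * (1 + y) < 1) (h : ℕ) :
    ∑ t ∈ spines G blk v h, t.weight ϖ ≤ 1 / (1 - Δ * β ^ 2 * (1 + y)) := by
  have hβ0 : 0 ≤ β := (hϖ v).trans (hβ v)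
  set a := Δ * β ^ 2 * (1 + y) with ha
  have ha0 : 0 ≤ a := by positivity
  have h1a : 0 < 1 - a := by linarith
  induction h with
  | zero =>
    simp only [spines, sum_singleton, WTree.weight]
    rw [le_div_iff₀ h1a]; linarith
  | succ h ih =>
    rw [spines, sum_insert (by simp), sum_node_eq, WTree.weight]
    calc _ ≤ 1 + ∑ d : V × V with d.1 = v ∧ G.Adj d.1 d.2,
            ϖ d.1 * ϖ d.2 * (1 / (1 - a) * (1 + y)) := by
          gcongr with d
          · exact mul_nonneg (hϖ _) (hϖ _)
          · exact sum_nonneg fun t _ => WTree.weight_nonneg hϖ t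
          · exact sum_trees_le hϖ hβ hΔ hsum hy hy' _ _
      _ = 1 + ϖ v * (∑ z with G.Adj v z, ϖ z) * (1 / (1 - a) * (1 + y)) := by
          congr 1
          rw [sum_filter, Fintype.sum_prod_type, Finset.sum_eq_single v]
          · rw [mul_sum, sum_mul, sum_filter]
            refine sum_congr rfl fun z _ => ?_
            simp only [true_and]
          · intro u _ hu; simp [hu]
          · simp
      _ ≤ 1 + β * (Δ * β) * (1 / (1 - a) * (1 + y)) := by
          have h2 : 0 ≤ ∑ z with G.Adj v z, ϖ z := sum_nonneg fun z _ => hϖ z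
          have h3 := sum_adj_le hϖ hβ hΔ v
          gcongr
          exact hβ v
      _ = 1 + a / (1 - a) := by rw [ha]; ring
      _ = 1 / (1 - a) := by field_simp; ring

end Weight
end Resampling

/-! ### Running time and expected weight of the resampling process -/

namespace Resampling

section Core
set_option linter.unusedSectionVars false
variable {V ι E : Type*} [DecidableEq ι] [Fintype ι] [Fintype V] [Fintype E] [Inhabited E]
  {G : SimpleGraph V} {blk : V → ι} {K S Δ : ℕ} {val : ι → E → V} {ϖ : V → ℝ} {a β y : ℝ}

theorem sum_cnt {R : ι → ℕ → V} {s : List (V × V)} : ∀ {c : ι → ℕ}, Valid G blk R c s →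
    ∑ i, cnt blk s i = 2 * s.length := by
  induction s with
  | nil => simp
  | cons d s ih =>
    intro c h
    have h2 : ∀ i, (if Touches blk d i then 1 else 0) =
        (if blk d.1 = i then 1 else 0) + if blk d.2 = i then 1 else 0 := by
      intro i
      have := h.1.2.1
      by_cases h1 : blk d.1 = i <;> by_cases h2 : blk d.2 = i <;> simp_all [Touches]
    simp only [cnt_cons, h2, sum_add_distrib, ih h.2, List.length_cons]
    simp; ring

-- Each of the values `1, …, cnt blk s i` of the counter has its own tree. The trees are distinct
-- because their numbers of conflicts at `i` are.
open Classical in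
theorem exists_trees_of_cnt {R : ι → ℕ → V} {s : List (V × V)}
    (hs : Valid G blk R (fun _ => 0) s) (hS : s.length ≤ S) (i : ι) :
    ∃ F ⊆ (trees G blk S i).filter (fun t => t ≠ .nil ∧ t.size ≤ S),
      (∀ t ∈ F, Valid G blk R (fun _ => 0) t.post) ∧ cnt blk s i = #F := by
  have : Nonempty (WTree (V × V)) := ⟨.nil⟩
  choose! t ht1 ht2 ht3 ht4 using fun k (hk : k ≤ cnt blk s i) => exists_tree hs (i := i) hk
  refine ⟨(Icc 1 (cnt blk s i)).image t, ?_, ?_, ?_⟩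
  · intro x
    simp only [mem_image, mem_Icc, mem_filter]
    rintro ⟨k, ⟨h1, h2⟩, rfl⟩
    refine ⟨(ht1 k h2).mem_trees ((ht2 k h2).trans hS), fun h0 => ?_, (ht2 k h2).trans hS⟩
    have := ht4 k h2
    rw [h0] at this
    simp [WTree.post] at this
    omega
  · simp only [mem_image, mem_Icc]
    rintro x ⟨k, ⟨h1, h2⟩, rfl⟩
    exact ht3 k h2
  · rw [card_image_of_injOn, Nat.card_Icc, Nat.add_sub_cancel]
    intro k hk k' hk' h
    simp only [coe_Icc, Set.mem_Icc] at hk hk'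
    rw [← ht4 k hk.2, ← ht4 k' hk'.2, h]

/-- Entries follow `ϖ` only up to the factor `a`, and a tree of size at most `S` reads at most `2S`
cells. The table must have more than `S` columns so that the entry after the tree exists. -/
theorem prob_post_le (hϖ : ∀ v, 0 ≤ ϖ v) (ha : 1 ≤ a)
    (hval : ∀ v, prob (fun e => val (blk v) e = v) ≤ a * ϖ v) (hSK : S < K) (i : ι)
    (p : V → Prop) {t : WTree (V × V)} (ht : t.size ≤ S) :
    prob (fun R : ι × Fin K → E => Valid G blk (tab val R) (fun _ => 0) t.post ∧
      p (tab val R i (cnt blk t.post i))) ≤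
      a ^ (2 * S) * t.weight ϖ * prob (fun e => p (val i e)) := by
  refine (prob_valid_le val (fun v => a * ϖ v) (fun v => mul_nonneg (by linarith) (hϖ v)) hval i
    p (by rw [WTree.length_post]; omega)).trans ?_
  rw [WTree.listWeight_post]
  gcongr
  · exact prob_nonneg _
  · exact WTree.weight_nonneg hϖ t

open Classical in
/-- The resampling process rarely makes many steps. -/
theorem prob_long_le (hϖ : ∀ v, 0 ≤ ϖ v) (hβ : ∀ v, ϖ v ≤ β)
    (hΔ : ∀ v, #{z | G.Adj v z} ≤ Δ) (hsum : ∀ i, ∑ v with blk v = i, ϖ v = 1) (hy : 0 ≤ y)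
    (hy' : Δ * β * (1 + y) ^ 2 ≤ y) (ha : 1 ≤ a)
    (hval : ∀ v, prob (fun e => val (blk v) e = v) ≤ a * ϖ v) (hSK : S < K)
    (log : (ι × Fin K → E) → List (V × V))
    (hlog : ∀ R, Valid G blk (tab val R) (fun _ => 0) (log R)) :
    (2 * S : ℝ) * prob (fun R => (log R).length = S) ≤ Fintype.card ι * y * a ^ (2 * S) := by
  -- A log of length `S` makes `2S` different nonempty trees valid, counted over all blocks, because
  -- each conflict involves two blocks.
  have key := mul_prob_card_le ((univ : Finset ι).sigma fun i =>
      (trees G blk S i).filter (fun t => t ≠ .nil ∧ t.size ≤ S))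
    (fun x R => Valid G blk (tab val R) (fun _ => 0) x.2.post) (2 * S)
    (fun R : ι × Fin K → E => (log R).length = S) (by
      intro R hR
      choose F hF1 hF2 hF3 using exists_trees_of_cnt (S := S) (hlog R) hR.le
      refine ⟨univ.sigma F, sigma_mono (subset_refl _) hF1, ?_, ?_⟩
      · simp only [mem_sigma]
        rintro ⟨i, t⟩ ⟨-, ht⟩
        exact hF2 i t ht
      · rw [card_sigma]
        simp only [← hF3]
        rw [sum_cnt (hlog R), hR]
        push_cast; rfl)
  refine key.trans ?_
  rw [sum_sigma]
  calc _ ≤ ∑ i : ι, a ^ (2 * S) * y := ?_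
    _ = _ := by simp; ring
  refine sum_le_sum fun i _ => ?_
  calc _ ≤ ∑ t ∈ (trees G blk S i).filter (fun t => t ≠ .nil ∧ t.size ≤ S),
        a ^ (2 * S) * t.weight ϖ := by
        refine sum_le_sum fun t ht => ?_
        have h := prob_post_le (G := G) (S := S) hϖ ha hval hSK i (fun _ => True)
          (mem_filter.1 ht).2.2
        refine (prob_mono fun R hR => ⟨hR, trivial⟩).trans (h.trans ?_)
        refine mul_le_of_le_one_right ?_ (prob_le_one _)
        exact mul_nonneg (by positivity) (WTree.weight_nonneg hϖ t)
    _ ≤ ∑ t ∈ (trees G blk S i).erase .nil, a ^ (2 * S) * t.weight ϖ := by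
        refine sum_le_sum_of_subset_of_nonneg ?_ fun t _ _ =>
          mul_nonneg (by positivity) (WTree.weight_nonneg hϖ t)
        intro t; simp only [mem_filter, mem_erase]; tauto
    _ ≤ _ := by
        rw [← mul_sum]
        gcongr
        have h1 := sum_trees_le hϖ hβ hΔ hsum hy hy' S i
        have h2 : WTree.nil ∈ trees G blk S i := IsTree.mem_trees (t := .nil) trivial (by simp [WTree.size])
        rw [← add_sum_erase _ _ h2] at h1
        simp only [WTree.weight] at h1
        linarith

open Classical in
/-- A vertex of full probability is likely to be selected, and never to be given up. -/
theorem prob_leave_le (hϖ : ∀ v, 0 ≤ ϖ v) (hβ : ∀ v, ϖ v ≤ β)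
    (hΔ : ∀ v, #{z | G.Adj v z} ≤ Δ) (hsum : ∀ i, ∑ v with blk v = i, ϖ v = 1) (hy : 0 ≤ y)
    (hy' : Δ * β * (1 + y) ^ 2 ≤ y) (h1 : Δ * β ^ 2 * (1 + y) < 1) (ha : 1 ≤ a)
    (hval : ∀ v, prob (fun e => val (blk v) e = v) ≤ a * ϖ v) (hSK : S < K)
    (log : (ι × Fin K → E) → List (V × V))
    (hlog : ∀ R, Valid G blk (tab val R) (fun _ => 0) (log R)) (hlen : ∀ R, (log R).length ≤ S)
    {v : V} (hv : prob (fun e => val (blk v) e ≠ v) ≤ a * (1 - β)) :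
    prob (fun R => tab val R (blk v) (cnt blk (log R) (blk v)) ≠ v) ≤
      a ^ (2 * S + 1) * ((1 - β) / (1 - Δ * β ^ 2 * (1 + y))) := by
  have key := prob_exists_le ((spines G blk v S).filter fun t => t.size ≤ S)
    (fun t (R : ι × Fin K → E) => Valid G blk (tab val R) (fun _ => 0) t.post ∧
      tab val R (blk v) (cnt blk t.post (blk v)) ≠ v)
  refine (prob_mono fun R hR => ?_).trans (key.trans ?_)
  -- The final entry differs from `v`, so some spine tree is valid and followed by an entry other
  -- than `v`; the union bound runs over these trees.
  · obtain ⟨t, h1, h2, h3, h4⟩ := exists_spine (hlog R) le_rfl hR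
    exact ⟨t, mem_filter.2 ⟨h1.mem_spines (h2.trans (hlen R)), h2.trans (hlen R)⟩, h3, h4⟩
  have hp : 0 ≤ a * (1 - β) := (prob_nonneg _).trans hv
  calc _ ≤ ∑ t ∈ (spines G blk v S).filter fun t => t.size ≤ S,
        a ^ (2 * S) * (a * (1 - β)) * t.weight ϖ := by
        refine sum_le_sum fun t ht => ?_
        have h := prob_post_le (G := G) (S := S) hϖ ha hval hSK (blk v) (· ≠ v)
          (mem_filter.1 ht).2
        refine h.trans ?_
        rw [mul_right_comm]
        exact mul_le_mul_of_nonneg_right (mul_le_mul_of_nonneg_left hv (by positivity))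
          (WTree.weight_nonneg hϖ t)
    _ ≤ ∑ t ∈ spines G blk v S, a ^ (2 * S) * (a * (1 - β)) * t.weight ϖ :=
        sum_le_sum_of_subset_of_nonneg (filter_subset _ _) fun t _ _ =>
          mul_nonneg (mul_nonneg (by positivity) hp) (WTree.weight_nonneg hϖ t)
    _ ≤ a ^ (2 * S) * (a * (1 - β)) * (1 / (1 - Δ * β ^ 2 * (1 + y))) := by
        rw [← mul_sum]
        exact mul_le_mul_of_nonneg_left (sum_spines_le hϖ hβ hΔ hsum hy hy' v h1 S)
          (mul_nonneg (by positivity) hp)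
    _ = _ := by ring

open Classical in
/-- The expected weight of the outcome of the resampling process. -/
theorem le_sum_weight (hϖ : ∀ v, 0 ≤ ϖ v) (hβ : ∀ v, ϖ v ≤ β)
    (hΔ : ∀ v, #{z | G.Adj v z} ≤ Δ) (hsum : ∀ i, ∑ v with blk v = i, ϖ v = 1) (hy : 0 ≤ y)
    (hy' : Δ * β * (1 + y) ^ 2 ≤ y) (h1 : Δ * β ^ 2 * (1 + y) < 1) (hβ1 : β ≤ 1) (ha : 1 ≤ a)
    (hval : ∀ v, prob (fun e => val (blk v) e = v) ≤ a * ϖ v) (hblk : ∀ i e, blk (val i e) = i)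
    (hSK : S < K) (log : (ι × Fin K → E) → List (V × V))
    (hlog : ∀ R, Valid G blk (tab val R) (fun _ => 0) (log R)) (hlen : ∀ R, (log R).length ≤ S)
    {b : ℕ} (hb : ∀ i, #{v | blk v = i} = b) {w : V → ℝ} (hw : ∀ v, 0 ≤ w v) {m : ι → ℝ}
    (hm0 : ∀ i, 0 ≤ m i) (hm : ∀ i e, m i ≤ w (val i e)) {F : Finset V}
    (hF : ∀ v ∈ F, prob (fun e => val (blk v) e ≠ v) ≤ a * (1 - β))
    (hmF : ∀ v ∈ F, m (blk v) ≤ w v) (hnF : ∀ v ∉ F, w v ≤ m (blk v))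
    {η τ : ℝ} (hη : a ^ (2 * S + 1) ≤ 1 + η)
    (hη' : prob (fun R => (log R).length = S) ≤ η) (hτ : 0 ≤ τ) (hτb : τ * b ≤ 1)
    (hτθ : τ ≤ 1 - (1 - β) / (1 - Δ * β ^ 2 * (1 + y))) :
    (τ - 2 * η) * (∑ v, w v) * Fintype.card (ι × Fin K → E) ≤
      ∑ R, if (log R).length = S then 0
        else ∑ i, w (tab val R i (cnt blk (log R) i)) := by
  set cur : (ι × Fin K → E) → ι → V := fun R i => tab val R i (cnt blk (log R) i) with hcur
  set ok : (ι × Fin K → E) → Prop := fun R => (log R).length ≠ S with hok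
  have hcb : ∀ R i, blk (cur R i) = i := fun R i => hblk i _
  have hη0 : 0 ≤ η := (prob_nonneg _).trans hη'
  have pok : 1 - η ≤ prob ok := by
    have : prob ok = 1 - prob (fun R => (log R).length = S) := prob_not _
    linarith
  -- One `η` pays for running out of steps, the other for the factor `a ^ (2 * S + 1)`.
  have pcur : ∀ v ∈ F, τ - 2 * η ≤ prob fun R => ok R ∧ cur R (blk v) = v := by
    intro v hv
    have e1 := prob_leave_le hϖ hβ hΔ hsum hy hy' h1 ha hval hSK log hlog hlen (hF v hv)
    set q := (1 - β) / (1 - Δ * β ^ 2 * (1 + y))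
    have hq0 : 0 ≤ q := div_nonneg (by linarith) (by linarith)
    have e2 : a ^ (2 * S + 1) * q ≤ q + η := by
      calc _ ≤ (1 + η) * q := by gcongr
        _ = q + η * q := by ring
        _ ≤ q + η * 1 := by gcongr; linarith
        _ = _ := by ring
    have e3 := prob_or_le (fun R : ι × Fin K → E => (log R).length = S) (fun R => cur R (blk v) ≠ v)
    have e4 := prob_not (fun R : ι × Fin K → E => ok R ∧ cur R (blk v) = v)
    have e5 := prob_congr (p := fun R : ι × Fin K → E => ¬ (ok R ∧ cur R (blk v) = v))
      (q := fun R => (log R).length = S ∨ cur R (blk v) ≠ v) (fun R => by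
        simp only [ok]; tauto)
    linarith
  -- the weight above the threshold
  set x : ι → ℝ := fun i => ∑ v with v ∈ F ∧ blk v = i, (w v - m i) with hx
  have hx0 : ∀ i, 0 ≤ x i := fun i => sum_nonneg fun v hv => by
    obtain ⟨-, hv', rfl⟩ := mem_filter.1 hv
    exact sub_nonneg.2 (hmF v hv')
  have hsplit : ∀ i, ∑ v with blk v = i, w v =
      ∑ v with v ∈ F ∧ blk v = i, w v + ∑ v with v ∉ F ∧ blk v = i, w v := by
    intro i
    rw [← sum_filter_add_sum_filter_not (univ.filter fun v => blk v = i) (· ∈ F), filter_filter,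
      filter_filter]
    congr 2 <;> (ext v; simp [and_comm])
  have hle : ∀ i, ∑ v with blk v = i, w v ≤ x i + b * m i := by
    intro i
    calc _ ≤ ∑ v with v ∈ F ∧ blk v = i, w v + ∑ v with v ∉ F ∧ blk v = i, m i := by
          rw [hsplit]
          gcongr with v hv
          obtain ⟨-, hv', rfl⟩ := mem_filter.1 hv
          exact hnF v hv'
      _ = x i + (∑ v with v ∈ F ∧ blk v = i, m i + ∑ v with v ∉ F ∧ blk v = i, m i) := by
          simp only [hx, sum_sub_distrib]; ring
      _ = x i + ∑ v with blk v = i, m i := by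
          congr 1
          rw [← sum_filter_add_sum_filter_not (univ.filter fun v => blk v = i) (· ∈ F),
            filter_filter, filter_filter]
          congr 2 <;> (ext v; simp [and_comm])
      _ = _ := by rw [sum_const, hb]; simp
  -- If the block has a vertex in `F`, such a vertex pays for `m i` besides its excess. Otherwise
  -- any vertex in use pays for it.
  have hge : ∀ i, x i + m i ≤ ∑ v with blk v = i, w v := by
    intro i
    have hn : 0 ≤ ∑ v with v ∉ F ∧ blk v = i, w v := sum_nonneg fun v _ => hw v
    rcases (univ.filter fun v => v ∈ F ∧ blk v = i).eq_empty_or_nonempty with h | h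
    · simp only [hx, h, sum_empty, zero_add]
      exact (hm i default).trans (single_le_sum (f := w) (fun v _ => hw v)
        (by simp [hblk]))
    · rw [hsplit]
      simp only [hx, sum_sub_distrib, sum_const, nsmul_eq_mul]
      have : (1 : ℝ) ≤ #{v | v ∈ F ∧ blk v = i} := by exact_mod_cast h.card_pos
      nlinarith [hm0 i]
  -- A finished run collects at least `m i` from each block, and also the excess if the shown vertex
  -- lies in `F`.
  have hpoint : ∀ R, (∑ i, (if ok R then m i else 0)) +
      ∑ i, ∑ v with v ∈ F ∧ blk v = i, (if ok R ∧ cur R i = v then (w v - m i) else 0) ≤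
      if (log R).length = S then 0 else ∑ i, w (cur R i) := by
    intro R
    by_cases h : (log R).length = S
    · simp [ok, h]
    · rw [if_neg h, ← sum_add_distrib]
      refine sum_le_sum fun i _ => ?_
      have hR : ok R := h
      simp only [hR, if_true, true_and]
      by_cases hc : cur R i ∈ F
      · rw [sum_eq_single (cur R i)]
        · simp
        · intro v _ hv; simp [hv.symm]
        · simp [hc, hcb]
      · rw [sum_eq_zero, add_zero]
        · exact hm i _
        · intro v hv
          rw [if_neg]
          rintro rfl
          exact hc (mem_filter.1 hv).2.1
  calc (τ - 2 * η) * (∑ v, w v) * Fintype.card (ι × Fin K → E)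
      ≤ (∑ i, ((1 - η) * m i + (τ - 2 * η) * x i)) * Fintype.card (ι × Fin K → E) := by
        gcongr
        rw [← sum_fiberwise univ blk w, mul_sum]
        refine sum_le_sum fun i _ => ?_
        -- The upper bound `x i + b * m i` is used with the coefficient `τ`, where `τ * b ≤ 1`
        -- absorbs the `b`; the lower bound `x i + m i` is used for the loss `2 * η`.
        have e1 := hle i
        have e2 := hge i
        have e3 : τ * ∑ v with blk v = i, w v ≤ τ * (x i + b * m i) := by gcongr
        have e4 : τ * b * m i ≤ 1 * m i := mul_le_mul_of_nonneg_right hτb (hm0 i)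
        have e5 : η * (x i + m i) ≤ η * ∑ v with blk v = i, w v := by gcongr
        have e6 : 0 ≤ η * m i := mul_nonneg hη0 (hm0 i)
        linarith
    _ ≤ (∑ i, (prob ok * m i + ∑ v with v ∈ F ∧ blk v = i,
          (prob fun R => ok R ∧ cur R i = v) * (w v - m i))) * Fintype.card (ι × Fin K → E) := by
        gcongr with i
        · exact hm0 i
        · simp only [hx, mul_sum]
          refine sum_le_sum fun v hv => ?_
          obtain ⟨-, hv', rfl⟩ := mem_filter.1 hv
          exact mul_le_mul_of_nonneg_right (pcur v hv') (sub_nonneg.2 (hmF v hv'))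
    _ = ∑ R, ((∑ i, (if ok R then m i else 0)) +
          ∑ i, ∑ v with v ∈ F ∧ blk v = i, (if ok R ∧ cur R i = v then (w v - m i) else 0)) := by
        have e : ∀ (p : (ι × Fin K → E) → Prop) [DecidablePred p] (z : ℝ),
            ∑ R, (if p R then z else 0) = prob p * z * Fintype.card (ι × Fin K → E) := by
          intro p _ z
          rw [prob_eq, ← sum_filter, sum_const, nsmul_eq_mul]
          have : (Fintype.card (ι × Fin K → E) : ℝ) ≠ 0 := by simp
          field_simp
        symm
        rw [sum_add_distrib]
        calc _ = ∑ i, ∑ R, (if ok R then m i else 0) + ∑ i, ∑ v with v ∈ F ∧ blk v = i,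
              ∑ R, (if ok R ∧ cur R i = v then (w v - m i) else 0) := by
              congr 1
              · exact sum_comm
              · rw [sum_comm]
                exact sum_congr rfl fun i _ => sum_comm
          _ = _ := by
              refine (congrArg₂ (· + ·) (sum_congr rfl fun i _ => e ok (m i))
                (sum_congr rfl fun i _ => sum_congr rfl fun v _ =>
                  e (fun R => ok R ∧ cur R i = v) (w v - m i))).trans ?_
              rw [← sum_add_distrib, sum_mul]
              refine sum_congr rfl fun i _ => ?_
              rw [add_mul, sum_mul]
    _ ≤ _ := sum_le_sum fun R _ => hpoint R

end Core
end Resampling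

namespace Resampling

/-! ### Slots: a vertex distribution that prefers the heavy vertices of each block -/

/-- The vertices of each block are ranked by decreasing weight: `rk v` is the rank of `v`, and
`ord i k` the vertex of rank `k` in the block `i`. -/
structure IsRanking {V ι : Type*} (blk : V → ι) (b : ℕ) (w : V → ℝ) (rk : V → ℕ)
    (ord : ι → ℕ → V) : Prop where
  rk_lt : ∀ v, rk v < b
  ord_rk : ∀ v, ord (blk v) (rk v) = v
  blk_ord : ∀ i, ∀ k < b, blk (ord i k) = i
  rk_ord : ∀ i, ∀ k < b, rk (ord i k) = k
  anti : ∀ u v, blk u = blk v → rk u ≤ rk v → w v ≤ w u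

/-- The number of slots of a block. The slots `2 k` and `2 k + 1` belong to the vertex of rank
`k`. -/
def slots (b Δ : ℕ) : ℕ := min (max (9 * Δ) 2) (2 * b)

/-- The guaranteed fraction of the total weight, when all vertices have probability at most `β`. -/
noncomputable def theta (β : ℝ) (Δ : ℕ) : ℝ :=
  β * (1 + √(1 - 4 * Δ * β)) / (2 - β * (1 - √(1 - 4 * Δ * β)))

/-- With `σ = √(1 - 4Δβ)`, the smaller root of `Δβ(1 + y)² = y` is `(1 - σ)/(1 + σ)` when `Δ > 0`,
and `y = 0` when `Δ = 0`. It makes `Δβ²(1 + y)` equal to `β(1 - σ)/2`, from which `theta` arises. -/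
theorem exists_fixpoint {β : ℝ} {Δ : ℕ} (h0 : 0 < β) (h1 : β ≤ 1) (h4 : 4 * Δ * β ≤ 1) :
    ∃ y, 0 ≤ y ∧ y ≤ 1 ∧ Δ * β * (1 + y) ^ 2 = y ∧ Δ * β ^ 2 * (1 + y) < 1 ∧
      theta β Δ = 1 - (1 - β) / (1 - Δ * β ^ 2 * (1 + y)) := by
  set σ := √(1 - 4 * Δ * β) with hσ
  have hσ0 : 0 ≤ σ := Real.sqrt_nonneg _
  have hσ2 : σ ^ 2 = 1 - 4 * Δ * β := Real.sq_sqrt (by linarith)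
  have hΔβ : Δ * β = (1 - σ ^ 2) / 4 := by rw [hσ2]; ring
  have hσ1 : σ ≤ 1 := by
    rw [hσ]; apply Real.sqrt_le_one.2 
    have : 0 ≤ 4 * (Δ : ℝ) * β := by positivity
    linarith
  have hk : Δ * β ^ 2 * (1 + (1 - σ) / (1 + σ)) = β * (1 - σ) / 2 := by
    have : Δ * β ^ 2 * (1 + (1 - σ) / (1 + σ)) = (Δ * β) * β * (1 + (1 - σ) / (1 + σ)) := by ring
    rw [this, hΔβ]
    field_simp; ring
  have hlt : β * (1 - σ) / 2 < 1 := by nlinarith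
  refine ⟨(1 - σ) / (1 + σ), div_nonneg (by linarith) (by linarith),
    (div_le_one (by linarith)).2 (by linarith), ?_, ?_, ?_⟩
  · rw [hΔβ]; field_simp; ring
  · rw [hk]; exact hlt
  · rw [hk, theta, ← hσ]
    have e1 : (1 - β * (1 - σ) / 2) ≠ 0 := by linarith
    have e2 : (2 - β * (1 - σ)) ≠ 0 := by intro h; apply e1; linarith
    rw [eq_sub_iff_add_eq, div_add_div _ _ e2 e1, div_eq_one_iff_eq (mul_ne_zero e2 e1)]
    ring

section Slots
set_option linter.unusedSectionVars false
variable {V ι E : Type*} [DecidableEq ι] [Fintype ι] [Fintype V] [Fintype E] [Inhabited E]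
  {G : SimpleGraph V} {blk : V → ι} {K S Δ b s : ℕ} {w : V → ℝ} {rk : V → ℕ} {ord : ι → ℕ → V}
  {num : E → ℕ} {a : ℝ}

theorem prob_slot_le (hs : 0 < s)
    (hnum : ∀ k < s, prob (fun e => num e % s = k) ≤ a / s) (p : ℕ → Prop) [DecidablePred p] :
    prob (fun e => p (num e % s)) ≤ a * (#{k ∈ range s | p k} / s) := by
  have h := prob_exists_le ((range s).filter p) (fun k (e : E) => num e % s = k)
  refine (prob_mono fun e he => ?_).trans (h.trans ?_)
  · exact ⟨_, mem_filter.2 ⟨mem_range.2 (Nat.mod_lt _ hs), he⟩, rfl⟩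
  · refine (sum_le_sum fun k hk => hnum k (mem_range.1 (mem_filter.1 hk).1)).trans (le_of_eq ?_)
    simp; ring

theorem slot_filter_eq {r : ℕ} (h : 2 * r + 2 ≤ s) : #{k ∈ range s | k / 2 ≠ r} + 2 = s := by
  have h1 := Finset.card_filter_add_card_filter_not (s := range s) (fun k => k / 2 = r)
  have h2 : (range s).filter (fun k => k / 2 = r) = {2 * r, 2 * r + 1} := by
    ext k; simp only [mem_filter, mem_range, mem_insert, mem_singleton]; omega
  rw [h2, card_range, card_pair (by omega)] at h1
  simp only [ne_eq]; omega

theorem slot_filter_le (r : ℕ) : #{k ∈ range s | k / 2 = r} ≤ 2 := by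
  refine (card_le_card (t := {2 * r, 2 * r + 1}) fun k => ?_).trans card_le_two
  simp only [mem_filter, mem_range, mem_insert, mem_singleton]; omega

open Classical in
/-- Resampling, with every entry chosen uniformly from the slots up to a factor `a`, is likely to
produce a heavy independent transversal. -/
theorem le_prob_good (hrk : IsRanking blk b w rk ord) (hb : ∀ i, #{v | blk v = i} = b)
    (hw : ∀ v, 0 ≤ w v) (hΔ : ∀ v, #{z | G.Adj v z} ≤ Δ) (hs2 : 2 ≤ s) (hsb : s ≤ 2 * b)
    (hs8 : 8 * Δ ≤ s) (ha : 1 ≤ a)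
    (hnum : ∀ k < s, prob (fun e => num e % s = k) ≤ a / s) (hSK : S < K)
    (log : (ι × Fin K → E) → List (V × V))
    (hlog : ∀ R, Valid G blk (tab (fun i e => ord i (num e % s / 2)) R) (fun _ => 0) (log R))
    (hlen : ∀ R, (log R).length ≤ S) {η τ ξ : ℝ} (hη : a ^ (2 * S + 1) ≤ 1 + η) (hη0 : 0 ≤ η)
    (hη' : Fintype.card ι * (1 + η) ≤ 2 * S * η) (hS : 0 < S) (hτ : 0 ≤ τ) (hτb : τ * b ≤ 1)
    (hτθ : τ ≤ theta (2 / s) Δ) (hξ : ξ ≤ 1) :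
    ξ * τ - 2 * η ≤ prob fun R : ι × Fin K → E => (log R).length ≠ S ∧
      (1 - ξ) * (τ * ∑ v, w v) ≤
        ∑ i, w (tab (fun i e => ord i (num e % s / 2)) R i (cnt blk (log R) i)) := by
  have hs0 : (0 : ℝ) < s := by exact_mod_cast (by omega : 0 < s)
  have hb1 : 1 ≤ b := by omega
  set val : ι → E → V := fun i e => ord i (num e % s / 2) with hval
  set β : ℝ := 2 / s with hβdef
  have hβ0 : 0 < β := by positivity
  have hβ1 : β ≤ 1 := by rw [hβdef, div_le_one hs0]; exact_mod_cast hs2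
  have h4 : 4 * Δ * β ≤ 1 := by
    rw [hβdef, ← mul_div_assoc, div_le_one hs0]
    have : (8 * Δ : ℝ) ≤ s := by exact_mod_cast hs8
    linarith
  obtain ⟨y, hy0, hy1, hy, hlt, hθ⟩ := exists_fixpoint hβ0 hβ1 h4
  have hmod : ∀ e, num e % s / 2 < b := fun e => by
    have := Nat.mod_lt (num e) (by omega : 0 < s); omega
  have hblk : ∀ i e, blk (val i e) = i := fun i e => hrk.blk_ord i _ (hmod e)
  have hvaleq : ∀ v e, val (blk v) e = v ↔ num e % s / 2 = rk v := by
    intro v e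
    constructor
    · intro h
      rw [← hrk.rk_ord (blk v) _ (hmod e)]; exact congrArg rk h
    · intro h
      simp only [hval, h, hrk.ord_rk]
  -- The ideal probability of a vertex is its share of the slots: `2/s` for the heaviest vertices,
  -- `1/s` for at most one more in each block, and zero for the rest.
  set ϖ : V → ℝ := fun v => (#{k ∈ range s | k / 2 = rk v} : ℝ) / s with hϖ
  have hϖ0 : ∀ v, 0 ≤ ϖ v := fun v => by positivity
  have hϖβ : ∀ v, ϖ v ≤ β := fun v => by
    simp only [hϖ, hβdef]; gcongr; exact_mod_cast slot_filter_le (rk v)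
  have hsum : ∀ i, ∑ v with blk v = i, ϖ v = 1 := by
    intro i
    simp only [hϖ]
    rw [← sum_div, div_eq_one_iff_eq hs0.ne']
    have h1 := card_eq_sum_card_fiberwise (f := fun k => ord i (k / 2)) (s := range s)
      (t := univ.filter fun v => blk v = i) (fun k hk => by
        simp only [coe_range, Set.mem_Iio] at hk
        simp only [coe_filter, mem_univ, true_and, Set.mem_ofPred_eq]
        exact hrk.blk_ord i _ (by omega))
    rw [card_range] at h1
    rw [← Nat.cast_sum]
    refine congrArg _ (Eq.trans ?_ h1.symm)
    refine sum_congr rfl fun v hv => ?_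
    obtain rfl := (mem_filter.1 hv).2
    congr 1
    ext k
    simp only [mem_filter, mem_range, and_congr_right_iff]
    intro hk
    constructor
    · intro h; simp only [h, hrk.ord_rk]
    · intro h; rw [← hrk.rk_ord (blk v) (k / 2) (by omega), h]
  have hvalle : ∀ v, prob (fun e => val (blk v) e = v) ≤ a * ϖ v := by
    intro v
    simp only [hvaleq]
    exact prob_slot_le (by omega) hnum fun k => k / 2 = rk v
  -- The vertices that own two slots.
  set F : Finset V := {v | 2 * rk v + 2 ≤ s}
  have hF : ∀ v ∈ F, prob (fun e => val (blk v) e ≠ v) ≤ a * (1 - β) := by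
    intro v hv
    simp only [ne_eq, hvaleq]
    refine (prob_slot_le (by omega) hnum fun k => ¬ k / 2 = rk v).trans (le_of_eq ?_)
    have h1 : (#{k ∈ range s | k / 2 ≠ rk v} : ℝ) + 2 = s := by
      exact_mod_cast slot_filter_eq (mem_filter.1 hv).2
    have h2 : (#{k ∈ range s | ¬ k / 2 = rk v} : ℝ) = s - 2 := by linarith
    rw [h2, hβdef]; field_simp
  -- The threshold is the weight of the owner of the last slot `s - 1`, the lightest vertex in use.
  set m : ι → ℝ := fun i => w (ord i ((s - 1) / 2)) with hm
  have hmb : ∀ i, blk (ord i ((s - 1) / 2)) = i ∧ rk (ord i ((s - 1) / 2)) = (s - 1) / 2 :=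
    fun i => ⟨hrk.blk_ord i _ (by omega), hrk.rk_ord i _ (by omega)⟩
  have hlong : prob (fun R => (log R).length = S) ≤ η := by
    have h := prob_long_le hϖ0 hϖβ hΔ hsum hy0 hy.le ha hvalle hSK log hlog
    have h2S : (0 : ℝ) < 2 * S := by exact_mod_cast (by omega : 0 < 2 * S)
    refine le_of_mul_le_mul_left (h.trans ?_) h2S
    refine le_trans ?_ hη'
    calc Fintype.card ι * y * a ^ (2 * S) ≤ Fintype.card ι * 1 * a ^ (2 * S + 1) := by
          gcongr
          omega
      _ ≤ Fintype.card ι * (1 + η) := by rw [mul_one]; gcongr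
  have core := le_sum_weight hϖ0 hϖβ hΔ hsum hy0 hy.le hlt hβ1 ha hvalle hblk hSK log hlog hlen
    hb hw (m := m) (fun i => hw _) (fun i e => hrk.anti _ _ (by rw [hblk, (hmb i).1]) (by
      rw [(hmb i).2, hrk.rk_ord _ _ (hmod e)]
      have := Nat.mod_lt (num e) (by omega : 0 < s); omega)) (F := F) hF
    (fun v hv => hrk.anti _ _ (hmb _).1.symm (by
      rw [(hmb _).2]
      have := (mem_filter.1 hv).2; omega))
    (fun v hv => hrk.anti _ _ (hmb _).1 (by
      rw [(hmb _).2]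
      have : ¬ 2 * rk v + 2 ≤ s := fun h => hv (mem_filter.2 ⟨mem_univ _, h⟩)
      omega)) hη hlong hτ hτb (hθ ▸ hτθ)
  set X : (ι × Fin K → E) → ℝ := fun R => ∑ i, w (tab val R i (cnt blk (log R) i)) with hX
  set W := ∑ v, w v with hW
  have hW0 : 0 ≤ W := sum_nonneg fun v _ => hw v
  have hb1' : (1 : ℝ) ≤ b := by exact_mod_cast hb1
  have hτ1 : τ ≤ 1 := by nlinarith
  have hXW : ∀ R, X R ≤ W := by
    intro R
    rw [hW, ← sum_fiberwise univ blk w]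
    refine sum_le_sum fun i _ => ?_
    exact single_le_sum (f := w) (fun v _ => hw v) (by simp [tab, hblk])
  change _ ≤ prob fun R => (log R).length ≠ S ∧ (1 - ξ) * (τ * W) ≤ X R
  set good : (ι × Fin K → E) → Prop := fun R => (log R).length ≠ S ∧ (1 - ξ) * (τ * W) ≤ X R
    with hgood
  rcases hW0.eq_or_lt with h0 | hWpos
  · have h1 : prob (fun R => ¬ (log R).length = S) ≤ prob good := prob_mono fun R hR => by
      refine ⟨hR, ?_⟩
      rw [← h0]
      simpa using sum_nonneg fun i _ => hw _
    rw [prob_not] at h1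
    have : ξ * τ ≤ 1 := mul_le_one₀ hξ hτ hτ1
    linarith
  · have hcard : (0 : ℝ) < Fintype.card (ι × Fin K → E) := by exact_mod_cast Fintype.card_pos
    -- A reverse Markov inequality: a bad run collects at most `(1 - ξ)τW` and a good one at most
    -- `W` more. Comparing with the expectation `(τ - 2η)W` bounds the probability of good runs from
    -- below.
    have h1 : ∀ R, (if (log R).length = S then 0 else X R) ≤
        (1 - ξ) * (τ * W) + if good R then W else 0 := by
      intro R
      have hnn : 0 ≤ (1 - ξ) * (τ * W) := mul_nonneg (by linarith) (mul_nonneg hτ hW0)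
      by_cases hl : (log R).length = S
      · rw [if_pos hl]
        split_ifs <;> linarith
      · rw [if_neg hl]
        by_cases hg : good R
        · rw [if_pos hg]; have := hXW R; linarith
        · rw [if_neg hg]
          have : X R < (1 - ξ) * (τ * W) := by
            by_contra h; exact hg ⟨hl, not_lt.1 h⟩
          linarith
    have h2 := core.trans (sum_le_sum fun R _ => h1 R)
    rw [sum_add_distrib, ← sum_filter, sum_const, sum_const, nsmul_eq_mul, nsmul_eq_mul,
      card_univ] at h2
    have h3 : (#{R | good R} : ℝ) = prob good * Fintype.card (ι × Fin K → E) := by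
      rw [prob_eq]; field_simp
    rw [h3] at h2
    have h4 : (ξ * τ - 2 * η) * (W * Fintype.card (ι × Fin K → E)) ≤
        prob good * (W * Fintype.card (ι × Fin K → E)) := by
      linarith
    exact le_of_mul_le_mul_right h4 (mul_pos hWpos hcard)

end Slots

/-! ### The guaranteed fractions -/

section Factors
variable {b Δ : ℕ}

theorem two_le_slots (hb : 1 ≤ b) : 2 ≤ slots b Δ := by unfold slots; omega

theorem slots_le : slots b Δ ≤ 2 * b := by unfold slots; omega

theorem eight_mul_le_slots (h : 4 * Δ ≤ b) : 8 * Δ ≤ slots b Δ := by unfold slots; omega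

theorem factorSmall_eq (hb : 1 ≤ b) :
    factorSmall b Δ = (1 + √(1 - 4 * Δ / b)) / (2 * b - 1 + √(1 - 4 * Δ / b)) := by
  have hb0 : (0 : ℝ) < b := by exact_mod_cast hb
  have h1 : √((b : ℝ) - 4 * Δ) = √(b : ℝ) * √(1 - 4 * Δ / b) := by
    rw [← Real.sqrt_mul hb0.le]; congr 1; field_simp
  have hs : 0 < √(b : ℝ) := Real.sqrt_pos.2 hb0
  rw [factorSmall, h1]
  rw [show √(b : ℝ) + √(b : ℝ) * √(1 - 4 * Δ / b) = √(b : ℝ) * (1 + √(1 - 4 * Δ / b)) by ring,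
    show √(b : ℝ) * (2 * b - 1) + √(b : ℝ) * √(1 - 4 * Δ / b) =
      √(b : ℝ) * (2 * b - 1 + √(1 - 4 * Δ / b)) by ring, mul_div_mul_left _ _ hs.ne']

theorem sqrt_mem (h4 : 4 * (Δ : ℝ) ≤ b) :
    0 ≤ √(1 - 4 * Δ / b : ℝ) ∧ √(1 - 4 * Δ / b : ℝ) ≤ 1 ∧
      √(1 - 4 * Δ / b : ℝ) ^ 2 = 1 - 4 * Δ / b := by
  refine ⟨Real.sqrt_nonneg _, Real.sqrt_le_one.2 ?_, Real.sq_sqrt ?_⟩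
  · have : 0 ≤ 4 * (Δ : ℝ) / b := by positivity
    linarith
  · have : 4 * (Δ : ℝ) / b ≤ 1 := div_le_one_of_le₀ h4 (by positivity)
    linarith

/-- A crude lower bound that keeps the success probability of a round polynomially large. -/
theorem one_div_le_factorSmall (hb : 1 ≤ b) (h4 : 4 * (Δ : ℝ) ≤ b) :
    1 / (2 * b : ℝ) ≤ factorSmall b Δ := by
  have hb0 : (1 : ℝ) ≤ b := by exact_mod_cast hb
  rw [factorSmall_eq hb]
  obtain ⟨h0, h1, -⟩ := sqrt_mem h4
  set σ := √(1 - 4 * Δ / b : ℝ)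
  rw [div_le_div_iff₀ (by linarith) (by linarith)]
  nlinarith

theorem factorSmall_mul_le (hb : 1 ≤ b) (h4 : 4 * (Δ : ℝ) ≤ b) : factorSmall b Δ * b ≤ 1 := by
  have hb0 : (1 : ℝ) ≤ b := by exact_mod_cast hb
  rw [factorSmall_eq hb]
  obtain ⟨h0, h1, -⟩ := sqrt_mem h4
  set σ := √(1 - 4 * Δ / b : ℝ)
  rw [div_mul_eq_mul_div, div_le_one (by linarith)]
  nlinarith

/-- Here `9Δ ≥ 2b`, so all slots of the block are used and `β = 1/b`: the uniform distribution. -/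
theorem factorSmall_eq_theta (hb : 1 ≤ b) (h4 : 4 * (Δ : ℝ) ≤ b) (h : (b : ℝ) ≤ 4.5 * Δ) :
    factorSmall b Δ = theta (2 / slots b Δ) Δ := by
  have hb0 : (1 : ℝ) ≤ b := by exact_mod_cast hb
  have hs : slots b Δ = 2 * b := by
    have : (2 * b : ℝ) ≤ 9 * Δ := by linarith
    have : 2 * b ≤ 9 * Δ := by exact_mod_cast this
    unfold slots; omega
  have hβ : (2 / (slots b Δ : ℝ)) = 1 / b := by rw [hs]; push_cast; field_simp
  rw [factorSmall_eq hb, hβ, theta, mul_one_div]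
  obtain ⟨h0, h1, -⟩ := sqrt_mem h4
  set σ := √(1 - 4 * Δ / b : ℝ)
  have e1 : 2 * b - 1 + σ ≠ 0 := by linarith
  have e2 : 2 - 1 / b * (1 - σ) = (2 * b - 1 + σ) / b := by field_simp; ring
  rw [e2]; field_simp

theorem one_div_le_factorSmall' (hb : 1 ≤ b) (h4 : 4 * (Δ : ℝ) ≤ b) (h : (b : ℝ) ≤ 4.5 * Δ) :
    1 / (8 * (Δ : ℝ) - 1) ≤ factorSmall b Δ := by
  have hb0 : (1 : ℝ) ≤ b := by exact_mod_cast hb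
  have hΔ : (1 : ℝ) ≤ Δ := by
    have : 0 < (Δ : ℝ) := by linarith
    exact_mod_cast this
  rw [factorSmall_eq hb]
  obtain ⟨h0, h1, h2⟩ := sqrt_mem h4
  set σ := √(1 - 4 * Δ / b : ℝ)
  have h3 : (b : ℝ) * σ ^ 2 = b - 4 * Δ := by rw [h2]; field_simp
  -- This is where `b ≤ 4.5Δ` enters: it says `σ² ≤ 1/9`.
  have h5 : σ ≤ 1 / 3 := by
    by_contra hc
    push Not at hc
    have : (1 / 9 : ℝ) < σ ^ 2 := by nlinarith
    nlinarith
  rw [div_le_div_iff₀ (by linarith) (by linarith)]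
  have h6 : 4 * (Δ : ℝ) = b - b * σ ^ 2 := by linarith
  -- After cross-multiplying and substituting `4Δ = b(1 - σ²)`, the difference of the two sides is
  -- exactly twice this expression.
  have h7 : 0 ≤ σ * ((b : ℝ) * (1 - σ - σ ^ 2) - 1) := by
    apply mul_nonneg h0
    have hb4 : (4 : ℝ) ≤ b := by linarith
    have : 5 / 9 ≤ 1 - σ - σ ^ 2 := by nlinarith
    nlinarith
  have h8 : 8 * (Δ : ℝ) = 2 * (b - b * σ ^ 2) := by linarith
  rw [h8]
  nlinarith

theorem factorLarge_mul_le (hb : 1 ≤ b) : factorLarge b Δ * b ≤ 1 := by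
  have hb0 : (0 : ℝ) < b := by exact_mod_cast hb
  have h1 : factorLarge b Δ ≤ 1 / b := by
    unfold factorLarge; split_ifs
    · exact le_rfl
    · exact min_le_left _ _
  calc _ ≤ 1 / (b : ℝ) * b := by gcongr
    _ = 1 := by field_simp

/-- For `Δ > 0` there are `9Δ` slots, so `4Δβ = 8/9` and the square root is `1/3`. For `Δ = 0` there
are two slots, both owned by the heaviest vertex, and `theta` is 1. -/
theorem factorLarge_le_theta (hb : 1 ≤ b) (h : 4.5 * (Δ : ℝ) ≤ b) :
    factorLarge b Δ ≤ theta (2 / slots b Δ) Δ := by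
  have hb0 : (1 : ℝ) ≤ b := by exact_mod_cast hb
  rcases Nat.eq_zero_or_pos Δ with rfl | hΔ
  · have hs : slots b 0 = 2 := by unfold slots; omega
    rw [hs, theta, factorLarge, if_pos rfl]
    norm_num
    exact inv_le_one_of_one_le₀ hb0
  · have hΔ' : (1 : ℝ) ≤ Δ := by exact_mod_cast hΔ
    have hs : slots b Δ = 9 * Δ := by
      have : (9 * Δ : ℝ) ≤ 2 * b := by linarith
      have : 9 * Δ ≤ 2 * b := by exact_mod_cast this
      unfold slots; omega
    rw [factorLarge, if_neg (by omega)]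
    refine (min_le_right _ _).trans (le_of_eq ?_)
    rw [hs, theta]
    have hr : √(1 - 4 * (Δ : ℝ) * (2 / (9 * Δ : ℕ))) = 1 / 3 := by
      rw [show (1 - 4 * (Δ : ℝ) * (2 / (9 * Δ : ℕ))) = (1 / 3) ^ 2 by push_cast; field_simp; norm_num]
      exact Real.sqrt_sq (by norm_num)
    rw [hr]
    push_cast
    have e1 : (27 * (Δ : ℝ) - 2) ≠ 0 := by linarith
    have e2 : 2 - 2 / (9 * (Δ : ℝ)) * (1 - 1 / 3) = 2 * (27 * Δ - 2) / (27 * Δ) := by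
      field_simp; ring
    rw [e2]; field_simp; norm_num

theorem one_div_le_factorLarge (hb : 1 ≤ b) (h : 4.5 * (Δ : ℝ) ≤ b) :
    1 / (2 * b : ℝ) ≤ factorLarge b Δ := by
  have hb0 : (1 : ℝ) ≤ b := by exact_mod_cast hb
  have h1 : 1 / (2 * b : ℝ) ≤ 1 / b := by gcongr; linarith
  unfold factorLarge
  split_ifs with h0
  · exact h1
  · have hΔ : (1 : ℝ) ≤ Δ := by exact_mod_cast Nat.pos_of_ne_zero h0
    refine le_min h1 ?_
    rw [div_le_div_iff₀ (by linarith) (by linarith)]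
    linarith

end Factors
end Resampling

/-! ### Ranking the vertices of a block by weight -/

namespace Resampling

section Ranking
set_option linter.unusedSectionVars false
variable {V ι : Type*} [Fintype V] [DecidableEq ι]

/-- `u` comes before `v` in the order of decreasing weights. -/
def Above (w : V → ℝ) (o : V → ℕ) (u v : V) : Prop := w v < w u ∨ (w u = w v ∧ o u < o v)

open Classical in
/-- The number of vertices of the same block that come before `v`. -/
noncomputable def rank (blk : V → ι) (w : V → ℝ) (o : V → ℕ) (v : V) : ℕ :=
  #{u | blk u = blk v ∧ Above w o u v}

theorem rank_lt_rank {blk : V → ι} {w : V → ℝ} {o : V → ℕ} {u v : V} (h : blk u = blk v)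
    (huv : Above w o u v) : rank blk w o u < rank blk w o v := by
  classical
  refine card_lt_card ⟨fun x => ?_, fun hsub => ?_⟩
  · simp only [mem_filter, mem_univ, true_and, and_imp]
    intro hx hxu
    refine ⟨hx.trans h, ?_⟩
    unfold Above at *
    rcases hxu with h1 | ⟨h1, h1'⟩ <;> rcases huv with h2 | ⟨h2, h2'⟩
    · exact Or.inl (h2.trans h1)
    · exact Or.inl (h2 ▸ h1)
    · exact Or.inl (h1 ▸ h2)
    · exact Or.inr ⟨h1.trans h2, h1'.trans h2'⟩
  · have := hsub (mem_filter.2 ⟨mem_univ u, h, huv⟩)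
    exact absurd (mem_filter.1 this).2.2 (by simp [Above])

theorem above_total {w : V → ℝ} {o : V → ℕ} (ho : Function.Injective o) {u v : V} (h : u ≠ v) :
    Above w o u v ∨ Above w o v u := by
  unfold Above
  rcases lt_trichotomy (w u) (w v) with h1 | h1 | h1
  · exact Or.inr (Or.inl h1)
  · rcases lt_or_gt_of_ne (ho.ne h) with h2 | h2
    · exact Or.inl (Or.inr ⟨h1, h2⟩)
    · exact Or.inr (Or.inr ⟨h1.symm, h2⟩)
  · exact Or.inl (Or.inl h1)

/-- The injective `o` breaks ties, so `Above` is a strict total order. Ranks are then injective on a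
block, with values below its size `b`, hence a bijection. -/
theorem exists_isRanking {blk : V → ι} {b : ℕ} (hb1 : 1 ≤ b)
    (hb : ∀ i, #{v | blk v = i} = b) (w : V → ℝ) {o : V → ℕ} (ho : Function.Injective o) :
    ∃ ord, IsRanking blk b w (rank blk w o) ord := by
  classical
  have hlt : ∀ v, rank blk w o v < b := by
    intro v
    rw [← hb (blk v)]
    refine card_lt_card ⟨fun x => ?_, fun hsub => ?_⟩
    · simp only [mem_filter, mem_univ, true_and, and_imp]; exact fun h _ => h
    · have := hsub (mem_filter.2 ⟨mem_univ v, rfl⟩)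
      rw [mem_filter] at this
      exact absurd this.2.2 (by simp [Above])
  have hinj : ∀ u v, blk u = blk v → rank blk w o u = rank blk w o v → u = v := by
    intro u v h1 h2
    by_contra h
    rcases above_total (w := w) ho h with h3 | h3
    · exact (rank_lt_rank h1 h3).ne h2
    · exact (rank_lt_rank h1.symm h3).ne' h2
  have hsurj : ∀ i, ∀ k < b, ∃ v, blk v = i ∧ rank blk w o v = k := by
    intro i k hk
    have h1 : (univ.filter fun v => blk v = i).image (rank blk w o) = range b := by
      refine eq_of_subset_of_card_le (fun x => ?_) ?_
      · simp only [mem_image, mem_range]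
        rintro ⟨v, -, rfl⟩; exact hlt v
      · rw [card_range, card_image_of_injOn, hb]
        intro u hu v hv h
        simp only [coe_filter, mem_univ, true_and, Set.mem_ofPred_eq] at hu hv
        exact hinj u v (hu.trans hv.symm) h
    have h2 : k ∈ (univ.filter fun v => blk v = i).image (rank blk w o) := by
      rw [h1]; exact mem_range.2 hk
    simpa using h2
  -- Some vertex is needed as a default value for ranks `k ≥ b`.
  have hne : ∀ i, ∃ v, blk v = i := fun i => (hsurj i 0 (by omega)).imp fun _ h => h.1
  refine ⟨fun i k => if h : ∃ v, blk v = i ∧ rank blk w o v = k then h.choose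
    else (hne i).choose, hlt, ?_, ?_, ?_, ?_⟩
  · intro v
    have h : ∃ u, blk u = blk v ∧ rank blk w o u = rank blk w o v := ⟨v, rfl, rfl⟩
    rw [dif_pos h]
    exact hinj _ _ h.choose_spec.1 h.choose_spec.2
  · intro i k hk
    rw [dif_pos (hsurj i k hk)]
    exact (hsurj i k hk).choose_spec.1
  · intro i k hk
    rw [dif_pos (hsurj i k hk)]
    exact (hsurj i k hk).choose_spec.2
  · intro u v h1 h2
    by_contra h3
    exact (rank_lt_rank (w := w) (o := o) h1.symm (Or.inl (not_le.1 h3))).not_ge h2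

end Ranking

/-! ### The final state of the resampling process -/

section Outcome
set_option linter.unusedSectionVars false
variable {V ι : Type*} [DecidableEq ι] {G : SimpleGraph V} {blk : V → ι}

theorem exists_log (R : ι → ℕ → V) (S : ℕ) : ∃ s, Valid G blk R (fun _ => 0) s ∧ s.length ≤ S ∧
    (s.length = S ∨ ∀ d, ¬ Conflict G blk R (cnt blk s) d) := by
  induction S with
  | zero => exact ⟨[], trivial, by simp⟩
  | succ S ih =>
    obtain ⟨s, hv, hl, h⟩ := ih
    by_cases hd : ∃ d, Conflict G blk R (cnt blk s) d
    · obtain ⟨d, hd⟩ := hd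
      have hS : s.length = S := h.resolve_right fun h => h d hd
      refine ⟨s ++ [d], (valid_append _ _ _).2 ⟨hv, ?_, trivial⟩, by simp [hS], by simp [hS]⟩
      simpa using hd
    · exact ⟨s, hv, by omega, Or.inr fun d h => hd ⟨d, h⟩⟩

variable [Fintype ι]

open Classical in
/-- When no conflict is left, the selected vertices form an independent transversal. -/
theorem isIndepTransversal_image {cur : ι → V} (hblk : ∀ i, blk (cur i) = i)
    (h : ∀ i j, ¬ G.Adj (cur i) (cur j)) : IsIndepTransversal G blk (univ.image cur) := by
  constructor
  · intro i
    refine ⟨cur i, by simp [hblk], ?_⟩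
    simp only [mem_image, mem_univ, true_and, and_imp, forall_exists_index]
    rintro _ j rfl hj
    rw [hblk] at hj; rw [hj]
  · intro u hu v hv _
    simp only [coe_image, coe_univ, Set.image_univ, Set.mem_range] at hu hv
    obtain ⟨i, rfl⟩ := hu
    obtain ⟨j, rfl⟩ := hv
    exact h i j

open Classical in
theorem sum_image_cur {cur : ι → V} (hblk : ∀ i, blk (cur i) = i) (w : V → ℝ) :
    ∑ v ∈ univ.image cur, w v = ∑ i, w (cur i) :=
  sum_image fun i _ j _ h => by rw [← hblk i, ← hblk j, h]

/-- Only edges between different blocks count as conflicts, but a block shows just one vertex, which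
is not adjacent to itself. -/
theorem not_adj_of_not_conflict {R : ι → ℕ → V} (hR : ∀ i k, blk (R i k) = i) {c : ι → ℕ}
    (h : ∀ d, ¬ Conflict G blk R c d) (i j : ι) : ¬ G.Adj (R i (c i)) (R j (c j)) := by
  intro hadj
  refine h (R i (c i), R j (c j)) ⟨hadj, ?_, ?_, ?_⟩
  · simp only [hR]
    rintro rfl
    exact G.irrefl hadj
  · simp only [hR]
  · simp only [hR]

end Outcome

/-! ### Existence of heavy independent transversals -/

section Existence
variable {V ι : Type*} [Fintype V] [Fintype ι] [DecidableEq ι] {G : SimpleGraph V} {blk : V → ι}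
  {b Δ : ℕ} {w : V → ℝ}

-- Here entries are exactly uniform on `Fin s`, so `a = 1`. With `η = ξτ/4` and enough steps, the
-- good event has probability at least `ξτ/2 > 0`.
open Classical in
theorem exists_transversal_lt (hb1 : 1 ≤ b) (hb : ∀ i, #{v | blk v = i} = b)
    (hΔ : ∀ v, #{z | G.Adj v z} ≤ Δ) (hw : ∀ v, 0 ≤ w v) (h4 : 4 * Δ ≤ b) {τ : ℝ} (hτ : 0 < τ)
    (hτb : τ * b ≤ 1) (hτθ : τ ≤ theta (2 / slots b Δ) Δ) {ξ : ℝ} (hξ0 : 0 < ξ) (hξ : ξ ≤ 1) :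
    ∃ I, IsIndepTransversal G blk I ∧ (1 - ξ) * (τ * ∑ v, w v) ≤ ∑ v ∈ I, w v := by
  obtain ⟨ord, hord⟩ := exists_isRanking hb1 hb w (o := fun v => Fintype.equivFin V v)
    (Fin.val_injective.comp (Equiv.injective _))
  set s := slots b Δ with hs
  have hs2 : 2 ≤ s := two_le_slots hb1
  have hsb : s ≤ 2 * b := slots_le
  have : NeZero s := ⟨by omega⟩
  have hs0 : (0 : ℝ) < s := by exact_mod_cast (by omega : 0 < s)
  let : Inhabited (Fin s) := ⟨0⟩
  set η := ξ * τ / 4 with hη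
  have hη0 : 0 < η := by positivity
  obtain ⟨S₀, hS₀⟩ := exists_nat_ge (Fintype.card ι * (1 + η) / (2 * η))
  set S := S₀ + 1
  have hS : Fintype.card ι * (1 + η) ≤ 2 * S * η := by
    rw [div_le_iff₀ (by positivity)] at hS₀
    push_cast [S]; nlinarith
  choose log hlog hlen hend using fun R : ι × Fin (S + 1) → Fin s =>
    exists_log (G := G) (blk := blk) (tab (fun i (e : Fin s) => ord i ((e : ℕ) % s / 2)) R) S
  have key := le_prob_good (a := 1) (num := fun e : Fin s => (e : ℕ)) hord hb hw hΔ hs2 hsb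
    (eight_mul_le_slots h4) le_rfl (by
      intro k hk
      rw [prob_eq, Fintype.card_fin]
      gcongr
      have : #{e : Fin s | (e : ℕ) % s = k} ≤ 1 := card_le_one.2 fun x hx y hy => by
        simp only [mem_filter, mem_univ, true_and, Nat.mod_eq_of_lt (Fin.is_lt _)] at hx hy
        exact Fin.ext (hx.trans hy.symm)
      exact_mod_cast this) (Nat.lt_succ_self S) log hlog hlen (η := η) (by simp [hη0.le]) hη0.le hS
    (by omega) hτ.le hτb hτθ hξ
  have hpos : 0 < ξ * τ - 2 * η := by rw [hη]; have : 0 < ξ * τ := by positivity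
                                      linarith
  obtain ⟨R, hR1, hR2⟩ : ∃ R : ι × Fin (S + 1) → Fin s, (log R).length ≠ S ∧
      (1 - ξ) * (τ * ∑ v, w v) ≤ ∑ i, w (tab (fun i (e : Fin s) => ord i ((e : ℕ) % s / 2)) R i
        (cnt blk (log R) i)) := by
    by_contra hno
    push Not at hno
    have : prob (fun R : ι × Fin (S + 1) → Fin s => (log R).length ≠ S ∧
      (1 - ξ) * (τ * ∑ v, w v) ≤ ∑ i, w (tab (fun i (e : Fin s) => ord i ((e : ℕ) % s / 2)) R i
        (cnt blk (log R) i))) = 0 := by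
      rw [prob_eq, div_eq_zero_iff]
      left
      rw [Nat.cast_eq_zero, card_eq_zero, filter_eq_empty_iff]
      exact fun R _ h => (hno R h.1).not_ge h.2
    linarith
  have hblk : ∀ i k, blk (tab (fun i (e : Fin s) => ord i ((e : ℕ) % s / 2)) R i k) = i := fun i k =>
    hord.blk_ord i _ (by
      have := Nat.mod_lt (((if h : k < S + 1 then R (i, ⟨k, h⟩) else default : Fin s) : ℕ))
        (by omega : 0 < s)
      omega)
  refine ⟨univ.image fun i => tab (fun i (e : Fin s) => ord i ((e : ℕ) % s / 2)) R i
      (cnt blk (log R) i),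
    isIndepTransversal_image (fun i => hblk i _)
      (not_adj_of_not_conflict hblk ((hend R).resolve_left hR1)), ?_⟩
  rw [sum_image_cur fun i => hblk i _]
  exact hR2

-- A heaviest independent transversal beats the bound with loss `ξ` for every `ξ > 0`, hence also
-- without loss.
open Classical in
theorem exists_transversal (hb1 : 1 ≤ b) (hb : ∀ i, #{v | blk v = i} = b)
    (hΔ : ∀ v, #{z | G.Adj v z} ≤ Δ) (hw : ∀ v, 0 ≤ w v) (h4 : 4 * Δ ≤ b) {τ : ℝ} (hτ : 0 < τ)
    (hτb : τ * b ≤ 1) (hτθ : τ ≤ theta (2 / slots b Δ) Δ) :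
    ∃ I, IsIndepTransversal G blk I ∧ (∑ v, w v) * τ ≤ ∑ v ∈ I, w v := by
  have h := fun {ξ} => exists_transversal_lt (ξ := ξ) hb1 hb hΔ hw h4 hτ hτb hτθ
  obtain ⟨I, hI, hmax⟩ := (univ.filter fun I => IsIndepTransversal G blk I).exists_max_image
    (fun I => ∑ v ∈ I, w v) (by
      obtain ⟨I, hI, -⟩ := h one_pos le_rfl
      exact ⟨I, mem_filter.2 ⟨mem_univ _, hI⟩⟩)
  refine ⟨I, (mem_filter.1 hI).2, ?_⟩
  rw [mul_comm]
  set W := τ * ∑ v, w v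
  have hW : 0 ≤ W := mul_nonneg hτ.le (sum_nonneg fun v _ => hw v)
  refine le_of_forall_pos_le_add fun ε hε => ?_
  obtain ⟨J, hJ, hle⟩ := h (ξ := ε / (W + ε)) (by positivity)
    ((div_le_one (by positivity)).2 (by linarith))
  have h1 := hle.trans (hmax J (mem_filter.2 ⟨mem_univ _, hJ⟩))
  have h2 : ε / (W + ε) * W ≤ ε := by
    rw [div_mul_eq_mul_div, div_le_iff₀ (by positivity)]; nlinarith
  linarith

end Existence

theorem card_adj_le {V : Type*} [Fintype V] (G : SimpleGraph V) [DecidableRel G.Adj] (v : V) :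
    #(@Finset.filter V (G.Adj v) (fun _ => Classical.propDecidable _) univ) ≤ G.maxDegree := by
  classical
  refine le_trans (le_of_eq ?_) (G.degree_le_maxDegree v)
  rw [← G.card_neighborFinset_eq_degree, G.neighborFinset_eq_filter]
  congr!

/-- The existence part of the theorem. -/
theorem existence {V ι : Type*} [Fintype V] [Fintype ι] [DecidableEq ι]
    (G : SimpleGraph V) [DecidableRel G.Adj] (blk : V → ι) (w : V → ℝ) (b Δ : ℕ)
    (hb1 : 1 ≤ b) (hb : ∀ i, #{v | blk v = i} = b) (hΔ : G.maxDegree = Δ) (hw : ∀ v, 0 ≤ w v) :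
    (4 * (Δ : ℝ) ≤ b → (b : ℝ) ≤ 4.5 * Δ →
      (∃ I : Finset V, IsIndepTransversal G blk I ∧
        (∑ v, w v) * factorSmall b Δ ≤ ∑ v ∈ I, w v) ∧
      (∑ v, w v) / (8 * (Δ : ℝ) - 1) ≤ (∑ v, w v) * factorSmall b Δ) ∧
    (4.5 * (Δ : ℝ) ≤ b →
      ∃ I : Finset V, IsIndepTransversal G blk I ∧
        (∑ v, w v) * factorLarge b Δ ≤ ∑ v ∈ I, w v) := by
  have hpos : (0 : ℝ) < 1 / (2 * b) := by
    have : (0 : ℝ) < b := by exact_mod_cast hb1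
    positivity
  have hdeg := fun v => hΔ ▸ card_adj_le G v
  refine ⟨fun h4 h45 => ⟨?_, ?_⟩, fun h45 => ?_⟩
  · exact exists_transversal hb1 hb hdeg hw (by exact_mod_cast h4)
      (hpos.trans_le (one_div_le_factorSmall hb1 h4)) (factorSmall_mul_le hb1 h4)
      (factorSmall_eq_theta hb1 h4 h45).le
  · rw [div_eq_mul_one_div]
    exact mul_le_mul_of_nonneg_left (one_div_le_factorSmall' hb1 h4 h45)
      (sum_nonneg fun v _ => hw v)
  · have h4 : 4 * (Δ : ℝ) ≤ b := by
      have : (0 : ℝ) ≤ Δ := by positivity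
      linarith
    exact exists_transversal hb1 hb hdeg hw (by exact_mod_cast h4)
      (hpos.trans_le (one_div_le_factorLarge hb1 h45)) (factorLarge_mul_le hb1)
      (factorLarge_le_theta hb1 h45)

end Resampling

/-! ### A structured language with arrays, compiled to the random access machine -/

namespace ArrProg
open RandRAM

/-- Expressions over registers, the input cells and eight arrays. -/
inductive AExpr where
  | const (k : ℕ)
  | reg (i : ℕ)
  | inp (a : AExpr)
  | arr (a : Fin 8) (x : AExpr)
  | add (a b : AExpr)
  | sub (a b : AExpr)
  | mul (a b : AExpr)
  | div (a b : AExpr)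

/-- Programs with bounded loops. `poke` writes to an input cell. -/
inductive AProg where
  | skip
  | set (i : ℕ) (e : AExpr)
  | store (a : Fin 8) (x e : AExpr)
  | poke (x e : AExpr)
  | flip (i : ℕ)
  | seq (p q : AProg)
  | ite (e : AExpr) (p q : AProg)
  | rep (i : ℕ) (e : AExpr) (p : AProg)

/-- States: registers, input cells (below the address `base`), arrays, number of coins flipped. -/
structure AState where
  reg : ℕ → ℕ
  inp : ℕ → ℕ
  arr : Fin 8 → ℕ → ℕ
  coins : ℕ
  base : ℕ

namespace AState

/-- The memory of the machine that a state describes. The arrays are interleaved. -/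
def mem (A : AState) (x : ℕ) : ℕ :=
  if x < A.base then A.inp x else A.arr (Fin.ofNat 8 (x - A.base)) ((x - A.base) / 8)

def setReg (A : AState) (i v : ℕ) : AState := { A with reg := Function.update A.reg i v }

def setArr (A : AState) (a : Fin 8) (x v : ℕ) : AState :=
  { A with arr := Function.update A.arr a (Function.update (A.arr a) x v) }

def setMem (A : AState) (x v : ℕ) : AState :=
  if x < A.base then { A with inp := Function.update A.inp x v }
  else A.setArr (Fin.ofNat 8 (x - A.base)) ((x - A.base) / 8) v

def flip (A : AState) (ω : ℕ → Bool) (i : ℕ) : AState :=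
  { A with reg := Function.update A.reg i (ω A.coins).toNat, coins := A.coins + 1 }

variable (A : AState)

@[simp] theorem reg_setReg (i v j : ℕ) : (A.setReg i v).reg j = if j = i then v else A.reg j := by
  simp [setReg, Function.update_apply]
@[simp] theorem arr_setReg (i v : ℕ) : (A.setReg i v).arr = A.arr := rfl
@[simp] theorem coins_setReg (i v : ℕ) : (A.setReg i v).coins = A.coins := rfl
@[simp] theorem reg_setArr (a : Fin 8) (x v : ℕ) : (A.setArr a x v).reg = A.reg := rfl
@[simp] theorem arr_setArr (a : Fin 8) (x v : ℕ) (a' : Fin 8) : (A.setArr a x v).arr a' =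
    if a' = a then Function.update (A.arr a) x v else A.arr a' := by
  simp [setArr, Function.update_apply]
@[simp] theorem coins_setArr (a : Fin 8) (x v : ℕ) : (A.setArr a x v).coins = A.coins := rfl
@[simp] theorem base_setArr (a : Fin 8) (x v : ℕ) : (A.setArr a x v).base = A.base := rfl
@[simp] theorem reg_flip (ω : ℕ → Bool) (i j : ℕ) : (A.flip ω i).reg j =
    if j = i then (ω A.coins).toNat else A.reg j := by
  simp [flip, Function.update_apply]
@[simp] theorem coins_flip (ω : ℕ → Bool) (i : ℕ) : (A.flip ω i).coins = A.coins + 1 := rfl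
@[simp] theorem reg_setMem (x v : ℕ) : (A.setMem x v).reg = A.reg := by
  unfold setMem; split_ifs <;> rfl
@[simp] theorem coins_setMem (x v : ℕ) : (A.setMem x v).coins = A.coins := by
  unfold setMem; split_ifs <;> rfl
@[simp] theorem base_setMem (x v : ℕ) : (A.setMem x v).base = A.base := by
  unfold setMem; split_ifs <;> rfl

theorem mem_of_lt {x : ℕ} (h : x < A.base) : A.mem x = A.inp x := if_pos h

theorem mem_add (x : ℕ) (a : Fin 8) : A.mem (A.base + (8 * x) + a) = A.arr a x := by
  rw [mem, if_neg (by omega)]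
  have h1 : A.base + 8 * x + a - A.base = 8 * x + a := by omega
  rw [h1]
  congr 1
  · ext
    simp only [Fin.ofNat]
    have := a.2; omega
  · have := a.2; omega

/-- Behind `base`, each address is `base + 8 z + a'` for a unique entry `z` of a unique array `a'`,
so writing to one array disturbs no other. -/
theorem mem_setArr (a : Fin 8) (x v : ℕ) :
    (A.setArr a x v).mem = Function.update A.mem (A.base + 8 * x + a) v := by
  funext y
  by_cases hy : y < A.base
  · rw [Function.update_of_ne (by omega), mem, mem, if_pos hy, if_pos (by simpa using hy)]
    rfl
  · obtain ⟨z, a', rfl⟩ : ∃ (z : ℕ) (a' : Fin 8), y = A.base + 8 * z + a' :=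
      ⟨(y - A.base) / 8, ⟨(y - A.base) % 8, Nat.mod_lt _ (by norm_num)⟩, by simp only; omega⟩
    have h := mem_add (A.setArr a x v) z a'
    rw [base_setArr] at h
    rw [h, arr_setArr]
    by_cases ha : a' = a
    · subst ha
      rw [if_pos rfl]
      by_cases hz : z = x
      · subst hz; simp
      · rw [Function.update_of_ne hz, Function.update_of_ne (by omega), mem_add]
    · have ha' : (a' : ℕ) ≠ a := fun h => ha (Fin.ext h)
      rw [if_neg ha, Function.update_of_ne (by have := a.2; have := a'.2; omega), mem_add]

theorem mem_setMem (x v : ℕ) : (A.setMem x v).mem = Function.update A.mem x v := by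
  by_cases hx : x < A.base
  · funext y
    rw [setMem, if_pos hx]
    simp only [mem, Function.update_apply]
    by_cases hy : y = x
    · subst hy; simp [hx]
    · simp [hy]
  · rw [setMem, if_neg hx, mem_setArr]
    congr 1
    simp only [Fin.ofNat]; omega

end AState

namespace AExpr

/-- The value of an expression. -/
def eval (A : AState) : AExpr → ℕ
  | const k => k
  | reg i => A.reg i
  | inp a => A.mem (a.eval A)
  | arr a x => A.arr a (x.eval A)
  | add a b => a.eval A + b.eval A
  | sub a b => a.eval A - b.eval A
  | mul a b => a.eval A * b.eval A
  | div a b => a.eval A / b.eval A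

/-- The cost of evaluating the compiled expression. -/
def cost (A : AState) : AExpr → ℕ
  | const _ => 1
  | reg _ => 1
  | inp a => a.cost A + 1
  | arr _ x => 8 * x.cost A + 12
  | add a b => a.cost A + b.cost A + 1
  | sub a b => a.cost A + b.cost A + 1
  | mul a b => a.cost A + b.cost A + ((a.eval A).size + (b.eval A).size + 1)
  | div a b => a.cost A + b.cost A + ((a.eval A).size + (b.eval A).size + 1)

/-- Twice an expression. -/
def dbl (e : Expr) : Expr := .add e e

/-- The address of an array entry. -/
def addr (a : Fin 8) (x : Expr) : Expr := .add (.add (.reg 1) (dbl (dbl (dbl x)))) (.const a)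

/-- The compiled expression. Register `i` is kept in the register `2 i` of the machine, the address
`base` in the register `1`. -/
def compile : AExpr → Expr
  | const k => .const k
  | reg i => .reg (2 * i)
  | inp a => .cell a.compile
  | arr a x => .cell (addr a x.compile)
  | add a b => .add a.compile b.compile
  | sub a b => .sub a.compile b.compile
  | mul a b => .mul a.compile b.compile
  | div a b => .div a.compile b.compile

end AExpr

/-- The final state and the cost of a program, when the coin flips come out as `ω 0, ω 1, …` -/
def run (ω : ℕ → Bool) : AProg → AState → AState × ℕ
  | .skip, A => (A, 2)
  | .set i e, A => (A.setReg i (e.eval A), e.cost A + 1)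
  | .store a x e, A => (A.setArr a (x.eval A) (e.eval A), 8 * x.cost A + e.cost A + 12)
  | .poke x e, A => (A.setMem (x.eval A) (e.eval A), x.cost A + e.cost A + 1)
  | .flip i, A => (A.flip ω i, 1)
  | .seq p q, A => ((run ω q (run ω p A).1).1, (run ω p A).2 + (run ω q (run ω p A).1).2)
  | .ite e p q, A =>
    if e.eval A = 0 then ((run ω q A).1, e.cost A + 1 + (run ω q A).2)
    else ((run ω p A).1, e.cost A + 1 + (run ω p A).2)
  | .rep i e p, A => Nat.rec (A, e.cost A + 7)
      (fun k r => ((run ω p (r.1.setReg i k)).1, r.2 + (run ω p (r.1.setReg i k)).2 + 10))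
      (e.eval A)

/-- The compiled program. A loop at nesting depth `d` uses the registers `4 d + 3` and
`4 d + 5`. -/
def compile : ℕ → AProg → Prog
  | _, .skip => .loop (.const 0) (.flip 0)
  | _, .set i e => .set (2 * i) e.compile
  | _, .store a x e => .store (AExpr.addr a x.compile) e.compile
  | _, .poke x e => .store x.compile e.compile
  | _, .flip i => .flip (2 * i)
  | d, .seq p q => .seq (compile d p) (compile d q)
  | d, .ite e p q => .ite e.compile (compile d p) (compile d q)
  | d, .rep i e p => .seq (.set (4 * d + 5) e.compile) (.seq (.set (4 * d + 3) (.const 0))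
      (.loop (.sub (.reg (4 * d + 5)) (.reg (4 * d + 3)))
        (.seq (.set (2 * i) (.reg (4 * d + 3)))
          (.seq (compile (d + 1) p) (.set (4 * d + 3) (.add (.reg (4 * d + 3)) (.const 1)))))))

/-- The state `s` of the machine represents `A`. -/
structure Rep (s : State) (A : AState) : Prop where
  reg : ∀ i, s.reg (2 * i) = A.reg i
  mem : s.mem = A.mem
  coins : s.coins = A.coins
  base : s.reg 1 = A.base

theorem Rep.eval_eq {s : State} {A : AState} (h : Rep s A) (e : AExpr) :
    e.compile.eval s = e.eval A := by
  induction e with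
  | const k => rfl
  | reg i => exact h.reg i
  | inp a ih => simp only [AExpr.compile, Expr.eval, AExpr.eval, ih, h.mem]
  | arr a x ih =>
    simp only [AExpr.compile, AExpr.addr, AExpr.dbl, Expr.eval, AExpr.eval, ih, h.mem, h.base]
    rw [← A.mem_add]; congr 1; ring
  | add a b iha ihb => simp only [AExpr.compile, Expr.eval, AExpr.eval, iha, ihb]
  | sub a b iha ihb => simp only [AExpr.compile, Expr.eval, AExpr.eval, iha, ihb]
  | mul a b iha ihb => simp only [AExpr.compile, Expr.eval, AExpr.eval, iha, ihb]
  | div a b iha ihb => simp only [AExpr.compile, Expr.eval, AExpr.eval, iha, ihb]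

theorem Rep.addr_eq {s : State} {A : AState} (h : Rep s A) (a : Fin 8) (x : AExpr) :
    (AExpr.addr a x.compile).eval s = A.base + 8 * x.eval A + a := by
  simp only [AExpr.addr, AExpr.dbl, Expr.eval, h.eval_eq, h.base]; ring

theorem Rep.cost_eq {s : State} {A : AState} (h : Rep s A) (e : AExpr) :
    e.compile.cost s = e.cost A := by
  induction e with
  | const k => rfl
  | reg i => rfl
  | inp a ih => simp only [AExpr.compile, Expr.cost, AExpr.cost, ih]
  -- Addresses are computed by three doublings and two additions, without multiplication. The cost
  -- `8 c + 11`, plus one for the access, thus depends only on the cost `c` of the index.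
  | arr a x ih =>
    simp only [AExpr.compile, AExpr.addr, AExpr.dbl, Expr.cost, AExpr.cost, ih]; ring
  | add a b iha ihb => simp only [AExpr.compile, Expr.cost, AExpr.cost, iha, ihb]
  | sub a b iha ihb => simp only [AExpr.compile, Expr.cost, AExpr.cost, iha, ihb]
  | mul a b iha ihb => simp only [AExpr.compile, Expr.cost, AExpr.cost, iha, ihb, h.eval_eq]
  | div a b iha ihb => simp only [AExpr.compile, Expr.cost, AExpr.cost, iha, ihb, h.eval_eq]

/-- The machine state after setting a register. -/
def upd (s : State) (r v : ℕ) : State := { s with reg := Function.update s.reg r v }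

theorem Rep.upd {s : State} {A : AState} (h : Rep s A) (i v : ℕ) :
    Rep (upd s (2 * i) v) (A.setReg i v) where
  reg j := by
    simp only [ArrProg.upd, Function.update_apply, AState.reg_setReg]
    simp [h.reg]
  mem := h.mem
  coins := h.coins
  base := by
    simp only [ArrProg.upd]; rw [Function.update_of_ne (by omega)]; exact h.base

theorem Rep.upd_odd {s : State} {A : AState} (h : Rep s A) (r v : ℕ) (hr : r % 2 = 1)
    (hr' : r ≠ 1) : Rep (ArrProg.upd s r v) A where
  reg j := by
    simp only [ArrProg.upd]; rw [Function.update_of_ne (by omega)]; exact h.reg j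
  mem := h.mem
  coins := h.coins
  base := by
    simp only [ArrProg.upd]; rw [Function.update_of_ne hr'.symm]; exact h.base

theorem _root_.RandRAM.Exec.cast {ω : ℕ → Bool} {p : Prog} {s s' : State} {t t' : ℕ} (h : Exec ω p s s' t)
    (e : t = t') : Exec ω p s s' t' := e ▸ h

/-- The compiled program behaves like the program. It leaves the registers that belong to
enclosing loops unchanged. -/
theorem exec_compile (ω : ℕ → Bool) (p : AProg) : ∀ (d : ℕ) (s : State) (A : AState), Rep s A →
    ∃ s', Exec ω (compile d p) s s' (run ω p A).2 ∧ Rep s' (run ω p A).1 ∧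
      ∀ r, r % 2 = 1 → r < 4 * d + 3 → s'.reg r = s.reg r := by
  induction p with
  | skip =>
    intro d s A h
    exact ⟨s, Exec.loopFalse rfl, h, fun _ _ _ => rfl⟩
  | set i e =>
    intro d s A h
    refine ⟨_, (Exec.set (2 * i) e.compile s).cast (by rw [h.cost_eq]; rfl), ?_, ?_⟩
    · rw [h.eval_eq]; exact h.upd i _
    · intro r hr _
      exact Function.update_of_ne (by omega) _ _
  | store a x e =>
    intro d s A h
    refine ⟨_, (Exec.store (AExpr.addr a x.compile) e.compile s).cast ?_, ⟨h.reg, ?_, h.coins,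
      h.base⟩, fun _ _ _ => rfl⟩
    · simp only [AExpr.addr, AExpr.dbl, Expr.cost, h.cost_eq, run]; ring
    · rw [h.addr_eq, h.eval_eq, h.mem]; exact (A.mem_setArr _ _ _).symm
  | poke x e =>
    intro d s A h
    refine ⟨_, (Exec.store x.compile e.compile s).cast ?_, ⟨?_, ?_, ?_, ?_⟩, fun _ _ _ => rfl⟩
    · simp only [h.cost_eq, run]
    · simpa [run] using h.reg
    · rw [h.eval_eq, h.eval_eq, h.mem]; exact (A.mem_setMem _ _).symm
    · simpa [run] using h.coins
    · simpa [run] using h.base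
  | flip i =>
    intro d s A h
    refine ⟨_, Exec.flip (2 * i) s, ⟨?_, h.mem, ?_, ?_⟩, ?_⟩
    · intro j
      simp only [run, Function.update_apply, AState.reg_flip, h.coins]
      simp [h.reg]
    · simp [run, h.coins]
    · exact (Function.update_of_ne (by omega) _ _).trans h.base
    · intro r hr _
      exact Function.update_of_ne (by omega) _ _
  | seq p q ihp ihq =>
    intro d s A h
    obtain ⟨s₁, e₁, h₁, k₁⟩ := ihp d s A h
    obtain ⟨s₂, e₂, h₂, k₂⟩ := ihq d s₁ _ h₁
    exact ⟨s₂, e₁.seq e₂, h₂, fun r hr hd => (k₂ r hr hd).trans (k₁ r hr hd)⟩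
  | ite e p q ihp ihq =>
    intro d s A h
    by_cases he : e.eval A = 0
    · obtain ⟨s₂, e₂, h₂, k₂⟩ := ihq d s A h
      simp only [run, he, if_true]
      exact ⟨s₂, (Exec.iteFalse (by rw [h.eval_eq, he]) e₂).cast (by rw [h.cost_eq]), h₂, k₂⟩
    · obtain ⟨s₂, e₂, h₂, k₂⟩ := ihp d s A h
      simp only [run, he, if_false]
      exact ⟨s₂, (Exec.iteTrue (by rwa [h.eval_eq]) e₂).cast (by rw [h.cost_eq]), h₂, k₂⟩
  | rep i e p ih =>
    intro d s A h
    set N := e.eval A with hN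
    set f : ℕ → AState × ℕ := fun k => Nat.rec (A, e.cost A + 7)
      (fun k r => ((run ω p (r.1.setReg i k)).1, r.2 + (run ω p (r.1.setReg i k)).2 + 10)) k
      with hf
    have hrun : run ω (.rep i e p) A = f N := rfl
    have hfs : ∀ k, f (k + 1) = ((run ω p ((f k).1.setReg i k)).1,
        (f k).2 + (run ω p ((f k).1.setReg i k)).2 + 10) := fun k => rfl
    set body : Prog := .seq (.set (2 * i) (.reg (4 * d + 3)))
      (.seq (compile (d + 1) p) (.set (4 * d + 3) (.add (.reg (4 * d + 3)) (.const 1))))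
    set cond : Expr := .sub (.reg (4 * d + 5)) (.reg (4 * d + 3))
    -- One pass through the body, with 2 units for copying the counter and 4 for advancing it. Loops
    -- inside the body use registers from `4 * d + 7` on, so counter and bound survive.
    have step : ∀ k s, Rep s (f k).1 → s.reg (4 * d + 3) = k →
        ∃ s', Exec ω body s s' ((run ω p ((f k).1.setReg i k)).2 + 6) ∧ Rep s' (f (k + 1)).1 ∧
          s'.reg (4 * d + 3) = k + 1 ∧
          ∀ r, r % 2 = 1 → r < 4 * d + 7 → r ≠ 4 * d + 3 → s'.reg r = s.reg r := by
      intro k s hs hk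
      have e1 : Exec ω (.set (2 * i) (.reg (4 * d + 3))) s (upd s (2 * i) k) 2 := by
        have := Exec.set (ω := ω) (2 * i) (.reg (4 * d + 3)) s
        simp only [Expr.eval, hk, Expr.cost] at this
        exact this
      obtain ⟨s₂, e2, h2, k2⟩ := ih (d + 1) _ _ (hs.upd i k)
      have hk2 : s₂.reg (4 * d + 3) = k := by
        rw [k2 _ (by omega) (by omega)]
        simp only [upd]; rw [Function.update_of_ne (by omega), hk]
      have e3 : Exec ω (.set (4 * d + 3) (.add (.reg (4 * d + 3)) (.const 1))) s₂
          (upd s₂ (4 * d + 3) (k + 1)) 4 := by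
        have := Exec.set (ω := ω) (4 * d + 3) (.add (.reg (4 * d + 3)) (.const 1)) s₂
        simp only [Expr.eval, hk2, Expr.cost] at this
        exact this
      refine ⟨_, (e1.seq (e2.seq e3)).cast (by ring), ?_, by simp [upd], ?_⟩
      · rw [hfs]; exact h2.upd_odd _ _ (by omega) (by omega)
      · intro r hr hr7 hne
        simp only [upd]
        rw [Function.update_of_ne hne, k2 r hr (by omega)]
        simp only [upd]; rw [Function.update_of_ne (by omega)]
    -- Induction on the number `j` of passes left. The extra 4 is the last, failing test of the
    -- condition, which the constant 7 in the cost of a loop already includes.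
    have loop : ∀ j k s, j + k = N → Rep s (f k).1 → s.reg (4 * d + 3) = k →
        s.reg (4 * d + 5) = N → ∃ s' t, Exec ω (.loop cond body) s s' t ∧ Rep s' (f N).1 ∧
          (f k).2 + t = (f N).2 + 4 ∧
          ∀ r, r % 2 = 1 → r < 4 * d + 3 → s'.reg r = s.reg r := by
      intro j
      induction j with
      | zero =>
        intro k s hjk hs h3 h5
        obtain rfl : k = N := by omega
        exact ⟨s, _, Exec.loopFalse (by simp [cond, Expr.eval, h3, h5]), hs,
          by simp [cond, Expr.cost], fun _ _ _ => rfl⟩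
      | succ j ihj =>
        intro k s hjk hs h3 h5
        obtain ⟨s₁, e₁, r₁, c₁, p₁⟩ := step k s hs h3
        obtain ⟨s₂, t, e₂, r₂, ht, p₂⟩ := ihj (k + 1) s₁ (by omega) r₁ c₁
          ((p₁ _ (by omega) (by omega) (by omega)).trans h5)
        refine ⟨s₂, _, Exec.loopTrue (by simp only [cond, Expr.eval, h3, h5]; omega) e₁ e₂, r₂,
          ?_, fun r hr hd => (p₂ r hr hd).trans (p₁ r hr (by omega) (by omega))⟩
        rw [hfs] at ht
        simp only [cond, Expr.cost] at ht ⊢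
        omega
    have e1 := Exec.set (ω := ω) (4 * d + 5) e.compile s
    rw [h.eval_eq, h.cost_eq] at e1
    have r1 := h.upd_odd (4 * d + 5) N (by omega) (by omega)
    have e2 := Exec.set (ω := ω) (4 * d + 3) (.const 0) (upd s (4 * d + 5) N)
    have r2 := r1.upd_odd (4 * d + 3) 0 (by omega) (by omega)
    obtain ⟨s', t, e3, r3, ht, k3⟩ := loop N 0 _ (by omega) r2 (by simp [upd])
      (by simp [upd])
    refine ⟨s', (e1.seq (e2.seq e3)).cast ?_, by rw [hrun]; exact r3, ?_⟩
    · rw [hrun]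
      have : (f 0).2 = e.cost A + 7 := rfl
      simp only [Expr.cost]
      omega
    · intro r hr hd
      rw [k3 r hr hd]
      simp only [upd]
      rw [Function.update_of_ne (by omega), Function.update_of_ne (by omega)]

/-! ### Program logic -/

namespace AProg

/-- The registers to which a program writes. -/
def wr : AProg → List ℕ
  | skip => []
  | set i _ => [i]
  | store _ _ _ => []
  | poke _ _ => []
  | flip i => [i]
  | seq p q => p.wr ++ q.wr
  | ite _ p q => p.wr ++ q.wr
  | .rep i _ p => i :: p.wr

/-- The arrays to which a program writes. -/
def wa : AProg → List (Fin 8)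
  | skip => []
  | set _ _ => []
  | store a _ _ => [a]
  | poke _ _ => []
  | flip _ => []
  | seq p q => p.wa ++ q.wa
  | ite _ p q => p.wa ++ q.wa
  | .rep _ _ p => p.wa

/-- Whether a program writes to input cells. -/
def pokes : AProg → Bool
  | poke _ _ => true
  | seq p q => p.pokes || q.pokes
  | ite _ p q => p.pokes || q.pokes
  | .rep _ _ p => p.pokes
  | _ => false

/-- Whether a program flips coins. -/
def flips : AProg → Bool
  | flip _ => true
  | seq p q => p.flips || q.flips
  | ite _ p q => p.flips || q.flips
  | .rep _ _ p => p.flips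
  | _ => false

end AProg

@[simp] theorem AState.mem_setReg (A : AState) (i v : ℕ) : (A.setReg i v).mem = A.mem := rfl

@[simp] theorem AState.mem_flip (A : AState) (ω : ℕ → Bool) (i : ℕ) : (A.flip ω i).mem = A.mem :=
  rfl

/-- The states `A` and `B` agree on all that the program `p` does not touch. -/
structure Fr (p : AProg) (A B : AState) : Prop where
  reg : ∀ j, j ∉ p.wr → B.reg j = A.reg j
  arr : p.pokes = false → ∀ a, a ∉ p.wa → B.arr a = A.arr a
  mem : p.pokes = false → ∀ x < A.base, B.mem x = A.mem x
  base : B.base = A.base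
  coins : p.flips = false → B.coins = A.coins

theorem Fr.refl (p : AProg) (A : AState) : Fr p A A :=
  ⟨fun _ _ => rfl, fun _ _ _ => rfl, fun _ _ _ => rfl, rfl, fun _ => rfl⟩

theorem Fr.trans {p q r : AProg} {A B C : AState} (h : Fr p A B) (h' : Fr q B C)
    (h1 : p.wr ⊆ r.wr) (h2 : q.wr ⊆ r.wr) (h3 : p.wa ⊆ r.wa) (h4 : q.wa ⊆ r.wa)
    (h5 : r.pokes = false → p.pokes = false ∧ q.pokes = false)
    (h6 : r.flips = false → p.flips = false ∧ q.flips = false) : Fr r A C where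
  reg j hj := (h'.reg j fun hm => hj (h2 hm)).trans (h.reg j fun hm => hj (h1 hm))
  arr hp a ha := (h'.arr (h5 hp).2 a fun hm => ha (h4 hm)).trans
    (h.arr (h5 hp).1 a fun hm => ha (h3 hm))
  mem hp x hx := (h'.mem (h5 hp).2 x (h.base ▸ hx)).trans (h.mem (h5 hp).1 x hx)
  base := h'.base.trans h.base
  coins hp := (h'.coins (h6 hp).2).trans (h.coins (h6 hp).1)

theorem Fr.mono {p r : AProg} {A B : AState} (h : Fr p A B) (h1 : p.wr ⊆ r.wr) (h3 : p.wa ⊆ r.wa)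
    (h5 : r.pokes = false → p.pokes = false) (h6 : r.flips = false → p.flips = false) :
    Fr r A B :=
  h.trans (Fr.refl p B) h1 h1 h3 h3 (fun h => ⟨h5 h, h5 h⟩) fun h => ⟨h6 h, h6 h⟩

theorem Fr.for_trans {i : ℕ} {e : AExpr} {p : AProg} {A B C : AState} (h : Fr (.rep i e p) A B)
    (h' : Fr (.rep i e p) B C) : Fr (.rep i e p) A C :=
  h.trans h' (List.Subset.refl _) (List.Subset.refl _) (List.Subset.refl _) (List.Subset.refl _)
    (fun h => ⟨h, h⟩) fun h => ⟨h, h⟩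

theorem fr_setReg (i : ℕ) (e : AExpr) (p : AProg) (A : AState) (v : ℕ) :
    Fr (.rep i e p) A (A.setReg i v) where
  reg j hj := by
    have : j ≠ i := fun h => hj (by simp [AProg.wr, h])
    simp [this]
  arr _ _ _ := rfl
  mem _ _ _ := rfl
  base := rfl
  coins _ := rfl

/-- The frame rule. The sets of written registers and arrays are computed from the program text, so
later frame conditions can be checked by `decide`. -/
theorem fr_run (ω : ℕ → Bool) (p : AProg) : ∀ A, Fr p A (run ω p A).1 := by
  induction p with
  | skip => exact fun A => Fr.refl _ A
  | set i e =>
    refine fun A => ⟨fun j hj => ?_, fun _ _ _ => rfl, fun _ _ _ => rfl, rfl, fun _ => rfl⟩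
    have : j ≠ i := by simpa [AProg.wr] using hj
    simp [run, this]
  | store a x e =>
    refine fun A => ⟨fun _ _ => rfl, fun _ a' ha => ?_, fun _ y hy => ?_, rfl, fun _ => rfl⟩
    · have : a' ≠ a := by simpa [AProg.wa] using ha
      simp [run, this]
    · simp only [run, AState.mem_setArr]
      exact Function.update_of_ne (by omega) _ _
  | poke x e =>
    refine fun A => ⟨fun _ _ => ?_, fun h => ?_, fun h => ?_, ?_, fun _ => ?_⟩
    · simp [run]
    · simp [AProg.pokes] at h
    · simp [AProg.pokes] at h
    · simp [run]
    · simp [run]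
  | flip i =>
    refine fun A => ⟨fun j hj => ?_, fun _ _ _ => rfl, fun _ _ _ => rfl, rfl, fun h => ?_⟩
    · have : j ≠ i := by simpa [AProg.wr] using hj
      simp [run, this]
    · simp [AProg.flips] at h
  | seq p q ihp ihq =>
    exact fun A => (ihp A).trans (ihq _) (by simp [AProg.wr]) (by simp [AProg.wr])
      (by simp [AProg.wa]) (by simp [AProg.wa]) (by simp [AProg.pokes]) (by simp [AProg.flips])
  | ite e p q ihp ihq =>
    intro A
    simp only [run]
    split_ifs
    · exact (ihq A).mono (by simp [AProg.wr]) (by simp [AProg.wa]) (by simp [AProg.pokes])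
        (by simp [AProg.flips])
    · exact (ihp A).mono (by simp [AProg.wr]) (by simp [AProg.wa])
        (by simp +contextual [AProg.pokes]) (by simp +contextual [AProg.flips])
  | rep i e p ih =>
    intro A
    simp only [run]
    induction e.eval A with
    | zero => exact Fr.refl _ A
    | succ k ihk =>
      refine (ihk.for_trans (fr_setReg i e p _ k)).for_trans ((ih _).mono ?_ ?_ id id)
      · simp [AProg.wr]
      · simp [AProg.wa]

/-- The loop rule. The invariant has to describe only what the body changes, because the step also
receives `Fr` relative to the state before the loop. Stability under `setReg i` is required since
each pass begins by writing the loop counter. -/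
theorem run_for {ω : ℕ → Bool} {p : AProg} {C i : ℕ} {e : AExpr} {N c : ℕ} {A : AState}
    (Inv : ℕ → AState → Prop) (hN : e.eval A = N) (hc : e.cost A ≤ c) (h0 : Inv 0 A)
    (hInv : ∀ k B v, Inv k B → Inv k (B.setReg i v))
    (hstep : ∀ k < N, ∀ B, Inv k B → B.reg i = k → Fr (.rep i e p) A B →
      Inv (k + 1) (run ω p B).1 ∧ (run ω p B).2 ≤ C) :
    Inv N (run ω (.rep i e p) A).1 ∧ (run ω (.rep i e p) A).2 ≤ c + 7 + N * (C + 10) := by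
  set f : ℕ → AState × ℕ := fun k => Nat.rec (A, e.cost A + 7)
    (fun k r => ((run ω p (r.1.setReg i k)).1, r.2 + (run ω p (r.1.setReg i k)).2 + 10)) k
  have hrun : run ω (.rep i e p) A = f N := by rw [← hN]; rfl
  have hfs : ∀ k, f (k + 1) = ((run ω p ((f k).1.setReg i k)).1,
      (f k).2 + (run ω p ((f k).1.setReg i k)).2 + 10) := fun k => rfl
  have key : ∀ k ≤ N, Inv k (f k).1 ∧ Fr (.rep i e p) A (f k).1 ∧
      (f k).2 ≤ c + 7 + k * (C + 10) := by
    intro k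
    induction k with
    | zero =>
      intro _
      refine ⟨h0, Fr.refl _ A, ?_⟩
      have : (f 0).2 = e.cost A + 7 := rfl
      omega
    | succ k ih =>
      intro hk
      obtain ⟨h1, h2, h3⟩ := ih (by omega)
      have h2' := h2.for_trans (fr_setReg i e p _ k)
      obtain ⟨h4, h5⟩ := hstep k (by omega) _ (hInv k _ k h1) (by simp) h2'
      rw [hfs]
      refine ⟨h4, h2'.for_trans ((fr_run ω p _).mono ?_ ?_ id id), ?_⟩
      · simp [AProg.wr]
      · simp [AProg.wa]
      · simp only
        rw [Nat.succ_mul]; omega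
  rw [hrun]
  exact ⟨(key N le_rfl).1, (key N le_rfl).2.2⟩

theorem size_le_self (x : ℕ) : x.size ≤ x := Nat.size_le.2 x.lt_two_pow_self

end ArrProg

/-! ### The program -/

namespace ArrProg
open RandRAM Resampling

/-- The data with which the main part of the program works: the graph, the weights `W` and for each
block the vertices ordered by weight. -/
structure Ctx {n l : ℕ} (G : SimpleGraph (Fin n)) (b s S m Q : ℕ) (W : Fin n → ℕ)
    (ord : Fin l → ℕ → Fin n) (A : AState) : Prop where
  n_eq : A.reg 0 = n
  l_eq : A.reg 1 = l
  b_eq : A.reg 2 = b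
  s_eq : A.reg 4 = s
  S_eq : A.reg 5 = S
  m_eq : A.reg 6 = m
  Q_eq : A.reg 7 = Q
  base : A.base = 2 + n + n * n + n + n
  adj : ∀ u v : Fin n, A.mem (2 + n + u * n + v) ≠ 0 ↔ G.Adj u v
  W_eq : ∀ v : Fin n, A.arr 1 v = W v
  ord_eq : ∀ (i : Fin l), ∀ k < b, A.arr 2 (i * b + k) = ord i k

/-- The program does not touch the data. -/
def AProg.Keeps (p : AProg) : Prop :=
  p.pokes = false ∧ (∀ j ∈ p.wr, 12 ≤ j) ∧ ∀ a ∈ p.wa, 3 ≤ (a : ℕ)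

instance (p : AProg) : Decidable p.Keeps := by unfold AProg.Keeps; infer_instance

theorem adj_lt {n : ℕ} (u v : Fin n) : 2 + n + u * n + v < 2 + n + n * n + n + n := by
  have : (u : ℕ) * n + n ≤ n * n := by
    rw [← Nat.succ_mul]; exact Nat.mul_le_mul_right _ u.2
  have := v.2
  omega

section
variable {n l b s S m Q : ℕ} {G : SimpleGraph (Fin n)} {W : Fin n → ℕ} {ord : Fin l → ℕ → Fin n}
  {A B : AState} {ω : ℕ → Bool}

theorem Ctx.fr (h : Ctx G b s S m Q W ord A) {p : AProg} (hf : Fr p A B) (hp : p.Keeps) :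
    Ctx G b s S m Q W ord B := by
  obtain ⟨h1, h2, h3⟩ := hp
  have hr : ∀ j, j < 12 → B.reg j = A.reg j := fun j hj => hf.reg j fun hm => by
    have := h2 j hm; omega
  have ha : ∀ a : Fin 8, (a : ℕ) < 3 → B.arr a = A.arr a := fun a ha => hf.arr h1 a fun hm => by
    have := h3 a hm; omega
  refine ⟨?_, ?_, ?_, ?_, ?_, ?_, ?_, ?_, ?_, ?_, ?_⟩
  · rw [hr 0 (by omega), h.n_eq]
  · rw [hr 1 (by omega), h.l_eq]
  · rw [hr 2 (by omega), h.b_eq]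
  · rw [hr 4 (by omega), h.s_eq]
  · rw [hr 5 (by omega), h.S_eq]
  · rw [hr 6 (by omega), h.m_eq]
  · rw [hr 7 (by omega), h.Q_eq]
  · rw [hf.base, h.base]
  · intro u v
    rw [hf.mem h1 _ (by rw [h.base]; exact adj_lt u v), h.adj]
  · rw [ha 1 (by decide)]; exact h.W_eq
  · rw [ha 2 (by decide)]; exact h.ord_eq

/-- Record the blocks `i` and `j` if their current vertices are adjacent. -/
def findPair : AProg :=
  .ite (.inp (.add (.add (.add (.const 2) (.reg 0)) (.mul (.arr 5 (.reg 13)) (.reg 0)))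
      (.arr 5 (.reg 14))))
    (.seq (.set 16 (.add (.reg 13) (.const 1))) (.set 17 (.reg 14))) .skip

/-- Search for two adjacent current vertices. -/
def findConf : AProg := .seq (.set 16 (.const 0)) (.rep 13 (.reg 1) (.rep 14 (.reg 1) findPair))

/-- The outcome of a search for two adjacent current vertices among those that satisfy `P`. -/
def Found (G : SimpleGraph (Fin n)) (cur : Fin l → Fin n) (P : Fin l → Fin l → Prop)
    (A : AState) : Prop :=
  (A.reg 16 = 0 ∧ ∀ i j, P i j → ¬ G.Adj (cur i) (cur j)) ∨
    ∃ i j, G.Adj (cur i) (cur j) ∧ A.reg 16 = i + 1 ∧ A.reg 17 = j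

theorem Found.mono {cur : Fin l → Fin n} {P P' : Fin l → Fin l → Prop} (h : Found G cur P A)
    (hP : ∀ i j, P' i j → P i j) : Found G cur P' A :=
  h.imp (fun h => ⟨h.1, fun i j hij => h.2 i j (hP i j hij)⟩) id

/-- Register 16 holds the first block plus one, so that zero means that nothing was found. Later
finds overwrite earlier ones; any conflict will do. -/
theorem run_findConf (h : Ctx G b s S m Q W ord A) {cur : Fin l → Fin n}
    (hcur : ∀ i : Fin l, A.arr 5 i = cur i) :
    Found G cur (fun _ _ => True) (run ω findConf A).1 ∧
      (run ω findConf A).2 ≤ 10 + l * (l * (2 * n + 110) + 18) := by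
  set A₁ := A.setReg 16 0
  have h₁ : Ctx G b s S m Q W ord A₁ := h.fr (fr_run ω (.set 16 (.const 0)) A) (by decide)
  have hcur₁ : ∀ i : Fin l, A₁.arr 5 i = cur i := hcur
  have key := run_for (ω := ω) (A := A₁) (i := 13) (e := .reg 1) (N := l) (c := 1)
    (p := .rep 14 (.reg 1) findPair)
    (C := l * (2 * n + 110) + 8)
    (fun k B => Found G cur (fun i _ => (i : ℕ) < k) B) h₁.l_eq le_rfl
    (Or.inl ⟨rfl, by simp⟩) (fun k B v hB => by simpa [Found] using hB) (by
      intro k hk B hB hBk hfB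
      have hcB := h₁.fr hfB (by decide)
      have hcurB : ∀ i : Fin l, B.arr 5 i = cur i := by
        rw [hfB.arr rfl 5 (by decide)]; exact hcur₁
      have key := run_for (ω := ω) (A := B) (i := 14) (e := .reg 1) (N := l) (c := 1)
        (p := findPair)
        (C := 2 * n + 100)
        -- Pairs are searched in lexicographic order.
        (fun k' D => Found G cur (fun i j => (i : ℕ) < k ∨ (i : ℕ) = k ∧ (j : ℕ) < k') D)
        hcB.l_eq le_rfl (hB.mono (by simp)) (fun k B v hB => by simpa [Found] using hB) (by
          intro k' hk' D hD hDk hfD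
          have hcD := hcB.fr hfD (by decide)
          have hcurD : ∀ i : Fin l, D.arr 5 i = cur i := by
            rw [hfD.arr rfl 5 (by decide)]; exact hcurB
          have e13 : D.reg 13 = k := by rw [hfD.reg 13 (by decide), hBk]
          have c1 := hcurD ⟨k, hk⟩
          have c2 := hcurD ⟨k', hk'⟩
          have hadj := hcD.adj (cur ⟨k, hk⟩) (cur ⟨k', hk'⟩)
          have hs1 := size_le_self (cur ⟨k, hk⟩)
          have hs2 := size_le_self n
          have hlt := (cur ⟨k, hk⟩).2
          simp only at c1 c2
          simp only [findPair, run, AExpr.eval, AExpr.cost, e13, hDk, hcD.n_eq, c1, c2]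
          split_ifs with hz
          · refine ⟨?_, by simp only; omega⟩
            rcases hD with ⟨h0, hD⟩ | hD
            · refine Or.inl ⟨h0, fun i j hij => ?_⟩
              by_cases hij' : (i : ℕ) = k ∧ (j : ℕ) = k'
              · obtain rfl : i = ⟨k, hk⟩ := Fin.ext hij'.1
                obtain rfl : j = ⟨k', hk'⟩ := Fin.ext hij'.2
                exact fun ha => hadj.2 ha hz
              · exact hD i j (by omega)
            · exact Or.inr hD
          · refine ⟨Or.inr ⟨⟨k, hk⟩, ⟨k', hk'⟩, hadj.1 hz, ?_, ?_⟩, ?_⟩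
            · simp
            · simp [hDk]
            · simp only; omega)
      refine ⟨key.1.mono fun i j hij => ?_, key.2.trans (by ring_nf; omega)⟩
      have := j.2
      omega)
  refine ⟨key.1.mono fun i j _ => i.2, ?_⟩
  have : (run ω findConf A).2 =
      2 + (run ω (.rep 13 (.reg 1) (.rep 14 (.reg 1) findPair)) A₁).2 := rfl
  rw [this]
  have := key.2
  ring_nf at this ⊢
  omega

/-- Array 3 holds the table `R`. -/
def Tab (S : ℕ) (R : Fin l → ℕ → Fin n) (A : AState) : Prop :=
  ∀ i : Fin l, ∀ k ≤ S, A.arr 3 (i * (S + 1) + k) = R i k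

/-- Array 4 holds the counters `c`, and array 5 the current vertices. -/
def Shows (R : Fin l → ℕ → Fin n) (c : Fin l → ℕ) (A : AState) : Prop :=
  ∀ i : Fin l, A.arr 4 i = c i ∧ A.arr 5 i = R i (c i)

/-- Move on to the next vertex in a block. -/
def bumpAt (e : AExpr) : AProg := .seq (.store 4 e (.add (.arr 4 e) (.const 1)))
  (.store 5 e (.arr 3 (.add (.mul e (.add (.reg 5) (.const 1))) (.arr 4 e))))

/-- Move on in both blocks of the conflict that has been found. -/
def resample : AProg :=
  .ite (.reg 16) (.seq (bumpAt (.sub (.reg 16) (.const 1))) (bumpAt (.reg 17))) .skip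

/-- The expression `e` is evaluated repeatedly between the two stores; it must depend on registers
only, which the stores leave alone. -/
theorem run_bumpAt {R : Fin l → ℕ → Fin n} {c : Fin l → ℕ} {e : AExpr} {i : Fin l}
    (he : ∀ B : AState, B.reg = A.reg → e.eval B = i) (hc : ∀ B : AState, e.cost B ≤ 3)
    (h : A.reg 5 = S) (hT : Tab S R A) (hA : Shows R c A) (hi : c i + 1 ≤ S) :
    Shows R (Function.update c i (c i + 1)) (run ω (bumpAt e) A).1 ∧
      (run ω (bumpAt e) A).2 ≤ 8 * (S + l) + 900 := by
  have h1 := he A rfl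
  set A₁ := A.setArr 4 i (c i + 1) with hA₁
  have h2 : e.eval A₁ = i := he A₁ rfl
  have e1 := (hA i).1
  have hrun : (run ω (bumpAt e) A).1 = A₁.setArr 5 i (R i (c i + 1)) := by
    have := hT i _ hi
    simp only [bumpAt, run, AExpr.eval, h1, e1]
    rw [← hA₁, h2]
    simp only [hA₁, AState.reg_setArr, AState.arr_setArr, h]
    simp [this]
  have hcost : (run ω (bumpAt e) A).2 ≤ 8 * (S + l) + 900 := by
    have s1 := size_le_self (i : ℕ)
    have s2 := size_le_self (S + 1)
    have := i.2
    have hc1 := hc A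
    have hc2 := hc A₁
    simp only [bumpAt, run, AExpr.eval, AExpr.cost, h1, e1]
    rw [← hA₁, h2]
    simp only [hA₁, AState.reg_setArr, h]
    rw [← hA₁]
    omega
  refine ⟨?_, hcost⟩
  rw [hrun]
  intro j
  by_cases hj : j = i
  · subst hj; simp [hA₁]
  · have hj' : (j : ℕ) ≠ i := fun h => hj (Fin.ext h)
    simp [hA₁, hj, hj', hA j]

theorem run_resample {blk : Fin n → Fin l} {R : Fin l → ℕ → Fin n}
    (hR : ∀ i k, blk (R i k) = i) {log : List (Fin n × Fin n)}
    (hlog : Valid G blk R (fun _ => 0) log) (hlen : log.length < S)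
    (hS : A.reg 5 = S) (hT : Tab S R A) (hA : Shows R (cnt blk log) A)
    (hF : Found G (fun i => R i (cnt blk log i)) (fun _ _ => True) A) :
    (∃ log', Valid G blk R (fun _ => 0) log' ∧ Shows R (cnt blk log') (run ω resample A).1 ∧
      ((log'.length = log.length + 1 ∧
        ∃ i j, G.Adj (R i (cnt blk log i)) (R j (cnt blk log j))) ∨ log' = log ∧
        ∀ i j, ¬ G.Adj (R i (cnt blk log i)) (R j (cnt blk log j)))) ∧
      (run ω resample A).2 ≤ 2 * (8 * (S + l) + 900) + 10 := by
  rcases hF with ⟨h0, hF⟩ | ⟨i, j, hadj, h16, h17⟩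
  · have : run ω resample A = (A, 4) := by simp [resample, run, AExpr.eval, AExpr.cost, h0]
    rw [this]
    exact ⟨⟨log, hlog, hA, Or.inr ⟨rfl, fun i j => hF i j trivial⟩⟩, by simp only; omega⟩
  · have hcle : ∀ i, cnt blk log i < S := fun i => lt_of_le_of_lt List.countP_le_length hlen
    have hij : i ≠ j := by rintro rfl; exact G.irrefl hadj
    have k1 := run_bumpAt (ω := ω) (A := A) (e := .sub (.reg 16) (.const 1)) (i := i)
      (fun B hB => by simp [AExpr.eval, hB, h16]) (fun B => le_rfl) hS hT hA (hcle i)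
    set A₁ := (run ω (bumpAt (.sub (.reg 16) (.const 1))) A).1
    have hf : Fr _ A A₁ := fr_run ω (bumpAt (.sub (.reg 16) (.const 1))) A
    have hr : A₁.reg = A.reg := funext fun j => hf.reg j (by simp [bumpAt, AProg.wr])
    have k2 := run_bumpAt (ω := ω) (A := A₁) (e := .reg 17) (i := j)
      (fun B hB => by simp [AExpr.eval, hB, hr, h17])
      (fun B => by simp [AExpr.cost]) (by rw [hr, hS]) (R := R)
      (fun i k hk => by rw [hf.arr rfl 3 (by decide)]; exact hT i k hk) k1.1 (by
        rw [Function.update_of_ne hij.symm]; exact hcle j)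
    have hrun : run ω resample A = ((run ω (bumpAt (.reg 17)) A₁).1, 2 +
        ((run ω (bumpAt (.sub (.reg 16) (.const 1))) A).2 +
          (run ω (bumpAt (.reg 17)) A₁).2)) := by
      simp only [resample, run, AExpr.eval, AExpr.cost, h16]
      rw [if_neg (by omega)]
    rw [hrun]
    -- The log exists only in the proof; the machine keeps nothing but its counters, and the found
    -- conflict is appended here.
    refine ⟨⟨log ++ [(R i (cnt blk log i), R j (cnt blk log j))], ?_, ?_,
      Or.inl ⟨by simp, i, j, hadj⟩⟩, ?_⟩
    · rw [valid_append]
      refine ⟨hlog, ⟨hadj, ?_, ?_, ?_⟩, trivial⟩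
      · simpa [hR] using hij
      · simp [hR]
      · simp [hR]
    -- Because `i ≠ j`, bumping the two blocks one after the other agrees with counting a single
    -- conflict.
    · have : cnt blk (log ++ [(R i (cnt blk log i), R j (cnt blk log j))]) =
          Function.update (Function.update (cnt blk log) i (cnt blk log i + 1)) j
            (Function.update (cnt blk log) i (cnt blk log i + 1) j + 1) := by
        funext x
        rw [cnt_append, cnt_cons, Function.update_of_ne hij.symm]
        simp only [Touches, hR, Function.update_apply]
        by_cases hx : x = j
        · subst hx; simp [cnt]
        · by_cases hx' : x = i
          · subst hx'; simp [cnt, hx]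
          · simp [hx, hx', Ne.symm hx, Ne.symm hx', cnt]
      rw [this]
      exact k2.1
    · simp only
      have := k1.2
      have := k2.2
      omega

/-- One step of the resampling process. -/
def mtStep : AProg := .seq findConf resample

/-- The cost of a search. -/
def findCost (n l : ℕ) : ℕ := 10 + l * (l * (2 * n + 110) + 18)

/-- The resampling process has been run for `t` steps. -/
def Resampled (G : SimpleGraph (Fin n)) (blk : Fin n → Fin l) (R : Fin l → ℕ → Fin n) (t : ℕ)
    (A : AState) : Prop :=
  ∃ log, Valid G blk R (fun _ => 0) log ∧ Shows R (cnt blk log) A ∧ (log.length = t ∨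
    log.length ≤ t ∧ ∀ i j, ¬ G.Adj (R i (cnt blk log i)) (R j (cnt blk log j)))

theorem run_mtStep (h : Ctx G b s S m Q W ord A) {blk : Fin n → Fin l} {R : Fin l → ℕ → Fin n}
    (hR : ∀ i k, blk (R i k) = i) (hT : Tab S R A) {t : ℕ} (ht : t < S)
    (hA : Resampled G blk R t A) : Resampled G blk R (t + 1) (run ω mtStep A).1 ∧
      (run ω mtStep A).2 ≤ findCost n l + (2 * (8 * (S + l) + 900) + 10) := by
  obtain ⟨log, hlog, hSh, hl⟩ := hA
  have k1 := run_findConf (ω := ω) h (fun i => (hSh i).2)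
  have hf := fr_run ω findConf A
  have k2 := run_resample (ω := ω) hR hlog (by omega) (h.fr hf (by decide)).S_eq
    (fun i k hk => by rw [hf.arr rfl 3 (by decide)]; exact hT i k hk)
    (fun i => by
      rw [hf.arr rfl 4 (by decide), hf.arr rfl 5 (by decide)]; exact hSh i) k1.1
  refine ⟨?_, add_le_add k1.2 k2.2⟩
  obtain ⟨⟨log', h1, h2, h3⟩, -⟩ := k2
  refine ⟨log', h1, h2, ?_⟩
  rcases h3 with ⟨h3, i, j, hij⟩ | ⟨rfl, h3⟩
  · rcases hl with hl | ⟨-, hn⟩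
    · left; omega
    · exact absurd hij (hn i j)
  · right; exact ⟨by omega, h3⟩

end
end ArrProg

namespace ArrProg
open RandRAM Resampling

section
variable {n l b s S m Q : ℕ} {G : SimpleGraph (Fin n)} {W : Fin n → ℕ} {ord : Fin l → ℕ → Fin n}
  {A B : AState} {ω : ℕ → Bool} {blk : Fin n → Fin l} {R : Fin l → ℕ → Fin n}

/-! #### Filling the table -/

/-- The number with the binary digits `ω o, ω (o + 1), …, ω (o + m - 1)`. -/
def bits (ω : ℕ → Bool) (o : ℕ) : ℕ → ℕ
  | 0 => 0
  | m + 1 => 2 * bits ω o m + (ω (o + m)).toNat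

/-- The table of a round. -/
def table (ω : ℕ → Bool) (s S m : ℕ) (ord : Fin l → ℕ → Fin n) (ρ : ℕ) (i : Fin l) (k : ℕ) :
    Fin n :=
  ord i ((if k ≤ S then bits ω (((ρ * l + i) * (S + 1) + k) * m) m else 0) % s / 2)

/-- Append a random bit to register 24, and reduce modulo `s`. -/
def fillBit : AProg := .seq (.flip 25) (.seq
  (.set 24 (.add (.add (.reg 24) (.reg 24)) (.reg 25)))
  (.ite (.sub (.add (.reg 24) (.const 1)) (.reg 4)) (.set 24 (.sub (.reg 24) (.reg 4))) .skip))

def fillCell : AProg := .seq (.set 24 (.const 0)) (.seq (.rep 23 (.reg 6) fillBit)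
  (.store 3 (.add (.mul (.reg 21) (.add (.reg 5) (.const 1))) (.reg 22))
    (.arr 2 (.add (.mul (.reg 21) (.reg 2)) (.div (.reg 24) (.const 2))))))

def fill : AProg := .rep 21 (.reg 1) (.rep 22 (.add (.reg 5) (.const 1)) fillCell)

/-- Horner's scheme modulo `s`: twice a residue plus a bit is less than `2s`, so one conditional
subtraction reduces it and numbers stay small. -/
theorem run_fillBit (hs : 0 < s) (h4 : A.reg 4 = s) {o k : ℕ} (h24 : A.reg 24 = bits ω o k % s)
    (hc : A.coins = o + k) :
    (run ω fillBit A).1.reg 24 = bits ω o (k + 1) % s ∧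
      (run ω fillBit A).1.coins = o + (k + 1) ∧ (run ω fillBit A).2 ≤ 20 := by
  have hlt := Nat.mod_lt (bits ω o k) hs
  have hb : (ω (o + k)).toNat ≤ 1 := Bool.toNat_le _
  have hmod : bits ω o (k + 1) % s =
      (bits ω o k % s + bits ω o k % s + (ω (o + k)).toNat) % s := by
    simp [bits, two_mul, Nat.add_mod]
  rw [hmod]
  set x := bits ω o k % s
  set y := (ω (o + k)).toNat
  simp only [fillBit, run, AExpr.eval, AExpr.cost, AState.reg_flip, AState.reg_setReg, hc]
  norm_num [h24, h4]
  split_ifs with hz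
  · refine ⟨?_, ?_, ?_⟩
    · simp
      rw [Nat.mod_eq_of_lt (by omega)]
    · simp [hc, add_assoc]
    · simp only; omega
  · refine ⟨?_, ?_, ?_⟩
    · simp
      rw [Nat.mod_eq_sub_mod (by omega), Nat.mod_eq_of_lt (by omega)]
    · simp [hc, add_assoc]
    · simp only; omega

/-- The cell number `x`, counted through all rounds, uses exactly the `m` coins from `x * m` on.
These fixed positions later give the independence of cells and rounds. -/
theorem run_fillCell (h : Ctx G b s S m Q W ord A) (hs : 0 < s) (hsb : s ≤ 2 * b) {x : ℕ}
    {i : Fin l} {k : ℕ} (h21 : A.reg 21 = i) (h22 : A.reg 22 = k) (hc : A.coins = x * m) :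
    (run ω fillCell A).1.arr 3 = Function.update (A.arr 3) (i * (S + 1) + k)
        (ord i (bits ω (x * m) m % s / 2)) ∧
      (run ω fillCell A).1.coins = (x + 1) * m ∧
      (run ω fillCell A).2 ≤ 9 * (2 * l + 4 * b + S) + 30 * m + 500 := by
  set A₁ := A.setReg 24 0
  have k1 := run_for (ω := ω) (A := A₁) (i := 23) (e := .reg 6) (N := m) (c := 1)
    (p := fillBit) (C := 20)
    (fun q D => D.reg 24 = bits ω (x * m) q % s ∧ D.coins = x * m + q)
    h.m_eq le_rfl ⟨by simp [A₁, bits], by simpa [A₁] using hc⟩ (fun q D v hD => by simpa using hD)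
    (by
      intro q hq D hD _ hfD
      have h4 : D.reg 4 = s := by rw [hfD.reg 4 (by decide)]; exact h.s_eq
      have := run_fillBit (ω := ω) hs h4 hD.1 hD.2
      exact ⟨⟨this.1, this.2.1⟩, this.2.2⟩)
  have hf := fr_run ω (.rep 23 (.reg 6) fillBit) A₁
  have hrun : run ω fillCell A = ((run ω (.store 3
      (.add (.mul (.reg 21) (.add (.reg 5) (.const 1))) (.reg 22))
      (.arr 2 (.add (.mul (.reg 21) (.reg 2)) (.div (.reg 24) (.const 2)))))
      (run ω (.rep 23 (.reg 6) fillBit) A₁).1).1, 2 + ((run ω (.rep 23 (.reg 6) fillBit) A₁).2 +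
      (run ω (.store 3 (.add (.mul (.reg 21) (.add (.reg 5) (.const 1))) (.reg 22))
      (.arr 2 (.add (.mul (.reg 21) (.reg 2)) (.div (.reg 24) (.const 2)))))
      (run ω (.rep 23 (.reg 6) fillBit) A₁).1).2)) := rfl
  rw [hrun]
  obtain ⟨⟨h24, hco⟩, hcost⟩ := k1
  set A₂ := (run ω (.rep 23 (.reg 6) fillBit) A₁).1
  have h2 : Ctx G b s S m Q W ord A₂ :=
    (h.fr (fr_run ω (.set 24 (.const 0)) A) (by decide)).fr hf (by decide)
  have e21 : A₂.reg 21 = i := by rw [hf.reg 21 (by decide)]; exact h21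
  have e22 : A₂.reg 22 = k := by rw [hf.reg 22 (by decide)]; exact h22
  have e3 : A₂.arr 3 = A.arr 3 := by rw [hf.arr rfl 3 (by decide)]; rfl
  have hlt := Nat.mod_lt (bits ω (x * m) m) hs
  have hord := h2.ord_eq i (bits ω (x * m) m % s / 2) (by omega)
  refine ⟨?_, ?_, ?_⟩
  · simp only [run, AExpr.eval, e21, e22, h2.S_eq, h2.b_eq, h24, hord, AState.arr_setArr, if_true,
      e3]
  · simp only [run, AState.coins_setArr, hco]; ring
  · have s1 := size_le_self (i : ℕ)
    have s2 := size_le_self (S + 1)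
    have s3 := size_le_self b
    have s4 := size_le_self (bits ω (x * m) m % s)
    have s5 := size_le_self 2
    have := i.2
    generalize (run ω (.rep 23 (.reg 6) fillBit) A₁).2 = t at hcost ⊢
    simp only [run, AExpr.eval, AExpr.cost, e21, h2.S_eq, h2.b_eq, h24]
    omega

theorem index_inj {S i j k k' : ℕ} (hk : k ≤ S) (hk' : k' ≤ S)
    (h : i * (S + 1) + k = j * (S + 1) + k') : i = j ∧ k = k' := by
  have h1 : (i * (S + 1) + k) / (S + 1) = i := by
    rw [add_comm, Nat.add_mul_div_right _ _ (by omega), Nat.div_eq_of_lt (by omega), zero_add]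
  have h2 : (j * (S + 1) + k') / (S + 1) = j := by
    rw [add_comm, Nat.add_mul_div_right _ _ (by omega), Nat.div_eq_of_lt (by omega), zero_add]
  have : i = j := by rw [← h1, h, h2]
  subst this
  exact ⟨rfl, by omega⟩

/-- The cost of filling the table. -/
def fillCost (l b S m : ℕ) : ℕ :=
  8 + l * (3 + 7 + (S + 1) * (9 * (2 * l + 4 * b + S) + 30 * m + 500 + 10) + 10)

theorem run_fill (h : Ctx G b s S m Q W ord A) (hs : 0 < s) (hsb : s ≤ 2 * b) {ρ : ℕ}
    (hc : A.coins = ρ * l * (S + 1) * m) :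
    Tab S (table ω s S m ord ρ) (run ω fill A).1 ∧
      (run ω fill A).1.coins = (ρ + 1) * l * (S + 1) * m ∧
      (run ω fill A).2 ≤ fillCost l b S m := by
  have key := run_for (ω := ω) (A := A) (i := 21) (e := .reg 1) (N := l) (c := 1)
    (p := .rep 22 (.add (.reg 5) (.const 1)) fillCell)
    (C := 3 + 7 + (S + 1) * (9 * (2 * l + 4 * b + S) + 30 * m + 500 + 10))
    (fun i B => (∀ j : Fin l, (j : ℕ) < i → ∀ k ≤ S,
      B.arr 3 (j * (S + 1) + k) = table ω s S m ord ρ j k) ∧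
        B.coins = (ρ * l + i) * (S + 1) * m) h.l_eq le_rfl ⟨by simp, by rw [hc]; ring⟩
    (fun k B v hB => by simpa using hB) (by
      intro i hi B hB hBi hfB
      have hcB := h.fr hfB (by decide)
      have key := run_for (ω := ω) (A := B) (i := 22) (e := .add (.reg 5) (.const 1))
        (N := S + 1) (c := 3) (p := fillCell)
        (C := 9 * (2 * l + 4 * b + S) + 30 * m + 500)
        (fun k D => (∀ j : Fin l, ∀ k' ≤ S, (j : ℕ) < i ∨ (j : ℕ) = i ∧ k' < k →
          D.arr 3 (j * (S + 1) + k') = table ω s S m ord ρ j k') ∧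
            D.coins = ((ρ * l + i) * (S + 1) + k) * m)
        (by simp [AExpr.eval, hcB.S_eq]) le_rfl
        ⟨fun j k' hk' hj => hB.1 j (by omega) k' hk', by rw [hB.2, add_zero]⟩
        (fun k B v hB => by simpa using hB) (by
          intro k hk D hD hDk hfD
          have hcD := hcB.fr hfD (by decide)
          have e21 : D.reg 21 = ((⟨i, hi⟩ : Fin l) : ℕ) := by rw [hfD.reg 21 (by decide), hBi]
          have := run_fillCell (ω := ω) hcD hs hsb e21 hDk hD.2
          refine ⟨⟨fun j k' hk' hj => ?_, this.2.1⟩, this.2.2⟩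
          rw [this.1]
          by_cases hjk : (j : ℕ) = i ∧ k' = k
          · obtain ⟨rfl, rfl⟩ := hjk
            simp [table, hk']
          · rw [Function.update_of_ne fun he => hjk (index_inj hk' (by omega) he)]
            exact hD.1 j k' hk' (by omega))
      refine ⟨⟨fun j hj k hk => key.1.1 j k hk (by omega), ?_⟩, key.2⟩
      rw [key.1.2]; ring)
  refine ⟨fun i k hk => key.1.1 i i.2 k hk, ?_, key.2⟩
  have := key.1.2
  rw [show (ρ + 1) * l = ρ * l + l by ring]
  exact this

/-! #### A round -/

/-- Start with the first column of the table. -/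
def start : AProg := .rep 13 (.reg 1) (.seq (.store 4 (.reg 13) (.const 0))
  (.store 5 (.reg 13) (.arr 3 (.mul (.reg 13) (.add (.reg 5) (.const 1))))))

theorem run_start (h : Ctx G b s S m Q W ord A) (hT : Tab S R A) :
    Shows R (fun _ => 0) (run ω start A).1 ∧
      (run ω start A).2 ≤ 8 + l * (8 * (l + S) + 200) := by
  have key := run_for (ω := ω) (A := A) (i := 13) (e := .reg 1) (N := l) (c := 1)
    (p := .seq (.store 4 (.reg 13) (.const 0))
      (.store 5 (.reg 13) (.arr 3 (.mul (.reg 13) (.add (.reg 5) (.const 1))))))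
    (C := 8 * (l + S) + 190)
    (fun k B => ∀ i : Fin l, (i : ℕ) < k → B.arr 4 i = 0 ∧ B.arr 5 i = R i 0)
    h.l_eq le_rfl (by simp) (fun k B v hB => by simpa using hB) (by
      intro i hi B hB hBi hfB
      have hcB := h.fr hfB (by decide)
      have hTi : B.arr 3 (i * (S + 1)) = R ⟨i, hi⟩ 0 := by
        rw [hfB.arr rfl 3 (by decide)]; exact hT ⟨i, hi⟩ 0 (Nat.zero_le _)
      constructor
      · intro j hj
        simp only [run, AExpr.eval, hBi, hcB.S_eq, AState.reg_setArr, AState.arr_setArr]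
        by_cases hji : (j : ℕ) = i
        · obtain rfl : j = ⟨i, hi⟩ := Fin.ext hji
          simp [hTi]
        · have := hB j (by omega)
          simp [hji, this]
      · have s1 := size_le_self i
        have s2 := size_le_self (S + 1)
        simp only [run, AExpr.eval, AExpr.cost, hBi, hcB.S_eq, AState.reg_setArr]
        omega)
  exact ⟨fun i => key.1 i i.2, key.2⟩

/-- The total weight of the current vertices. -/
def weigh : AProg := .seq (.set 18 (.const 0))
  (.rep 13 (.reg 1) (.set 18 (.add (.reg 18) (.arr 1 (.arr 5 (.reg 13))))))

theorem run_weigh (h : Ctx G b s S m Q W ord A) {cur : Fin l → Fin n}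
    (hcur : ∀ i : Fin l, A.arr 5 i = cur i) :
    (run ω weigh A).1.reg 18 = ∑ i, W (cur i) ∧ (run ω weigh A).2 ≤ 10 + l * 300 := by
  set A₁ := A.setReg 18 0
  have h₁ : Ctx G b s S m Q W ord A₁ := h.fr (fr_run ω (.set 18 (.const 0)) A) (by decide)
  have key := run_for (ω := ω) (A := A₁) (i := 13) (e := .reg 1) (N := l) (c := 1)
    (p := .set 18 (.add (.reg 18) (.arr 1 (.arr 5 (.reg 13))))) (C := 290)
    (fun k B => B.reg 18 = ∑ i ∈ univ.filter (fun i : Fin l => (i : ℕ) < k), W (cur i))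
    h₁.l_eq le_rfl (by simp [A₁]) (fun k B v hB => by simpa using hB) (by
      intro i hi B hB hBi hfB
      have hcB := h₁.fr hfB (by decide)
      have hci : B.arr 5 i = cur ⟨i, hi⟩ := by
        rw [hfB.arr rfl 5 (by decide)]; exact hcur ⟨i, hi⟩
      refine ⟨?_, by simp only [run, AExpr.cost]; omega⟩
      simp only [run, AExpr.eval, hBi, hci, hcB.W_eq, AState.reg_setReg, if_true, hB]
      have : (univ.filter fun j : Fin l => (j : ℕ) < i + 1) =
          insert ⟨i, hi⟩ (univ.filter fun j : Fin l => (j : ℕ) < i) := by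
        ext j; simp [Fin.ext_iff]; omega
      rw [this, sum_insert (by simp), add_comm])
  refine ⟨?_, ?_⟩
  · have := key.1
    simp only [Fin.is_lt, filter_true] at this
    exact this
  · have : (run ω weigh A).2 = 2 + (run ω (.rep 13 (.reg 1)
      (.set 18 (.add (.reg 18) (.arr 1 (.arr 5 (.reg 13)))))) A₁).2 := rfl
    have := key.2
    omega

/-- Register 19 and array 6 hold the best independent transversal so far. -/
def Best (G : SimpleGraph (Fin n)) (blk : Fin n → Fin l) (W : Fin n → ℕ) (A : AState) : Prop :=
  A.reg 19 = 0 ∨ ∃ cur : Fin l → Fin n, (∀ i, blk (cur i) = i) ∧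
    (∀ i j, ¬ G.Adj (cur i) (cur j)) ∧ (∀ i : Fin l, A.arr 6 i = cur i) ∧
      A.reg 19 = ∑ i, W (cur i) + 1

/-- Copy the current vertices to array 6. -/
def save : AProg := .rep 13 (.reg 1) (.store 6 (.reg 13) (.arr 5 (.reg 13)))

theorem run_save (h : A.reg 1 = l) {cur : Fin l → Fin n} (hcur : ∀ i : Fin l, A.arr 5 i = cur i) :
    (∀ i : Fin l, (run ω save A).1.arr 6 i = cur i) ∧ (run ω save A).2 ≤ 8 + l * 100 := by
  have key := run_for (ω := ω) (A := A) (i := 13) (e := .reg 1) (N := l) (c := 1)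
    (p := .store 6 (.reg 13) (.arr 5 (.reg 13))) (C := 90)
    (fun k B => ∀ i : Fin l, (i : ℕ) < k → B.arr 6 i = cur i)
    h le_rfl (by simp) (fun k B v hB => by simpa using hB) (by
      intro i hi B hB hBi hfB
      have hci : B.arr 5 i = cur ⟨i, hi⟩ := by
        rw [hfB.arr rfl 5 (by decide)]; exact hcur ⟨i, hi⟩
      refine ⟨?_, by simp only [run, AExpr.cost]; omega⟩
      intro j hj
      simp only [run, AExpr.eval, hBi, hci, AState.arr_setArr]
      by_cases hji : (j : ℕ) = i
      · obtain rfl : j = ⟨i, hi⟩ := Fin.ext hji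
        simp
      · simp [hji, hB j (by omega)])
  exact ⟨fun i => key.1 i i.2, key.2⟩

/-- Keep the current vertices, if they form the best independent transversal so far. -/
def keepBest : AProg := .seq findConf (.seq weigh (.ite (.reg 16) .skip
  (.ite (.sub (.add (.reg 18) (.const 1)) (.reg 19))
    (.seq (.set 19 (.add (.reg 18) (.const 1))) save) .skip)))

/-- Register 19 stores a weight plus one, so that even a transversal of weight zero is told apart
from having none. -/
theorem run_keepBest (h : Ctx G b s S m Q W ord A) {cur : Fin l → Fin n}
    (hcur : ∀ i : Fin l, A.arr 5 i = cur i) (hblk : ∀ i, blk (cur i) = i) (hA : Best G blk W A) :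
    Best G blk W (run ω keepBest A).1 ∧ A.reg 19 ≤ (run ω keepBest A).1.reg 19 ∧
      ((∀ i j, ¬ G.Adj (cur i) (cur j)) → ∑ i, W (cur i) + 1 ≤ (run ω keepBest A).1.reg 19) ∧
      (run ω keepBest A).2 ≤ findCost n l + (10 + l * 300) + (50 + l * 100) := by
  have k1 := run_findConf (ω := ω) h hcur
  have hf1 := fr_run ω findConf A
  set A₁ := (run ω findConf A).1
  have h1 := h.fr hf1 (by decide)
  have hcur1 : ∀ i : Fin l, A₁.arr 5 i = cur i := by rw [hf1.arr rfl 5 (by decide)]; exact hcur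
  have k2 := run_weigh (ω := ω) h1 hcur1
  have hf2 := fr_run ω weigh A₁
  set A₂ := (run ω weigh A₁).1
  have h2 := h1.fr hf2 (by decide)
  have hcur2 : ∀ i : Fin l, A₂.arr 5 i = cur i := by rw [hf2.arr rfl 5 (by decide)]; exact hcur1
  have e19 : A₂.reg 19 = A.reg 19 := by rw [hf2.reg 19 (by decide), hf1.reg 19 (by decide)]
  have e16 : A₂.reg 16 = A₁.reg 16 := hf2.reg 16 (by decide)
  have e6 : A₂.arr 6 = A.arr 6 := by rw [hf2.arr rfl 6 (by decide), hf1.arr rfl 6 (by decide)]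
  have hbest : Best G blk W A₂ := by unfold Best; rw [e19, e6]; exact hA
  have hrun : run ω keepBest A = ((run ω (.ite (.reg 16) .skip
      (.ite (.sub (.add (.reg 18) (.const 1)) (.reg 19))
        (.seq (.set 19 (.add (.reg 18) (.const 1))) save) .skip)) A₂).1,
      (run ω findConf A).2 + ((run ω weigh A₁).2 + (run ω (.ite (.reg 16) .skip
      (.ite (.sub (.add (.reg 18) (.const 1)) (.reg 19))
        (.seq (.set 19 (.add (.reg 18) (.const 1))) save) .skip)) A₂).2)) := rfl
  obtain ⟨k1, c1⟩ := k1
  obtain ⟨k2, c2⟩ := k2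
  change _ ≤ findCost n l at c1
  rw [hrun]
  simp only [run, AExpr.eval, AExpr.cost, e16, k2, e19]
  rcases k1 with ⟨h0, hno⟩ | ⟨i, j, hij, h16, -⟩
  · rw [if_pos h0]
    split_ifs with hz
    · exact ⟨hbest, e19.ge, fun _ => by rw [e19]; omega, by simp only; omega⟩
    · set A₃ := A₂.setReg 19 (∑ i, W (cur i) + 1)
      have k3 := run_save (ω := ω) (A := A₃) h2.l_eq hcur2
      have hf3 := fr_run ω save A₃
      have e19' : (run ω save A₃).1.reg 19 = ∑ i, W (cur i) + 1 := by
        rw [hf3.reg 19 (by decide)]; simp [A₃]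
      refine ⟨Or.inr ⟨cur, hblk, fun i j => hno i j trivial, k3.1, e19'⟩, ?_, fun _ => e19'.ge, ?_⟩
      · simp only [e19']; omega
      · have := k3.2
        simp only; omega
  · rw [if_neg (by omega)]
    exact ⟨hbest, e19.ge, fun hn => absurd hij (hn i j), by simp only; omega⟩

/-- The process is sure to end early with an independent transversal of weight at least `β`. -/
def Good (G : SimpleGraph (Fin n)) (blk : Fin n → Fin l) (S : ℕ) (W : Fin n → ℕ) (β : ℝ)
    (R : Fin l → ℕ → Fin n) : Prop :=
  ∀ log, Valid G blk R (fun _ => 0) log → log.length ≤ S →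
    (log.length = S ∨ ∀ d, ¬ Conflict G blk R (cnt blk log) d) →
    log.length ≠ S ∧ β ≤ ∑ i, (W (R i (cnt blk log i)) : ℝ)

def round : AProg := .seq fill (.seq start (.seq (.rep 15 (.reg 5) mtStep) keepBest))

/-- The cost of a round. -/
def roundCost (n l b S m : ℕ) : ℕ := fillCost l b S m + (8 + l * (8 * (l + S) + 200) +
  (8 + S * (findCost n l + (2 * (8 * (S + l) + 900) + 10) + 10) +
    (findCost n l + (10 + l * 300) + (50 + l * 100))))

theorem run_round (h : Ctx G b s S m Q W ord A) (hs : 0 < s) (hsb : s ≤ 2 * b) {ρ : ℕ}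
    (hord : ∀ i, ∀ k < b, blk (ord i k) = i)
    (hc : A.coins = ρ * l * (S + 1) * m) (hA : Best G blk W A) :
    Best G blk W (run ω round A).1 ∧ A.reg 19 ≤ (run ω round A).1.reg 19 ∧
      (run ω round A).1.coins = (ρ + 1) * l * (S + 1) * m ∧
      (∀ β : ℝ, Good G blk S W β (table ω s S m ord ρ) →
        β + 1 ≤ (run ω round A).1.reg 19 ∧ (run ω round A).1.reg 19 ≠ 0) ∧
      (run ω round A).2 ≤ roundCost n l b S m := by
  set R : Fin l → ℕ → Fin n := table ω s S m ord ρ with hRdef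
  have hR : ∀ i k, blk (R i k) = i := fun i k => hord _ _ (by
    have := Nat.mod_lt (if k ≤ S then bits ω (((ρ * l + i) * (S + 1) + k) * m) m else 0) hs
    omega)
  obtain ⟨hT1, hc1, t1⟩ := run_fill (ω := ω) h hs hsb hc
  rw [← hRdef] at hT1
  have hf1 := fr_run ω fill A
  set A₁ := (run ω fill A).1
  have h1 := h.fr hf1 (by decide)
  obtain ⟨hS2, t2⟩ := run_start (ω := ω) h1 hT1
  have hf2 := fr_run ω start A₁
  set A₂ := (run ω start A₁).1
  have h2 := h1.fr hf2 (by decide)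
  have hT2 : Tab S R A₂ := by unfold Tab; rw [hf2.arr rfl 3 (by decide)]; exact hT1
  obtain ⟨hS3, t3⟩ := run_for (ω := ω) (A := A₂) (i := 15) (e := .reg 5) (N := S) (c := 1)
    (p := mtStep) (C := findCost n l + (2 * (8 * (S + l) + 900) + 10)) (Resampled G blk R)
    h2.S_eq le_rfl ⟨[], trivial, hS2, Or.inl rfl⟩ (fun k B v hB => by
      obtain ⟨log, h1, h2, h3⟩ := hB
      exact ⟨log, h1, h2, h3⟩) (by
      intro t ht B hB _ hfB
      exact run_mtStep (h2.fr hfB (by decide)) hR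
        (by unfold Tab; rw [hfB.arr rfl 3 (by decide)]; exact hT2) ht hB)
  have hf3 := fr_run ω (.rep 15 (.reg 5) mtStep) A₂
  set A₃ := (run ω (.rep 15 (.reg 5) mtStep) A₂).1
  have h3 := h2.fr hf3 (by decide)
  obtain ⟨log, hlog, hSh, hl⟩ := hS3
  have e19 : A₃.reg 19 = A.reg 19 := by
    rw [hf3.reg 19 (by decide), hf2.reg 19 (by decide), hf1.reg 19 (by decide)]
  have e6 : A₃.arr 6 = A.arr 6 := by
    rw [hf3.arr rfl 6 (by decide), hf2.arr rfl 6 (by decide), hf1.arr rfl 6 (by decide)]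
  obtain ⟨r1, r2, r3, t4⟩ := run_keepBest (ω := ω) (blk := blk) h3 (fun i => (hSh i).2)
    (fun i => hR i _) (by unfold Best; rw [e19, e6]; exact hA)
  have hf4 := fr_run ω keepBest A₃
  have hrun : run ω round A = ((run ω keepBest A₃).1, (run ω fill A).2 + ((run ω start A₁).2 +
      ((run ω (.rep 15 (.reg 5) mtStep) A₂).2 + (run ω keepBest A₃).2))) := rfl
  rw [hrun]
  refine ⟨r1, e19 ▸ r2, ?_, fun β hβ => ?_, by simp only [roundCost]; omega⟩
  · simp only
    rw [hf4.coins rfl, hf3.coins rfl, hf2.coins rfl, hc1]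
  · have hno : log.length ≠ S → ∀ i j, ¬ G.Adj (R i (cnt blk log i)) (R j (cnt blk log j)) :=
      fun hne => (hl.resolve_left hne).2
    -- The log of the machine is one of those over which `Good` quantifies, so its way of choosing
    -- conflicts does not matter.
    have hmax : log.length = S ∨ ∀ d, ¬ Conflict G blk R (cnt blk log) d := by
      rcases hl with hl | ⟨-, hl⟩
      · exact Or.inl hl
      · refine Or.inr fun d ⟨ha, _, h1, h2⟩ => hl (blk d.1) (blk d.2) ?_
        rw [h1, h2]; exact ha
    obtain ⟨hne, hge⟩ := hβ log hlog (by omega) hmax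
    have := r3 (hno hne)
    refine ⟨?_, by simp only; omega⟩
    have h' : ((∑ i, W (R i (cnt blk log i)) + 1 : ℕ) : ℝ) ≤
      ((run ω keepBest A₃).1.reg 19 : ℕ) := by exact_mod_cast this
    push_cast at h'
    simp only
    linarith

/-- All rounds. -/
def rounds : AProg := .seq (.set 19 (.const 0)) (.rep 20 (.reg 7) round)

/-- The best weight never decreases, so one good round suffices. -/
theorem run_rounds (h : Ctx G b s S m Q W ord A) (hs : 0 < s) (hsb : s ≤ 2 * b)
    (hord : ∀ i, ∀ k < b, blk (ord i k) = i) (hc : A.coins = 0) :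
    (∀ β : ℝ, (∃ ρ < Q, Good G blk S W β (table ω s S m ord ρ)) →
      ∃ cur : Fin l → Fin n, (∀ i, blk (cur i) = i) ∧ (∀ i j, ¬ G.Adj (cur i) (cur j)) ∧
        (∀ i : Fin l, (run ω rounds A).1.arr 6 i = cur i) ∧ β ≤ ∑ i, (W (cur i) : ℝ)) ∧
      (run ω rounds A).2 ≤ 10 + Q * (roundCost n l b S m + 10) := by
  set A₁ := A.setReg 19 0
  have h₁ : Ctx G b s S m Q W ord A₁ := h.fr (fr_run ω (.set 19 (.const 0)) A) (by decide)
  have key := run_for (ω := ω) (A := A₁) (i := 20) (e := .reg 7) (N := Q) (c := 1)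
    (p := round) (C := roundCost n l b S m)
    (fun k B => Best G blk W B ∧ B.coins = k * l * (S + 1) * m ∧
      ∀ β : ℝ, (∃ ρ < k, Good G blk S W β (table ω s S m ord ρ)) →
        β + 1 ≤ B.reg 19 ∧ B.reg 19 ≠ 0)
    h₁.Q_eq le_rfl ⟨Or.inl (by simp [A₁]), by simpa [A₁] using hc, by simp⟩
    (fun k B v hB => by simpa [Best] using hB) (by
      intro k hk B hB _ hfB
      obtain ⟨hB1, hB2, hB3⟩ := hB
      obtain ⟨r1, r2, r3, r4, t⟩ := run_round (ω := ω) (h₁.fr hfB (by decide)) hs hsb hord hB2 hB1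
      refine ⟨⟨r1, r3, ?_⟩, t⟩
      rintro β ⟨ρ, hρ, hgood⟩
      rcases Nat.lt_succ_iff_lt_or_eq.1 hρ with hlt | rfl
      · obtain ⟨g1, g2⟩ := hB3 β ⟨ρ, hlt, hgood⟩
        have : (B.reg 19 : ℝ) ≤ ((run ω round B).1.reg 19 : ℕ) := by exact_mod_cast r2
        exact ⟨by linarith, by omega⟩
      · exact r4 β hgood)
  have hrun : run ω rounds A = ((run ω (.rep 20 (.reg 7) round) A₁).1,
    2 + (run ω (.rep 20 (.reg 7) round) A₁).2) := rfl
  rw [hrun]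
  obtain ⟨⟨k1, -, k2⟩, t⟩ := key
  refine ⟨fun β hβ => ?_, by simp only; omega⟩
  obtain ⟨g1, g2⟩ := k2 β hβ
  rcases k1 with k1 | ⟨cur, c1, c2, c3, c4⟩
  · exact absurd k1 g2
  · refine ⟨cur, c1, c2, c3, ?_⟩
    rw [c4] at g1
    push_cast at g1
    linarith

end
end ArrProg

/-! ### Reading the instance: sizes, degrees, integer weights, sorting -/

namespace ArrProg
open RandRAM Resampling

section
variable {n l b : ℕ} {G : SimpleGraph (Fin n)} {blk : Fin n → Fin l} {num den : Fin n → ℕ}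
  {A B : AState} {ω : ℕ → Bool}

/-- The input cells describe the instance. -/
structure Enc (G : SimpleGraph (Fin n)) (blk : Fin n → Fin l) (num den : Fin n → ℕ)
    (A : AState) : Prop where
  base : A.base = 2 + n + n * n + n + n
  n_eq : A.mem 0 = n
  l_eq : A.mem 1 = l
  blk_eq : ∀ v : Fin n, A.mem (2 + v) = blk v
  adj : ∀ u v : Fin n, (G.Adj u v → A.mem (2 + n + u * n + v) = 1) ∧
    (¬ G.Adj u v → A.mem (2 + n + u * n + v) = 0)
  num_eq : ∀ v : Fin n, A.mem (2 + n + n * n + v) = num v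
  den_eq : ∀ v : Fin n, A.mem (2 + n + n * n + n + v) = den v

theorem Enc.fr (h : Enc G blk num den A) {p : AProg} (hf : Fr p A B) (hp : p.pokes = false) :
    Enc G blk num den B := by
  have hm := hf.mem hp
  rw [h.base] at hm
  refine ⟨hf.base.trans h.base, ?_, ?_, ?_, ?_, ?_, ?_⟩
  · rw [hm _ (by omega), h.n_eq]
  · rw [hm _ (by omega), h.l_eq]
  · intro v; rw [hm _ (by have := v.2; omega), h.blk_eq]
  · intro u v; rw [hm _ (adj_lt u v)]; exact h.adj u v
  · intro v; rw [hm _ (by have := v.2; omega), h.num_eq]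
  · intro v; rw [hm _ (by have := v.2; omega), h.den_eq]

/-- Read the sizes of the graph. -/
def readSizes : AProg := .seq (.set 0 (.inp (.const 0))) (.seq (.set 1 (.inp (.const 1)))
  (.seq (.set 2 (.add (.div (.reg 0) (.reg 1)) (.sub (.const 1) (.reg 1))))
  (.seq (.set 9 (.add (.add (.const 2) (.reg 0)) (.mul (.reg 0) (.reg 0))))
    (.set 10 (.add (.reg 9) (.reg 0))))))

/-- The block size is `n / l`; the term `1 - l` makes it 1 when there are no blocks and the quotient
is zero. -/
theorem run_readSizes (h : Enc G blk num den A) : (run ω readSizes A).1.reg 0 = n ∧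
    (run ω readSizes A).1.reg 1 = l ∧ (run ω readSizes A).1.reg 2 = n / l + (1 - l) ∧
    (run ω readSizes A).1.reg 9 = 2 + n + n * n ∧
    (run ω readSizes A).1.reg 10 = 2 + n + n * n + n ∧
    (run ω readSizes A).2 ≤ 3 * n + l + 50 := by
  have h0 := h.n_eq
  have h1 := h.l_eq
  have s1 := size_le_self n
  have s2 := size_le_self l
  simp [readSizes, run, AExpr.eval, AExpr.cost, h0, h1]
  omega

theorem filter_lt_succ {k : ℕ} (hk : k < n) : (univ.filter fun j : Fin n => (j : ℕ) < k + 1) =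
    insert ⟨k, hk⟩ (univ.filter fun j : Fin n => (j : ℕ) < k) := by
  ext j; simp [Fin.ext_iff]; omega

/-- Compute the degree of the vertex in register 13. -/
def degreeOf : AProg := .seq (.set 12 (.const 0)) (.rep 14 (.reg 0) (.set 12 (.add (.reg 12)
  (.inp (.add (.add (.add (.const 2) (.reg 0)) (.mul (.reg 13) (.reg 0))) (.reg 14))))))

theorem run_degreeOf [DecidableRel G.Adj] (h : Enc G blk num den A) (h0 : A.reg 0 = n) {u : Fin n}
    (hu : A.reg 13 = u) :
    (run ω degreeOf A).1.reg 12 = G.degree u ∧ (run ω degreeOf A).2 ≤ 10 + n * (2 * n + 50 + 10) := by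
  set A₁ := A.setReg 12 0
  have key := run_for (ω := ω) (A := A₁) (i := 14) (e := .reg 0) (N := n) (c := 1)
    (p := .set 12 (.add (.reg 12)
      (.inp (.add (.add (.add (.const 2) (.reg 0)) (.mul (.reg 13) (.reg 0))) (.reg 14)))))
    (C := 2 * n + 50)
    (fun k B => B.reg 12 = ∑ v ∈ univ.filter (fun v : Fin n => (v : ℕ) < k),
      if G.Adj u v then 1 else 0)
    h0 le_rfl (by simp [A₁]) (fun k B v hB => by simpa using hB) (by
      intro v hv B hB hBv hfB
      have hE := h.fr ((fr_run ω (.set 12 (.const 0)) A).mono (r := .seq (.set 12 (.const 0))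
        (.rep 14 (.reg 0) .skip)) (by decide) (by decide) (by decide) (by decide)) rfl
      have hE := (show Enc G blk num den A₁ from hE).fr hfB rfl
      have e0 : B.reg 0 = n := by rw [hfB.reg 0 (by decide)]; exact h0
      have e13 : B.reg 13 = u := by rw [hfB.reg 13 (by decide)]; exact hu
      have hadj := hE.adj u ⟨v, hv⟩
      have s1 := size_le_self n
      have s2 := size_le_self u
      have := u.2
      simp only [run, AExpr.eval, AExpr.cost, e0, e13, hBv]
      refine ⟨?_, by omega⟩
      rw [filter_lt_succ hv, sum_insert (by simp), ← hB]
      simp only [AState.reg_setReg, if_true]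
      split_ifs with ha
      · rw [hadj.1 ha]; omega
      · rw [hadj.2 ha]; omega)
  have hrun : run ω degreeOf A = ((run ω (.rep 14 (.reg 0) (.set 12 (.add (.reg 12)
    (.inp (.add (.add (.add (.const 2) (.reg 0)) (.mul (.reg 13) (.reg 0))) (.reg 14)))))) A₁).1,
    2 + (run ω (.rep 14 (.reg 0) (.set 12 (.add (.reg 12)
    (.inp (.add (.add (.add (.const 2) (.reg 0)) (.mul (.reg 13) (.reg 0))) (.reg 14)))))) A₁).2) :=
    rfl
  rw [hrun]
  refine ⟨?_, ?_⟩
  · have := key.1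
    simp only [Fin.is_lt, filter_true] at this
    rw [this, ← G.card_neighborFinset_eq_degree, G.neighborFinset_eq_filter, card_filter]
  · have := key.2
    simp only at this ⊢
    omega

/-- Compute the maximum degree. -/
def maxDeg : AProg := .seq (.set 3 (.const 0)) (.rep 13 (.reg 0) (.seq degreeOf
  (.ite (.sub (.reg 12) (.reg 3)) (.set 3 (.reg 12)) .skip)))

theorem run_maxDeg [DecidableRel G.Adj] (h : Enc G blk num den A) (h0 : A.reg 0 = n) :
    (run ω maxDeg A).1.reg 3 = G.maxDegree ∧
      (run ω maxDeg A).2 ≤ 10 + n * (10 + n * (2 * n + 50 + 10) + 20) := by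
  set A₁ := A.setReg 3 0
  have hE₁ : Enc G blk num den A₁ := h.fr (fr_run ω (.set 3 (.const 0)) A) rfl
  have key := run_for (ω := ω) (A := A₁) (i := 13) (e := .reg 0) (N := n) (c := 1)
    (p := .seq degreeOf (.ite (.sub (.reg 12) (.reg 3)) (.set 3 (.reg 12)) .skip))
    (C := 10 + n * (2 * n + 50 + 10) + 10)
    (fun k B => B.reg 3 = (univ.filter (fun v : Fin n => (v : ℕ) < k)).sup fun v => G.degree v)
    h0 le_rfl (by simp [A₁]) (fun k B v hB => by simpa using hB) (by
      intro v hv B hB hBv hfB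
      have e0 : B.reg 0 = n := by rw [hfB.reg 0 (by decide)]; exact h0
      have k1 := run_degreeOf (ω := ω) (hE₁.fr hfB rfl) e0 (u := ⟨v, hv⟩) hBv
      have e3 : (run ω degreeOf B).1.reg 3 = B.reg 3 := (fr_run ω degreeOf B).reg 3 (by decide)
      rw [filter_lt_succ hv, sup_insert, ← hB]
      simp only [run, AExpr.eval, AExpr.cost, e3, k1.1]
      have := k1.2
      split_ifs with hz
      · exact ⟨by simp only [e3]; rw [sup_eq_right.2 (by omega)], by simp only; omega⟩
      · refine ⟨?_, by simp only; omega⟩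
        simp only [AState.reg_setReg, if_true]
        rw [sup_eq_left.2 (by omega)])
  have hrun : run ω maxDeg A = ((run ω (.rep 13 (.reg 0) (.seq degreeOf
      (.ite (.sub (.reg 12) (.reg 3)) (.set 3 (.reg 12)) .skip))) A₁).1,
    2 + (run ω (.rep 13 (.reg 0) (.seq degreeOf
      (.ite (.sub (.reg 12) (.reg 3)) (.set 3 (.reg 12)) .skip))) A₁).2) := rfl
  rw [hrun]
  refine ⟨?_, ?_⟩
  · have := key.1
    simp only [Fin.is_lt, filter_true] at this
    rw [this]
    apply le_antisymm
    · exact Finset.sup_le fun v _ => G.degree_le_maxDegree v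
    · exact G.maxDegree_le_of_forall_degree_le _ fun v => Finset.le_sup (f := fun v => G.degree v)
        (mem_univ v)
  · have := key.2
    simp only at this ⊢
    have e : n * (10 + n * (2 * n + 50 + 10) + 10 + 10) = n * (10 + n * (2 * n + 50 + 10) + 20) := by ring
    omega

/-- Compute the product of the denominators. -/
def denoms : AProg := .seq (.set 8 (.const 1)) (.rep 13 (.reg 0)
  (.set 8 (.mul (.reg 8) (.inp (.add (.reg 10) (.reg 13))))))

theorem size_mul_le (a b : ℕ) : (a * b).size ≤ a.size + b.size := by
  rw [Nat.size_le, pow_add]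
  exact Nat.mul_lt_mul'' (Nat.lt_size_self a) (Nat.lt_size_self b)

/-- The common denominator may be exponentially large, but its bit length is at most linear in that
of the input. -/
theorem size_prod_le {α : Type*} (s : Finset α) (f : α → ℕ) :
    (∏ x ∈ s, f x).size ≤ 1 + ∑ x ∈ s, (f x).size := by
  classical
  induction s using Finset.induction_on with
  | empty => simp
  | insert a s ha ih =>
    rw [prod_insert ha, sum_insert ha]
    have := size_mul_le (f a) (∏ x ∈ s, f x)
    omega

theorem run_denoms (h : Enc G blk num den A) (h0 : A.reg 0 = n)
    (h10 : A.reg 10 = 2 + n + n * n + n) {Z : ℕ} (hZ : ∑ v, (den v).size ≤ Z) :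
    (run ω denoms A).1.reg 8 = ∏ v, den v ∧ (run ω denoms A).2 ≤ 10 + n * (2 * Z + 40 + 10) := by
  set A₁ := A.setReg 8 1
  have hE₁ : Enc G blk num den A₁ := h.fr (fr_run ω (.set 8 (.const 1)) A) rfl
  have key := run_for (ω := ω) (A := A₁) (i := 13) (e := .reg 0) (N := n) (c := 1)
    (p := .set 8 (.mul (.reg 8) (.inp (.add (.reg 10) (.reg 13))))) (C := 2 * Z + 40)
    (fun k B => B.reg 8 = ∏ v ∈ univ.filter (fun v : Fin n => (v : ℕ) < k), den v)
    h0 le_rfl (by simp [A₁]) (fun k B v hB => by simpa using hB) (by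
      intro v hv B hB hBv hfB
      have e10 : B.reg 10 = 2 + n + n * n + n := by rw [hfB.reg 10 (by decide)]; exact h10
      have ed := (hE₁.fr hfB rfl).den_eq ⟨v, hv⟩
      simp only at ed
      simp only [run, AExpr.eval, AExpr.cost, e10, hBv, ed, hB]
      refine ⟨?_, ?_⟩
      · rw [filter_lt_succ hv, prod_insert (by simp), mul_comm]
        simp
      · have h1 := size_prod_le (univ.filter (fun u : Fin n => (u : ℕ) < v)) den
        have h2 : ∑ u ∈ univ.filter (fun u : Fin n => (u : ℕ) < v), (den u).size ≤ Z :=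
          (sum_le_univ_sum_of_nonneg (by simp)).trans hZ
        have h3 : (den ⟨v, hv⟩).size ≤ Z :=
          (single_le_sum (f := fun u => (den u).size) (by simp) (mem_univ _)).trans hZ
        omega)
  have hrun : run ω denoms A = ((run ω (.rep 13 (.reg 0)
      (.set 8 (.mul (.reg 8) (.inp (.add (.reg 10) (.reg 13)))))) A₁).1,
    2 + (run ω (.rep 13 (.reg 0)
      (.set 8 (.mul (.reg 8) (.inp (.add (.reg 10) (.reg 13)))))) A₁).2) := rfl
  rw [hrun]
  refine ⟨?_, ?_⟩
  · have := key.1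
    simp only [Fin.is_lt, filter_true] at this
    exact this
  · have := key.2
    simp only at this ⊢
    omega

/-- The weights, scaled to natural numbers. -/
def scaled (num den : Fin n → ℕ) (v : Fin n) : ℕ := num v * ((∏ u, den u) / den v)

/-- Compute the scaled weights. -/
def scale : AProg := .rep 13 (.reg 0) (.store 1 (.reg 13)
  (.mul (.inp (.add (.reg 9) (.reg 13))) (.div (.reg 8) (.inp (.add (.reg 10) (.reg 13))))))

theorem run_scale (h : Enc G blk num den A) (h0 : A.reg 0 = n) (h8 : A.reg 8 = ∏ v, den v)
    (h9 : A.reg 9 = 2 + n + n * n) (h10 : A.reg 10 = 2 + n + n * n + n) {Z : ℕ}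
    (hZ : ∑ v, (den v).size ≤ Z) (hZ' : ∀ v, (num v).size ≤ Z) :
    (∀ v : Fin n, (run ω scale A).1.arr 1 v = scaled num den v) ∧
      (run ω scale A).2 ≤ 10 + n * (4 * Z + 70 + 10) := by
  have key := run_for (ω := ω) (A := A) (i := 13) (e := .reg 0) (N := n) (c := 1)
    (p := .store 1 (.reg 13) (.mul (.inp (.add (.reg 9) (.reg 13)))
      (.div (.reg 8) (.inp (.add (.reg 10) (.reg 13)))))) (C := 4 * Z + 70)
    (fun k B => ∀ v : Fin n, (v : ℕ) < k → B.arr 1 v = scaled num den v)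
    h0 le_rfl (by simp) (fun k B v hB => by simpa using hB) (by
      intro v hv B hB hBv hfB
      have e8 : B.reg 8 = ∏ v, den v := by rw [hfB.reg 8 (by decide)]; exact h8
      have e9 : B.reg 9 = 2 + n + n * n := by rw [hfB.reg 9 (by decide)]; exact h9
      have e10 : B.reg 10 = 2 + n + n * n + n := by rw [hfB.reg 10 (by decide)]; exact h10
      have ed := (h.fr hfB rfl).den_eq ⟨v, hv⟩
      have en := (h.fr hfB rfl).num_eq ⟨v, hv⟩
      simp only at ed en
      simp only [run, AExpr.eval, AExpr.cost, e8, e9, e10, hBv, ed, en]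
      refine ⟨fun u hu => ?_, ?_⟩
      · by_cases huv : (u : ℕ) = v
        · obtain rfl : u = ⟨v, hv⟩ := Fin.ext huv
          simp [scaled]
        · simp [huv, hB u (by omega)]
      · have h1 := (size_prod_le univ den).trans (Nat.add_le_add_left hZ 1)
        have h2 : ((∏ u, den u) / den ⟨v, hv⟩).size ≤ 1 + Z :=
          (Nat.size_le_size (Nat.div_le_self _ _)).trans h1
        have h3 : (den ⟨v, hv⟩).size ≤ Z :=
          (single_le_sum (f := fun u => (den u).size) (by simp) (mem_univ _)).trans hZ
        have h4 := hZ' ⟨v, hv⟩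
        omega)
  exact ⟨fun v => key.1 v v.2, key.2.trans (by omega)⟩

/-- Count the vertices of the same block that come before the vertex in register 13. -/
def rankOf : AProg := .seq (.set 12 (.const 0)) (.rep 14 (.reg 0)
  (.ite (.add (.sub (.inp (.add (.const 2) (.reg 13))) (.inp (.add (.const 2) (.reg 14))))
    (.sub (.inp (.add (.const 2) (.reg 14))) (.inp (.add (.const 2) (.reg 13))))) .skip
    (.ite (.add (.sub (.arr 1 (.reg 14)) (.arr 1 (.reg 13))) (.mul (.sub (.const 1)
        (.sub (.arr 1 (.reg 13)) (.arr 1 (.reg 14)))) (.sub (.reg 13) (.reg 14))))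
      (.set 12 (.add (.reg 12) (.const 1))) .skip)))

theorem run_rankOf (h : Enc G blk num den A) (h0 : A.reg 0 = n) {W : Fin n → ℕ}
    (hW : ∀ v : Fin n, A.arr 1 v = W v) {v : Fin n} (hv : A.reg 13 = v) :
    (run ω rankOf A).1.reg 12 = rank blk (fun u => (W u : ℝ)) (fun u => (u : ℕ)) v ∧
      (run ω rankOf A).2 ≤ 10 + n * (n + 190 + 10) := by
  classical
  set A₁ := A.setReg 12 0
  have hE₁ : Enc G blk num den A₁ := h.fr (fr_run ω (.set 12 (.const 0)) A) rfl
  set p : AProg := (.ite (.add (.sub (.inp (.add (.const 2) (.reg 13)))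
    (.inp (.add (.const 2) (.reg 14)))) (.sub (.inp (.add (.const 2) (.reg 14)))
      (.inp (.add (.const 2) (.reg 13))))) .skip
    (.ite (.add (.sub (.arr 1 (.reg 14)) (.arr 1 (.reg 13))) (.mul (.sub (.const 1)
        (.sub (.arr 1 (.reg 13)) (.arr 1 (.reg 14)))) (.sub (.reg 13) (.reg 14))))
      (.set 12 (.add (.reg 12) (.const 1))) .skip)) with hp
  have key := run_for (ω := ω) (A := A₁) (i := 14) (e := .reg 0) (N := n) (c := 1)
    (p := p) (C := n + 190)
    (fun k B => B.reg 12 = ∑ u ∈ univ.filter (fun u : Fin n => (u : ℕ) < k),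
      if blk u = blk v ∧ (W v < W u ∨ W u = W v ∧ (u : ℕ) < v) then 1 else 0)
    h0 le_rfl (by simp [A₁]) (fun k B v hB => by simpa using hB) (by
      intro u hu B hB hBu hfB
      have hE := hE₁.fr hfB rfl
      have e13 : B.reg 13 = v := by rw [hfB.reg 13 (by decide)]; exact hv
      have hWB : ∀ v : Fin n, B.arr 1 v = W v := by
        rw [hfB.arr rfl 1 (by decide)]; exact hW
      have w1 := hWB v
      have w2 := hWB ⟨u, hu⟩
      have b1 := hE.blk_eq v
      have b2 := hE.blk_eq ⟨u, hu⟩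
      simp only at w2 b2
      have s1 : (1 - (W v - W ⟨u, hu⟩)).size ≤ 1 := (size_le_self _).trans (by omega)
      have s2 : ((v : ℕ) - u).size ≤ n := (size_le_self _).trans (by have := v.2; omega)
      -- Truncated subtraction in both directions tests equality.
      have hbe : blk ⟨u, hu⟩ = blk v ↔
          (blk v : ℕ) - blk ⟨u, hu⟩ + ((blk ⟨u, hu⟩ : ℕ) - blk v) = 0 := by
        rw [Fin.ext_iff]; omega
      -- The factor `1 - (W v - W u)` vanishes unless `W v ≤ W u`; in case of equality the product
      -- is nonzero exactly if `u < v`.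
      have hwe : (W v < W ⟨u, hu⟩ ∨ W ⟨u, hu⟩ = W v ∧ u < v) ↔
          W ⟨u, hu⟩ - W v + (1 - (W v - W ⟨u, hu⟩)) * (v - u) ≠ 0 := by
        rcases lt_trichotomy (W v) (W ⟨u, hu⟩) with h | h | h
        · exact ⟨fun _ => by omega, fun _ => Or.inl h⟩
        · rw [h]; simp; omega
        · rw [show 1 - (W v - W ⟨u, hu⟩) = 0 by omega]
          simp; omega
      simp only [hp, run, AExpr.eval, AExpr.cost, e13, hBu, w1, w2, b1, b2]
      rw [filter_lt_succ hu, sum_insert (by simp), ← hB]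
      simp only [hbe, hwe]
      by_cases hz : (blk v : ℕ) - blk ⟨u, hu⟩ + ((blk ⟨u, hu⟩ : ℕ) - blk v) = 0
      · by_cases hz' : W ⟨u, hu⟩ - W v + (1 - (W v - W ⟨u, hu⟩)) * (v - u) = 0
        · simp only [hz, hz', if_true, ne_eq, not_true_eq_false, and_false, if_false, zero_add]
          exact ⟨trivial, by omega⟩
        · simp only [hz, hz', if_true, ne_eq, not_false_eq_true, and_true, if_false,
            AState.reg_setReg]
          exact ⟨by omega, by omega⟩
      · simp only [hz, if_false, false_and, zero_add]
        exact ⟨trivial, by omega⟩)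
  have hrun : run ω rankOf A = ((run ω (.rep 14 (.reg 0) p) A₁).1,
    2 + (run ω (.rep 14 (.reg 0) p) A₁).2) := rfl
  rw [hrun]
  refine ⟨?_, ?_⟩
  · have := key.1
    simp only [Fin.is_lt, filter_true] at this
    rw [this, ← card_filter, rank]
    congr 1
    ext u
    simp [Above]
  · have := key.2
    simp only at this ⊢
    omega

/-- Sort the vertices of each block by weight. -/
def sortBlocks : AProg := .rep 13 (.reg 0) (.seq rankOf
  (.store 2 (.add (.mul (.inp (.add (.const 2) (.reg 13))) (.reg 2)) (.reg 12)) (.reg 13)))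

theorem run_sortBlocks (h : Enc G blk num den A) (h0 : A.reg 0 = n) (h2 : A.reg 2 = b)
    {W : Fin n → ℕ} (hW : ∀ v : Fin n, A.arr 1 v = W v) {ord : Fin l → ℕ → Fin n}
    (hrk : IsRanking blk b (fun v => (W v : ℝ)) (rank blk (fun u => (W u : ℝ)) fun u => (u : ℕ))
      ord) :
    (∀ (i : Fin l), ∀ k < b, (run ω sortBlocks A).1.arr 2 (i * b + k) = ord i k) ∧
      (run ω sortBlocks A).2 ≤ 10 + n * (10 + n * (n + 190 + 10) + 9 * (l + b) + 190 + 10) := by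
  set rk : Fin n → ℕ := rank blk (fun u => (W u : ℝ)) fun u => (u : ℕ) with hrkdef
  have key := run_for (ω := ω) (A := A) (i := 13) (e := .reg 0) (N := n) (c := 1)
    (p := .seq rankOf (.store 2 (.add (.mul (.inp (.add (.const 2) (.reg 13))) (.reg 2))
      (.reg 12)) (.reg 13))) (C := 10 + n * (n + 190 + 10) + 9 * (l + b) + 190)
    (fun k B => ∀ v : Fin n, (v : ℕ) < k → B.arr 2 (blk v * b + rk v) = v)
    h0 le_rfl (by simp) (fun k B v hB => by simpa using hB) (by
      intro v hv B hB hBv hfB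
      have hE := h.fr hfB rfl
      have e0 : B.reg 0 = n := by rw [hfB.reg 0 (by decide)]; exact h0
      have hWB : ∀ v : Fin n, B.arr 1 v = W v := by
        rw [hfB.arr rfl 1 (by decide)]; exact hW
      obtain ⟨k1, k2⟩ := run_rankOf (ω := ω) hE e0 hWB (v := ⟨v, hv⟩) hBv
      have hf := fr_run ω rankOf B
      rw [← hrkdef] at k1
      simp only [run]
      set D := (run ω rankOf B).1
      have e13 : D.reg 13 = v := by rw [hf.reg 13 (by decide), hBv]
      have e2 : D.reg 2 = b := by rw [hf.reg 2 (by decide), hfB.reg 2 (by decide), h2]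
      have ea : D.arr 2 = B.arr 2 := hf.arr rfl 2 (by decide)
      have eb := (hE.fr hf rfl).blk_eq ⟨v, hv⟩
      simp only at eb
      have s1 := size_le_self (blk ⟨v, hv⟩)
      have s2 := size_le_self b
      have := (blk ⟨v, hv⟩).2
      simp only [AExpr.eval, AExpr.cost, e13, e2, eb, k1]
      refine ⟨fun u hu => ?_, by omega⟩
      simp only [AState.arr_setArr, if_true, ea]
      by_cases huv : (u : ℕ) = v
      · obtain rfl : u = ⟨v, hv⟩ := Fin.ext huv
        simp
      · rw [Function.update_of_ne, hB u (by omega)]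
        intro he
        -- Ranks are at most `b - 1`, so the address determines block and rank, and with them the
        -- vertex.
        have hb : b - 1 + 1 = b := by have := hrk.rk_lt u; omega
        rw [← hb] at he
        have := index_inj (by have := hrk.rk_lt u; omega)
          (by have := hrk.rk_lt ⟨v, hv⟩; omega) he
        apply huv
        have h1 := hrk.ord_rk u
        rw [Fin.ext this.1, this.2, hrk.ord_rk] at h1
        rw [← h1])
  refine ⟨fun i k hk => ?_, ?_⟩
  · have := key.1 (ord i k) (ord i k).2
    rwa [hrk.blk_ord i k hk, hrk.rk_ord i k hk] at this
  · exact key.2.trans (by omega)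

end
end ArrProg

/-! ### Parameters, output and the whole program -/

namespace ArrProg
open RandRAM Resampling

section
variable {n l b : ℕ} {G : SimpleGraph (Fin n)} {blk : Fin n → Fin l} {num den : Fin n → ℕ}
  {A B : AState} {ω : ℕ → Bool}

/-- A power of the number of vertices. -/
def powN : ℕ → AExpr
  | 0 => .const 1
  | k + 1 => .mul (powN k) (.reg 0)

/-- The cost of computing a power of the number of vertices. -/
def powCost (n : ℕ) : ℕ → ℕ
  | 0 => 1
  | k + 1 => powCost n k + n ^ k + n + 2

theorem eval_powN (h : A.reg 0 = n) (k : ℕ) : (powN k).eval A = n ^ k := by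
  induction k with
  | zero => rfl
  | succ k ih => simp [powN, AExpr.eval, ih, h, pow_succ]

theorem cost_powN_le (h : A.reg 0 = n) (k : ℕ) : (powN k).cost A ≤ powCost n k := by
  induction k with
  | zero => exact le_rfl
  | succ k ih =>
    have s1 := size_le_self n
    have s2 := size_le_self (n ^ k)
    simp only [powN, AExpr.cost, eval_powN h, AExpr.eval, h, powCost]
    omega

/-- The number of steps of a round. -/
def numSteps (c n : ℕ) : ℕ := 8 * n ^ (c + 2)

/-- The number of coins for an entry of the table. -/
def numCoins (c n : ℕ) : ℕ := (2 * c + 4) * n + 10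

/-- The number of rounds. -/
def numRounds (c n : ℕ) : ℕ := 4 * c * n ^ (c + 2)

/-- Compute the number of slots and the parameters. -/
def params (c : ℕ) : AProg := .seq (.set 12 (.mul (.const 9) (.reg 3)))
  (.seq (.set 12 (.add (.reg 12) (.sub (.const 2) (.reg 12))))
  (.seq (.set 4 (.sub (.reg 12) (.sub (.reg 12) (.add (.reg 2) (.reg 2)))))
  (.seq (.set 5 (.mul (.const 8) (powN (c + 2))))
  (.seq (.set 6 (.add (.mul (.const (2 * c + 4)) (.reg 0)) (.const 10)))
    (.set 7 (.mul (.const (4 * c)) (powN (c + 2))))))))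

/-- Maximum and minimum are expressed by truncated subtraction: `x + (2 - x)` and `x - (x - y)`. -/
theorem run_params (c : ℕ) (h0 : A.reg 0 = n) (h2 : A.reg 2 = b) {Δ : ℕ} (h3 : A.reg 3 = Δ) :
    (run ω (params c) A).1.reg 4 = slots b Δ ∧ (run ω (params c) A).1.reg 5 = numSteps c n ∧
      (run ω (params c) A).1.reg 6 = numCoins c n ∧ (run ω (params c) A).1.reg 7 = numRounds c n ∧
      (run ω (params c) A).2 ≤ 2 * powCost n (c + 2) + 2 * n ^ (c + 2) + n + Δ + 6 * c + 100 := by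
  have hp : ∀ A : AState, A.reg 0 = n → (powN (c + 2)).eval A = n ^ (c + 2) :=
    fun A h => eval_powN h _
  have hc : ∀ A : AState, A.reg 0 = n → (powN (c + 2)).cost A ≤ powCost n (c + 2) :=
    fun A h => cost_powN_le h _
  simp only [params, run, AExpr.eval, AExpr.cost, AState.reg_setReg, h0, h2, h3]
  norm_num
  rw [hp _ (by simp [h0]), hp _ (by simp [h0])]
  refine ⟨?_, rfl, rfl, rfl, ?_⟩
  · simp only [slots]; omega
  · have s1 := size_le_self 9
    have s2 := size_le_self Δ
    have s3 := size_le_self 8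
    have s4 := size_le_self (n ^ (c + 2))
    have s5 := size_le_self n
    have s6 := size_le_self (2 * c + 4)
    have s7 := size_le_self (4 * c)
    refine le_trans (Nat.add_le_add_left (Nat.add_le_add_left (Nat.add_le_add_left (Nat.add_le_add
      (Nat.add_le_add_right (Nat.add_le_add_right (Nat.add_le_add_left (hc _ (by simp [h0])) _) _) _)
      (Nat.add_le_add_left (Nat.add_le_add_right (Nat.add_le_add_right (Nat.add_le_add_left
        (hc _ (by simp [h0])) _) _) _) _)) _) _) _) ?_
    omega

/-- Write the output. -/
def output : AProg := .seq (.rep 13 (.reg 0) (.poke (.reg 13) (.const 0)))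
  (.rep 13 (.reg 1) (.poke (.arr 6 (.reg 13)) (.const 1)))

theorem AState.arr_setMem_of_lt (A : AState) {x v : ℕ} (h : x < A.base) :
    (A.setMem x v).arr = A.arr := by
  unfold setMem; rw [if_pos h]

/-- The output overwrites the first `n` input cells, so these are cleared before the chosen vertices
are marked. All writes stay below `base` and leave the arrays intact. -/
theorem run_output (h0 : A.reg 0 = n) (h1 : A.reg 1 = l) (hb : n ≤ A.base) :
    (∀ cur : Fin l → Fin n, (∀ i : Fin l, A.arr 6 i = cur i) →
      ∀ v : Fin n, (run ω output A).1.mem v ≠ 0 ↔ ∃ i, cur i = v) ∧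
      (run ω output A).2 ≤ 16 + n * 20 + l * 40 := by
  have key := run_for (ω := ω) (A := A) (i := 13) (e := .reg 0) (N := n) (c := 1)
    (p := .poke (.reg 13) (.const 0)) (C := 10)
    (fun k B => (∀ v < k, B.mem v = 0) ∧ B.arr = A.arr)
    h0 le_rfl (by simp) (fun k B v hB => by simpa using hB) (by
      intro v hv B hB hBv hfB
      refine ⟨⟨fun u hu => ?_, ?_⟩, by simp [run, AExpr.cost]⟩
      · simp only [run, AExpr.eval, hBv, AState.mem_setMem, Function.update_apply]
        split_ifs with huv
        · rfl
        · exact hB.1 u (by omega)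
      · simp only [run, AExpr.eval, hBv]
        rw [B.arr_setMem_of_lt (by rw [hfB.base]; omega), hB.2])
  obtain ⟨⟨k1, k2⟩, k3⟩ := key
  have hf := fr_run ω (.rep 13 (.reg 0) (.poke (.reg 13) (.const 0))) A
  have hrun : run ω output A = ((run ω (.rep 13 (.reg 1) (.poke (.arr 6 (.reg 13)) (.const 1)))
      (run ω (.rep 13 (.reg 0) (.poke (.reg 13) (.const 0))) A).1).1,
    (run ω (.rep 13 (.reg 0) (.poke (.reg 13) (.const 0))) A).2 +
      (run ω (.rep 13 (.reg 1) (.poke (.arr 6 (.reg 13)) (.const 1)))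
      (run ω (.rep 13 (.reg 0) (.poke (.reg 13) (.const 0))) A).1).2) := rfl
  rw [hrun]
  set A₁ := (run ω (.rep 13 (.reg 0) (.poke (.reg 13) (.const 0))) A).1
  have e1 : A₁.reg 1 = l := by rw [hf.reg 1 (by decide), h1]
  constructor
  · intro cur hcur
    have key := run_for (ω := ω) (A := A₁) (i := 13) (e := .reg 1) (N := l) (c := 1)
      (p := .poke (.arr 6 (.reg 13)) (.const 1)) (C := 30)
      (fun k B => (∀ v : Fin n, B.mem v ≠ 0 ↔ ∃ i : Fin l, (i : ℕ) < k ∧ cur i = v) ∧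
        B.arr = A.arr)
      e1 le_rfl ⟨fun v => by simp [k1 v v.2], k2⟩ (fun k B v hB => by simpa using hB) (by
        intro i hi B hB hBi hfB
        have hci := hcur ⟨i, hi⟩
        simp only at hci
        refine ⟨⟨fun v => ?_, ?_⟩, by simp [run, AExpr.cost]⟩
        · simp only [run, AExpr.eval, hBi, AState.mem_setMem, Function.update_apply, hB.2, hci]
          split_ifs with hv
          · simp only [ne_eq, one_ne_zero, not_false_eq_true, true_iff]
            exact ⟨⟨i, hi⟩, Nat.lt_succ_self i, Fin.ext hv.symm⟩
          · rw [hB.1 v]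
            constructor
            · rintro ⟨j, hj, rfl⟩; exact ⟨j, by omega, rfl⟩
            · rintro ⟨j, hj, rfl⟩
              refine ⟨j, ?_, rfl⟩
              rcases Nat.lt_succ_iff_lt_or_eq.1 hj with h | h
              · exact h
              · exact absurd (by rw [show j = ⟨i, hi⟩ from Fin.ext h]) hv
        · simp only [run, AExpr.eval, hBi, hB.2, hci]
          rw [B.arr_setMem_of_lt
            (by rw [hfB.base, hf.base]; have := (cur ⟨i, hi⟩).2; omega), hB.2])
    intro v
    rw [key.1.1 v]
    exact ⟨fun ⟨i, _, h⟩ => ⟨i, h⟩, fun ⟨i, h⟩ => ⟨i, i.2, h⟩⟩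
  · have key := run_for (ω := ω) (A := A₁) (i := 13) (e := .reg 1) (N := l) (c := 1)
      (p := .poke (.arr 6 (.reg 13)) (.const 1)) (C := 30) (fun _ _ => True)
      e1 le_rfl trivial (fun _ _ _ _ => trivial) (fun i hi B _ _ _ =>
        ⟨trivial, by simp [run, AExpr.cost]⟩)
    have := key.2
    simp only
    omega

/-- The preparations. -/
def prep (c : ℕ) : AProg := .seq readSizes (.seq maxDeg (.seq denoms (.seq scale
  (.seq sortBlocks (params c)))))

/-- The whole program, after the computation of the address `base`. -/
def main (c : ℕ) : AProg := .seq (prep c) (.seq rounds output)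

/-- The cost of the preparations. -/
def prepCost (c n l b Z : ℕ) : ℕ := (3 * n + l + 50) +
  ((10 + n * (10 + n * (2 * n + 50 + 10) + 20)) + ((10 + n * (2 * Z + 40 + 10)) +
  ((10 + n * (4 * Z + 70 + 10)) + ((10 + n * (10 + n * (n + 190 + 10) + 9 * (l + b) + 190 + 10)) +
  (2 * powCost n (c + 2) + 2 * n ^ (c + 2) + n + n + 6 * c + 100)))))

/-- The cost of the whole program. -/
def mainCost (c n l b Z : ℕ) : ℕ := prepCost c n l b Z +
  (10 + numRounds c n * (roundCost n l b (numSteps c n) (numCoins c n) + 10)) +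
    (16 + n * 20 + l * 40)

theorem run_prep [DecidableRel G.Adj] (c : ℕ) (h : Enc G blk num den A) (hA : A.coins = 0)
    (hb : b = n / l + (1 - l)) {Z : ℕ} (hZ : ∑ v, (den v).size ≤ Z)
    (hZ' : ∀ v, (num v).size ≤ Z) {ord : Fin l → ℕ → Fin n}
    (hrk : IsRanking blk b (fun v => (scaled num den v : ℝ))
      (rank blk (fun u => (scaled num den u : ℝ)) fun u => (u : ℕ)) ord) :
    Ctx G b (slots b G.maxDegree) (numSteps c n) (numCoins c n) (numRounds c n)
      (scaled num den) ord (run ω (prep c) A).1 ∧ (run ω (prep c) A).1.coins = 0 ∧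
      (run ω (prep c) A).2 ≤ prepCost c n l b Z := by
  obtain ⟨a0, a1, a2, a9, a10, t1⟩ := run_readSizes (ω := ω) h
  rw [← hb] at a2
  have f1 := fr_run ω readSizes A
  set A₁ := (run ω readSizes A).1
  have h1 := h.fr f1 rfl
  obtain ⟨a3, t2⟩ := run_maxDeg (ω := ω) h1 a0
  have f2 := fr_run ω maxDeg A₁
  set A₂ := (run ω maxDeg A₁).1
  have h2 := h1.fr f2 rfl
  have b0 : A₂.reg 0 = n := by rw [f2.reg 0 (by decide), a0]
  have b10 : A₂.reg 10 = 2 + n + n * n + n := by rw [f2.reg 10 (by decide), a10]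
  obtain ⟨a8, t3⟩ := run_denoms (ω := ω) h2 b0 b10 hZ
  have f3 := fr_run ω denoms A₂
  set A₃ := (run ω denoms A₂).1
  have h3 := h2.fr f3 rfl
  have c0 : A₃.reg 0 = n := by rw [f3.reg 0 (by decide), b0]
  obtain ⟨aW, t4⟩ := run_scale (ω := ω) h3 c0 a8
    (by rw [f3.reg 9 (by decide), f2.reg 9 (by decide), a9]) (by rw [f3.reg 10 (by decide), b10])
    hZ hZ'
  have f4 := fr_run ω scale A₃
  set A₄ := (run ω scale A₃).1
  have h4 := h3.fr f4 rfl
  have d0 : A₄.reg 0 = n := by rw [f4.reg 0 (by decide), c0]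
  have d2 : A₄.reg 2 = b := by
    rw [f4.reg 2 (by decide), f3.reg 2 (by decide), f2.reg 2 (by decide), a2]
  obtain ⟨aO, t5⟩ := run_sortBlocks (ω := ω) h4 d0 d2 aW hrk
  have f5 := fr_run ω sortBlocks A₄
  set A₅ := (run ω sortBlocks A₄).1
  have h5 := h4.fr f5 rfl
  have e0 : A₅.reg 0 = n := by rw [f5.reg 0 (by decide), d0]
  have e2 : A₅.reg 2 = b := by rw [f5.reg 2 (by decide), d2]
  have e3 : A₅.reg 3 = G.maxDegree := by
    rw [f5.reg 3 (by decide), f4.reg 3 (by decide), f3.reg 3 (by decide), a3]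
  obtain ⟨a4, a5, a6, a7, t6⟩ := run_params (ω := ω) c e0 e2 e3
  have f6 := fr_run ω (params c) A₅
  set A₆ := (run ω (params c) A₅).1
  have h6 := h5.fr f6 rfl
  have hwr : ∀ j, j < 4 → j ∉ (params c).wr := fun j hj => by
    interval_cases j <;> simp [params, AProg.wr]
  have g0 : A₆.reg 0 = n := by rw [f6.reg 0 (hwr 0 (by omega)), e0]
  have g1 : A₆.reg 1 = l := by
    rw [f6.reg 1 (hwr 1 (by omega)), f5.reg 1 (by decide), f4.reg 1 (by decide),
      f3.reg 1 (by decide), f2.reg 1 (by decide), a1]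
  have hctx : Ctx G b (slots b G.maxDegree) (numSteps c n) (numCoins c n) (numRounds c n)
      (scaled num den) ord A₆ := by
    refine ⟨g0, g1, ?_, a4, a5, a6, a7, h6.base, fun u v => ?_, fun v => ?_, fun i k hk => ?_⟩
    · rw [f6.reg 2 (hwr 2 (by omega)), e2]
    · have := h6.adj u v
      by_cases ha : G.Adj u v
      · simp [this.1 ha, ha]
      · simp [this.2 ha, ha]
    · rw [f6.arr rfl 1 (by simp [params, AProg.wa]), f5.arr rfl 1 (by decide)]; exact aW v
    · rw [f6.arr rfl 2 (by simp [params, AProg.wa])]; exact aO i k hk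
  have hco : A₆.coins = 0 := by
    rw [f6.coins rfl, f5.coins rfl, f4.coins rfl, f3.coins rfl, f2.coins rfl, f1.coins rfl, hA]
  have hΔ : G.maxDegree ≤ n := G.maxDegree_le_of_forall_degree_le _ fun v =>
    (G.degree_lt_card_verts v).le.trans (by simp)
  exact ⟨hctx, hco, Nat.add_le_add t1 (Nat.add_le_add t2 (Nat.add_le_add t3 (Nat.add_le_add t4
    (Nat.add_le_add t5 (t6.trans (by omega))))))⟩

theorem run_main [DecidableRel G.Adj] (c : ℕ) (h : Enc G blk num den A) (hA : A.coins = 0)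
    (hb : b = n / l + (1 - l)) (hb1 : 1 ≤ b) {Z : ℕ} (hZ : ∑ v, (den v).size ≤ Z)
    (hZ' : ∀ v, (num v).size ≤ Z) {ord : Fin l → ℕ → Fin n}
    (hrk : IsRanking blk b (fun v => (scaled num den v : ℝ))
      (rank blk (fun u => (scaled num den u : ℝ)) fun u => (u : ℕ)) ord) :
    (∀ β : ℝ, (∃ ρ < numRounds c n, Good G blk (numSteps c n) (scaled num den) β
        (table ω (slots b G.maxDegree) (numSteps c n) (numCoins c n) ord ρ)) →
      ∃ cur : Fin l → Fin n, (∀ i, blk (cur i) = i) ∧ (∀ i j, ¬ G.Adj (cur i) (cur j)) ∧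
        (∀ v : Fin n, (run ω (main c) A).1.mem v ≠ 0 ↔ ∃ i, cur i = v) ∧
        β ≤ ∑ i, (scaled num den (cur i) : ℝ)) ∧
      (run ω (main c) A).2 ≤ mainCost c n l b Z := by
  obtain ⟨hctx, hco, t6⟩ := run_prep (ω := ω) c h hA hb hZ hZ' hrk
  set A₆ := (run ω (prep c) A).1
  have hs : 2 ≤ slots b G.maxDegree := two_le_slots hb1
  obtain ⟨r1, t7⟩ := run_rounds (ω := ω) (blk := blk) hctx (by omega) slots_le hrk.blk_ord hco
  have f7 := fr_run ω rounds A₆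
  set A₇ := (run ω rounds A₆).1
  obtain ⟨o1, t8⟩ := run_output (ω := ω) (A := A₇) (n := n) (l := l)
    (by rw [f7.reg 0 (by decide), hctx.n_eq]) (by rw [f7.reg 1 (by decide), hctx.l_eq])
    (by rw [f7.base, hctx.base]; omega)
  have hrun : run ω (main c) A = ((run ω output A₇).1, (run ω (prep c) A).2 +
    ((run ω rounds A₆).2 + (run ω output A₇).2)) := rfl
  rw [hrun]
  constructor
  · intro β hβ
    obtain ⟨cur, c1, c2, c3, c4⟩ := r1 β hβ
    exact ⟨cur, c1, c2, o1 cur c3, c4⟩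
  · simp only [mainCost]
    omega

end
end ArrProg

/-! ### The encoded instance and the start of the machine -/

namespace ArrProg
open RandRAM Resampling

section
variable {n l b : ℕ} {G : SimpleGraph (Fin n)} {blk : Fin n → Fin l} {w : Fin n → ℚ≥0}

theorem getD_append_ofFn {α : Type*} (a c : List α) {n k : ℕ} (f : Fin n → α) (v : Fin n) (d : α)
    (hk : a.length = k) : (a ++ List.ofFn f ++ c).getD (k + v) d = f v := by
  subst hk
  rw [List.append_assoc, List.getD_append_right _ _ _ _ (by omega), Nat.add_sub_cancel_left,
    List.getD_append _ _ _ _ (by simp), List.getD_eq_getElem _ _ (by simp)]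
  simp

-- The matrix becomes one list indexed by `u * n + v`, matching the addresses that the program
-- computes.
open Classical in
theorem adjacency_eq : (List.ofFn fun u => List.ofFn fun v => if G.Adj u v then 1 else 0).flatten =
    List.ofFn fun k : Fin (n * n) => if G.Adj k.divNat k.modNat then 1 else 0 := by
  rw [List.ofFn_mul]
  congr 1
  congr 1
  funext u
  congr 1
  funext v
  have h1 : (⟨u * n + v, by
      have := u.2; have := v.2
      calc (u : ℕ) * n + v < (u + 1) * n := by rw [Nat.succ_mul]; omega
        _ ≤ n * n := Nat.mul_le_mul_right _ u.2⟩ : Fin (n * n)) = finProdFinEquiv (u, v) := by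
    ext; simp [finProdFinEquiv]; ring
  have h2 : finProdFinEquiv.symm (finProdFinEquiv (u, v)) = (u, v) :=
    finProdFinEquiv.symm_apply_apply _
  simp only [finProdFinEquiv_symm_apply, Prod.mk.injEq] at h2
  rw [h1, h2.1, h2.2]

/-- The state in which the program starts, after the address `base` has been computed. -/
def initState (x : List ℕ) (base : ℕ) : AState :=
  ⟨fun _ => 0, fun i => x.getD i 0, fun _ _ => 0, 0, base⟩

theorem length_encodeInstance : (encodeInstance G blk w).length = 2 + n + n * n + n + n := by
  rw [encodeInstance, adjacency_eq]
  simp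
  ring

theorem enc_initState : Enc G blk (fun v => (w v).num) (fun v => (w v).den)
    (initState (encodeInstance G blk w) (2 + n + n * n + n + n)) := by
  classical
  set x := encodeInstance G blk w with hx
  have hx' := hx
  rw [encodeInstance, adjacency_eq] at hx'
  have hm : ∀ k, k < 2 + n + n * n + n + n →
      (initState x (2 + n + n * n + n + n)).mem k = x.getD k 0 := fun k hk =>
    AState.mem_of_lt _ hk
  refine ⟨rfl, ?_, ?_, fun v => ?_, fun u v => ?_, fun v => ?_, fun v => ?_⟩
  · rw [hm _ (by omega), hx']; simp
  · rw [hm _ (by omega), hx']; simp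
  · have := v.2
    rw [hm _ (by omega), hx']
    simp only [List.append_assoc]
    simp only [← List.append_assoc [n, l]]
    rw [getD_append_ofFn _ _ _ v 0 (by simp)]
  · rw [hm _ (adj_lt u v), hx']
    have h2 : finProdFinEquiv.symm (finProdFinEquiv (u, v)) = (u, v) :=
      finProdFinEquiv.symm_apply_apply _
    simp only [finProdFinEquiv_symm_apply, Prod.mk.injEq] at h2
    have h1 : 2 + n + u * n + v = 2 + n + (finProdFinEquiv (u, v) : Fin (n * n)) := by
      simp [finProdFinEquiv]; ring
    rw [h1, List.append_assoc, getD_append_ofFn _ _ _ _ 0 (by simp; ring), h2.1, h2.2]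
    constructor
    · intro h; rw [if_pos h]
    · intro h; rw [if_neg h]
  · have := v.2
    rw [hm _ (by omega), hx', getD_append_ofFn _ _ _ v 0 (by simp; ring)]
  · have := v.2
    rw [hm _ (by omega), hx', ← List.append_nil (_ ++ List.ofFn fun v => (w v).den),
      getD_append_ofFn _ _ _ v 0 (by simp; ring)]

theorem inputSize_append (x y : List ℕ) : inputSize (x ++ y) = inputSize x + inputSize y := by
  simp [inputSize]

theorem inputSize_ofFn {n : ℕ} (f : Fin n → ℕ) :
    inputSize (List.ofFn f) = ∑ v, (f v).size + n := by
  simp [inputSize, List.map_ofFn, List.sum_ofFn, sum_add_distrib]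

theorem length_le_inputSize (x : List ℕ) : x.length ≤ inputSize x := by
  induction x with
  | nil => simp
  | cons a x ih => simp [inputSize] at ih ⊢; omega

theorem sum_size_den_le : ∑ v, ((w v).den).size ≤ inputSize (encodeInstance G blk w) := by
  rw [encodeInstance, inputSize_append, inputSize_ofFn]
  omega

theorem size_num_le (v : Fin n) : ((w v).num).size ≤ inputSize (encodeInstance G blk w) := by
  have : ((w v).num).size ≤ ∑ v, ((w v).num).size :=
    single_le_sum (f := fun v => ((w v).num).size) (by simp) (mem_univ v)
  rw [encodeInstance, inputSize_append, inputSize_append, inputSize_ofFn]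
  omega

/-- The address behind the input. -/
def baseExpr : Expr := .add (.add (.add (.add (.const 2) (.cell (.const 0)))
  (.mul (.cell (.const 0)) (.cell (.const 0)))) (.cell (.const 0))) (.cell (.const 0))

/-- The program for the machine. -/
def prog (c : ℕ) : Prog := .seq (.set 1 baseExpr) (ArrProg.compile 0 (main c))

theorem exec_prog (ω : ℕ → Bool) (c : ℕ) :
    ∃ s' t, Exec ω (prog c) (init (encodeInstance G blk w)) s' t ∧
      s'.mem = (run ω (main c) (initState (encodeInstance G blk w)
        (2 + n + n * n + n + n))).1.mem ∧
      t ≤ (run ω (main c) (initState (encodeInstance G blk w)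
        (2 + n + n * n + n + n))).2 + 2 * n + 20 := by
  set x := encodeInstance G blk w with hx
  set A := initState x (2 + n + n * n + n + n) with hA
  have hn : x.getD 0 0 = n := by simp [hx, encodeInstance]
  have e1 := Exec.set (ω := ω) 1 baseExpr (init x)
  have hev : baseExpr.eval (init x) = 2 + n + n * n + n + n := by
    simp only [baseExpr, Expr.eval, init, hn]
  have hrep : Rep (upd (init x) 1 (baseExpr.eval (init x))) A := by
    refine ⟨fun i => ?_, ?_, rfl, ?_⟩
    · simp only [upd, Function.update_of_ne (show 2 * i ≠ 1 by omega)]; rfl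
    · funext k
      simp only [upd, init, hA, initState, AState.mem]
      split_ifs with hk
      · rfl
      -- Cells behind the input are zero, as are all arrays at the start.
      · exact List.getD_eq_default _ _ (by rw [length_encodeInstance]; omega)
    · simp only [upd, Function.update_self, hev]; rfl
  obtain ⟨s', e2, r2, -⟩ := exec_compile ω (main c) 0 _ A hrep
  refine ⟨s', _, e1.seq e2, r2.mem, ?_⟩
  have s1 := size_le_self n
  simp only [baseExpr, Expr.cost, Expr.eval, init, hn]
  omega

/-! ### Polynomial bounds -/

/-- Functions that are given by a polynomial. -/
def IsPoly (f : ℕ → ℕ) : Prop := ∃ P : Polynomial ℕ, ∀ x, P.eval x = f x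

theorem IsPoly.const (k : ℕ) : IsPoly fun _ => k := ⟨.C k, fun _ => by simp⟩
theorem IsPoly.id : IsPoly fun x => x := ⟨.X, fun _ => by simp⟩
theorem IsPoly.add {f g : ℕ → ℕ} (hf : IsPoly f) (hg : IsPoly g) : IsPoly fun x => f x + g x := by
  obtain ⟨P, hP⟩ := hf
  obtain ⟨Q, hQ⟩ := hg
  exact ⟨P + Q, fun x => by simp [hP, hQ]⟩
theorem IsPoly.mul {f g : ℕ → ℕ} (hf : IsPoly f) (hg : IsPoly g) : IsPoly fun x => f x * g x := by
  obtain ⟨P, hP⟩ := hf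
  obtain ⟨Q, hQ⟩ := hg
  exact ⟨P * Q, fun x => by simp [hP, hQ]⟩
theorem IsPoly.pow {f : ℕ → ℕ} (hf : IsPoly f) (k : ℕ) : IsPoly fun x => f x ^ k := by
  obtain ⟨P, hP⟩ := hf
  exact ⟨P ^ k, fun x => by simp [hP]⟩

theorem isPoly_powCost (k : ℕ) : IsPoly fun x => powCost x k := by
  induction k with
  | zero => exact IsPoly.const 1
  | succ k ih => exact ((ih.add (IsPoly.id.pow k)).add IsPoly.id).add (IsPoly.const 2)

theorem powCost_mono {n x : ℕ} (h : n ≤ x) (k : ℕ) : powCost n k ≤ powCost x k := by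
  induction k with
  | zero => exact le_rfl
  | succ k ih => simp only [powCost]; gcongr

theorem isPoly_mainCost (c : ℕ) : IsPoly fun x => mainCost c x x x x + 2 * x + 20 := by
  simp only [mainCost, prepCost, roundCost, fillCost, findCost, numRounds, numSteps, numCoins]
  with_reducible repeat' first
    | exact IsPoly.id
    | exact isPoly_powCost _
    | apply IsPoly.add
    | apply IsPoly.mul
    | apply IsPoly.pow
    | exact IsPoly.const _

/-- Lets every size be replaced by the input size, so that the time bound becomes a polynomial in
one variable. -/
theorem mainCost_mono (c : ℕ) {n l b Z x : ℕ} (hn : n ≤ x) (hl : l ≤ x) (hb : b ≤ x)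
    (hZ : Z ≤ x) : mainCost c n l b Z ≤ mainCost c x x x x := by
  have := powCost_mono hn (c + 2)
  simp only [mainCost, prepCost, roundCost, fillCost, findCost, numRounds, numSteps, numCoins]
  gcongr

end
end ArrProg

namespace Resampling

/-! ### Uniform coins -/

section Coins

theorem prob_equiv {Ω Ω' : Type*} [Fintype Ω] [Fintype Ω'] (f : Ω ≃ Ω') (p : Ω' → Prop) :
    prob (fun x => p (f x)) = prob p := by
  classical
  rw [prob_eq, prob_eq, Fintype.card_congr f]
  congr 2
  refine card_bij (fun x _ => f x) ?_ ?_ ?_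
  · intro x hx; simpa using hx
  · intro x _ y _ h; exact f.injective h
  · intro y hy; exact ⟨f.symm y, by simpa using hy, by simp⟩

theorem prob_fst {Ω Y : Type*} [Fintype Ω] [Fintype Y] [Nonempty Y] (p : Ω → Prop) :
    prob (fun x : Ω × Y => p x.1) = prob p := by
  classical
  rw [prob_eq, prob_eq, Fintype.card_prod]
  have : (univ.filter fun x : Ω × Y => p x.1) = (univ.filter p) ×ˢ univ := by
    ext x; simp
  rw [this, card_product, card_univ]
  push_cast
  rw [mul_div_mul_right _ _ (by simp)]

/-- Coins read at distinct positions are uniform; the coins that are not read split off as an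
independent factor. -/
theorem prob_comp_injective {α β E : Type*} [Fintype α] [Fintype β] [DecidableEq α]
    [DecidableEq β] [Fintype E] [Nonempty E] {e : α → β} (he : Function.Injective e)
    (p : (α → E) → Prop) : prob (fun ω : β → E => p fun a => ω (e a)) = prob p := by
  classical
  let f : (β → E) ≃ (α → E) × ({x // ¬ x ∈ Set.range e} → E) :=
    (Equiv.piEquivPiSubtypeProd (fun x => x ∈ Set.range e) fun _ => E).trans
      (Equiv.prodCongr ((Equiv.ofInjective e he).symm.arrowCongr (Equiv.refl E)) (Equiv.refl _))
  rw [← prob_fst (Y := {x // ¬ x ∈ Set.range e} → E) p, ← prob_equiv f]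
  rfl

theorem prob_exists_fin {X : Type*} [Fintype X] [Nonempty X] (Q : ℕ) (p : X → Prop) :
    prob (fun R : Fin Q → X => ∃ ρ, p (R ρ)) = 1 - (1 - prob p) ^ Q := by
  classical
  have h := prob_pi (C := Fin Q) (E := X) fun _ => univ.filter fun x => ¬ p x
  have h2 : prob (fun x => ¬ p x) = (#(univ.filter fun x => ¬ p x) : ℝ) / Fintype.card X :=
    prob_eq _
  rw [← h2] at h
  simp only [mem_filter, mem_univ, true_and, prod_const, card_univ, Fintype.card_fin] at h
  rw [← prob_not, ← h, eq_sub_iff_add_eq, add_comm, ← eq_sub_iff_add_eq, ← prob_not]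
  exact prob_congr fun R => by simp

end Coins
end Resampling

/-! ### Table entries from coins, and amplification -/

namespace ArrProg
open RandRAM Resampling

theorem bits_congr {ω ω' : ℕ → Bool} {o o' m : ℕ} (h : ∀ q < m, ω (o + q) = ω' (o' + q)) :
    bits ω o m = bits ω' o' m := by
  induction m with
  | zero => rfl
  | succ m ih =>
    rw [bits, bits, ih fun q hq => h q (by omega), h m (by omega)]

theorem bits_lt (ω : ℕ → Bool) (o m : ℕ) : bits ω o m < 2 ^ m := by
  induction m with
  | zero => simp [bits]
  | succ m ih =>
    have := Bool.toNat_le (ω (o + m))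
    rw [bits, pow_succ]; omega

theorem bits_inj {ω ω' : ℕ → Bool} {o m : ℕ} (h : bits ω o m = bits ω' o m) :
    ∀ q < m, ω (o + q) = ω' (o + q) := by
  induction m with
  | zero => simp
  | succ m ih =>
    have h1 := Bool.toNat_le (ω (o + m))
    have h2 := Bool.toNat_le (ω' (o + m))
    simp only [bits] at h
    intro q hq
    rcases Nat.lt_succ_iff_lt_or_eq.1 hq with hq | rfl
    · exact ih (by omega) q hq
    · have h3 : (ω (o + q)).toNat = (ω' (o + q)).toNat := by omega
      revert h3
      cases ω (o + q) <;> cases ω' (o + q) <;> simp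

/-- The number with the given binary digits. -/
def value {m : ℕ} (e : Fin m → Bool) : ℕ := bits (tape e) 0 m

theorem value_injective {m : ℕ} : Function.Injective (value (m := m)) := by
  intro e e' h
  funext q
  have := bits_inj h q q.2
  simpa [tape] using this

/-- A residue class modulo `s` contains at most `2^m / s + 1` numbers below `2^m`; the surplus 1 is
the deviation from uniformity. -/
theorem prob_value_mod_le {m s k : ℕ} (hs : 0 < s) :
    prob (fun e : Fin m → Bool => value e % s = k) ≤ (1 + s / 2 ^ m) / s := by
  have hs0 : (0 : ℝ) < s := by exact_mod_cast hs
  have hcard : #{e : Fin m → Bool | value e % s = k} ≤ 2 ^ m / s + 1 := by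
    rw [← card_range (2 ^ m / s + 1)]
    refine card_le_card_of_injOn (fun e => value e / s) ?_ ?_
    · intro e _
      simp only [coe_range, Set.mem_Iio]
      exact Nat.lt_succ_of_le (Nat.div_le_div_right (bits_lt _ _ _).le)
    · intro e he e' he' h
      simp only [coe_filter, mem_univ, true_and, Set.mem_ofPred_eq] at he he'
      have h : value e / s = value e' / s := h
      apply value_injective
      rw [← Nat.div_add_mod (value e) s, ← Nat.div_add_mod (value e') s, he, he', h]
  rw [prob_eq]
  have h1 : (#{e : Fin m → Bool | value e % s = k} : ℝ) ≤ 2 ^ m / s + 1 := by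
    calc (#{e : Fin m → Bool | value e % s = k} : ℝ) ≤ ((2 ^ m / s + 1 : ℕ) : ℝ) := by
          exact_mod_cast hcard
      _ ≤ 2 ^ m / s + 1 := by
        push_cast
        gcongr
        exact_mod_cast (Nat.cast_div_le (α := ℝ) (m := 2 ^ m) (n := s))
  have h2 : (Fintype.card (Fin m → Bool) : ℝ) = 2 ^ m := by simp
  rw [h2, div_le_div_iff₀ (by positivity) hs0]
  calc _ ≤ (2 ^ m / s + 1 : ℝ) * s := by gcongr
    _ = (1 + s / 2 ^ m) * 2 ^ m := by field_simp

theorem one_add_pow_le {x y : ℝ} {N : ℕ} (hx : 0 ≤ x) (h : 2 * (N * x) ≤ y) (hy : y ≤ 1) :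
    (1 + x) ^ N ≤ 1 + y := by
  have h0 : 0 ≤ N * x := by positivity
  have h1 : (1 + x) ^ N ≤ Real.exp (N * x) := by
    rw [Real.exp_nat_mul]
    gcongr
    linarith [Real.add_one_le_exp x]
  have h2 := Real.abs_exp_sub_one_le (x := N * x) (by rw [abs_of_nonneg h0]; linarith)
  rw [abs_of_nonneg h0] at h2
  have := (abs_le.1 h2).2
  linarith

/-- Since `n < 2^n`, linearly many coins outweigh `n^(2c+4)` without computing a logarithm; the 10
additional coins absorb the constant 544. -/
theorem numCoins_large {c n s : ℕ} (hs : s ≤ 2 * n) (hn : 1 ≤ n) :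
    2 * (((2 * numSteps c n + 1 : ℕ) : ℝ) * (s / 2 ^ numCoins c n)) ≤ 1 / (8 * n ^ (c + 1)) := by
  have h1 : n ^ (2 * c + 4) ≤ 2 ^ ((2 * c + 4) * n) := by
    rw [mul_comm _ n, pow_mul 2]
    exact Nat.pow_le_pow_left n.lt_two_pow_self.le _
  have h2 : 2 * (2 * numSteps c n + 1) * s * (8 * n ^ (c + 1)) ≤ 2 ^ numCoins c n := by
    have e : 1 ≤ n ^ (c + 2) := Nat.one_le_pow _ _ hn
    calc 2 * (2 * numSteps c n + 1) * s * (8 * n ^ (c + 1))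
        ≤ 2 * (2 * (8 * n ^ (c + 2)) + n ^ (c + 2)) * (2 * n) * (8 * n ^ (c + 1)) := by
          unfold numSteps; gcongr
      _ = 544 * n ^ (2 * c + 4) := by ring
      _ ≤ 2 ^ 10 * 2 ^ ((2 * c + 4) * n) := by gcongr; norm_num
      _ = 2 ^ numCoins c n := by rw [numCoins, pow_add, mul_comm]
  have hn' : (0 : ℝ) < n := by exact_mod_cast hn
  rw [← mul_div_assoc, ← mul_div_assoc, div_le_div_iff₀ (by positivity) (by positivity), one_mul]
  calc _ = ((2 * (2 * numSteps c n + 1) * s * (8 * n ^ (c + 1)) : ℕ) : ℝ) := by push_cast; ring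
    _ ≤ ((2 ^ numCoins c n : ℕ) : ℝ) := by exact_mod_cast h2
    _ = _ := by push_cast; ring

section
variable {n l b : ℕ} {G : SimpleGraph (Fin n)} {blk : Fin n → Fin l} {W : Fin n → ℕ}
  {ord : Fin l → ℕ → Fin n}

/-- A round succeeds with probability at least `1 / (4 n ^ (c + 1))`. -/
theorem le_prob_good_table [DecidableRel G.Adj] (c : ℕ) {rk : Fin n → ℕ}
    (hrk : IsRanking blk b (fun v => (W v : ℝ)) rk ord) (hb1 : 1 ≤ b)
    (hb : ∀ i, #{v | blk v = i} = b) (h4 : 4 * G.maxDegree ≤ b) (hn : 1 ≤ n) (hln : l ≤ n)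
    (hbn : b ≤ n) {τ : ℝ} (hτ : 1 / (2 * b : ℝ) ≤ τ) (hτb : τ * b ≤ 1)
    (hτθ : τ ≤ theta (2 / slots b G.maxDegree) G.maxDegree) :
    1 / (4 * n ^ (c + 1)) ≤ prob fun R : Fin l × Fin (numSteps c n + 1) →
        (Fin (numCoins c n) → Bool) =>
      Good G blk (numSteps c n) W ((1 - 1 / n ^ c) * (τ * ∑ v, (W v : ℝ)))
        (tab (fun i e => ord i (value e % slots b G.maxDegree / 2)) R) := by
  classical
  set s := slots b G.maxDegree with hs
  set S := numSteps c n with hSdef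
  set m := numCoins c n with hm
  set ξ : ℝ := 1 / n ^ c with hξ
  set η : ℝ := 1 / (8 * n ^ (c + 1)) with hη
  set β : ℝ := (1 - ξ) * (τ * ∑ v, (W v : ℝ)) with hβ
  have hn' : (1 : ℝ) ≤ n := by exact_mod_cast hn
  have hn0 : (0 : ℝ) < n := by linarith
  have hb0 : (0 : ℝ) < b := by exact_mod_cast hb1
  have hs2 : 2 ≤ s := two_le_slots hb1
  have hsb : s ≤ 2 * b := slots_le
  have hη0 : 0 < η := by positivity
  have hpow : (1 : ℝ) ≤ n ^ (c + 1) := one_le_pow₀ hn'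
  have hη1 : η ≤ 1 := by
    rw [hη, div_le_one (by positivity)]; linarith
  have hξ1 : ξ ≤ 1 := by
    rw [hξ, div_le_one (by positivity)]; exact one_le_pow₀ hn'
  have hS0 : 0 < S := by
    rw [hSdef, numSteps]; have := Nat.one_le_pow (c + 2) n hn; omega
  -- The log is chosen adversarially: if the table is not good, take one that shows it. The
  -- probability bound holds for any choice of logs, so it bounds the probability of `Good` itself.
  have hlog : ∀ R : Fin l × Fin (S + 1) → (Fin m → Bool), ∃ log : List (Fin n × Fin n),
      Valid G blk (tab (fun i e => ord i (value e % s / 2)) R) (fun _ => 0) log ∧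
      log.length ≤ S ∧ ((log.length ≠ S ∧ β ≤ ∑ i,
        (W (tab (fun i e => ord i (value e % s / 2)) R i (cnt blk log i)) : ℝ)) →
        Good G blk S W β (tab (fun i e => ord i (value e % s / 2)) R)) := by
    intro R
    by_cases hg : Good G blk S W β (tab (fun i e => ord i (value e % s / 2)) R)
    · obtain ⟨log, h1, h2, -⟩ := exists_log (G := G) (blk := blk)
        (tab (fun i e => ord i (value e % s / 2)) R) S
      exact ⟨log, h1, h2, fun _ => hg⟩
    · have hg' := hg
      unfold Good at hg'
      push Not at hg'
      obtain ⟨log, h1, h2, -, h4⟩ := hg'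
      exact ⟨log, h1, h2, fun h => absurd h.2 (h4 h.1).not_ge⟩
  choose log hval hlen hgood using hlog
  have key := le_prob_good (a := 1 + s / 2 ^ m) (num := value (m := m)) hrk hb
    (fun v => by positivity) (card_adj_le G) hs2 hsb (eight_mul_le_slots h4)
    (by have : (0 : ℝ) ≤ s / 2 ^ m := by positivity
        linarith) (fun k _ => prob_value_mod_le (by omega)) (Nat.lt_succ_self S) log hval hlen
    (η := η) (τ := τ) (ξ := ξ)
    (one_add_pow_le (by positivity) (numCoins_large (by omega) hn) hη1) hη0.le (by
      rw [Fintype.card_fin]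
      -- The number of steps is chosen for this; `2n` covers `l(1 + η)` because `η ≤ 1`.
      have h1 : 2 * (S : ℝ) * η = 2 * n := by
        rw [hSdef, hη, numSteps]; push_cast; field_simp; ring
      have h2 : (l : ℝ) ≤ n := by exact_mod_cast hln
      rw [h1]
      nlinarith) hS0 ((by positivity : (0 : ℝ) ≤ 1 / (2 * b)).trans hτ) hτb hτθ hξ1
  refine le_trans ?_ (key.trans (prob_mono fun R hR => hgood R hR))
  have h1 : 1 / (2 * n : ℝ) ≤ τ := by
    refine le_trans ?_ hτ
    have : (b : ℝ) ≤ n := by exact_mod_cast hbn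
    gcongr
  have h2 : ξ * (1 / (2 * n)) ≤ ξ * τ := mul_le_mul_of_nonneg_left h1 (by positivity)
  -- With `τ ≥ 1/(2n)`, half of `ξτ` is kept after the loss `2η`.
  have h3 : (1 / (4 * n ^ (c + 1)) : ℝ) = ξ * (1 / (2 * n)) - 2 * η := by
    rw [hξ, hη]; field_simp; ring
  linarith

/-- The rounds read disjoint sets of coins. -/
theorem prob_rounds {Q S m T : ℕ} (hT : Q * l * (S + 1) * m ≤ T) (s : ℕ)
    (p : (Fin l → ℕ → Fin n) → Prop) :
    prob (fun ω : Fin T → Bool => ∃ ρ < Q, p (table (tape ω) s S m ord ρ)) =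
      1 - (1 - prob fun R : Fin l × Fin (S + 1) → (Fin m → Bool) =>
        p (tab (fun i e => ord i (value e % s / 2)) R)) ^ Q := by
  classical
  have hidx : ∀ x : (Fin Q × (Fin l × Fin (S + 1))) × Fin m,
      (finProdFinEquiv (finProdFinEquiv (x.1.1, finProdFinEquiv x.1.2), x.2) : ℕ) =
        ((x.1.1 * l + x.1.2.1) * (S + 1) + x.1.2.2) * m + x.2 := by
    intro x; simp [finProdFinEquiv]; ring
  -- The position on the tape of each bit of each cell in each round.
  let e : Fin Q × (Fin l × Fin (S + 1)) × Fin m → Fin T := fun x =>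
    Fin.castLE (by rw [mul_assoc Q l (S + 1)]  at hT; exact hT)
      (finProdFinEquiv (finProdFinEquiv (x.1, finProdFinEquiv x.2.1), x.2.2))
  have he : Function.Injective e := by
    intro x y h
    have h := finProdFinEquiv.injective (Fin.castLE_injective _ h)
    simp only [Prod.mk.injEq, EmbeddingLike.apply_eq_iff_eq] at h
    exact Prod.ext h.1.1 (Prod.ext h.1.2 h.2)
  rw [← prob_exists_fin]
  let f : (Fin Q × (Fin l × Fin (S + 1)) × Fin m → Bool) ≃
      (Fin Q → Fin l × Fin (S + 1) → Fin m → Bool) :=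
    (Equiv.curry _ _ _).trans ((Equiv.refl _).arrowCongr (Equiv.curry _ _ _))
  rw [← prob_equiv f, ← prob_comp_injective he]
  refine prob_congr fun ω => ?_
  have htab : ∀ ρ : Fin Q, table (tape ω) s S m ord ρ =
      tab (fun i e => ord i (value e % s / 2)) (f (fun a => ω (e a)) ρ) := by
    intro ρ
    funext i k
    simp only [table, tab]
    by_cases hk : k ≤ S
    · rw [if_pos hk, dif_pos (by omega)]
      congr 3
      apply bits_congr
      intro q hq
      have h1 := (hidx ((ρ, (i, ⟨k, by omega⟩)), ⟨q, hq⟩))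
      simp only at h1
      rw [← h1]
      have h2 : (e (ρ, (i, ⟨k, by omega⟩), ⟨q, hq⟩) : ℕ) = finProdFinEquiv (finProdFinEquiv
        (ρ, finProdFinEquiv (i, (⟨k, by omega⟩ : Fin (S + 1)))), (⟨q, hq⟩ : Fin m)) := rfl
      rw [← h2]
      simp [tape, f, hq]
    -- Outside the table, the default entry consists of zero bits, and its value is the 0 used in
    -- `table`.
    · rw [if_neg hk, dif_neg (by omega)]
      congr 3
      have : ∀ m' ≤ m, bits (tape (default : Fin m → Bool)) 0 m' = 0 := by
        intro m'
        induction m' with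
        | zero => intro _; rfl
        | succ m' ih =>
          intro h
          rw [bits, ih (by omega)]
          simp [tape]
      exact (this m le_rfl).symm
  constructor
  · rintro ⟨ρ, hρ, h⟩
    exact ⟨⟨ρ, hρ⟩, by rw [← htab ⟨ρ, hρ⟩]; exact h⟩
  · rintro ⟨ρ, h⟩
    exact ⟨ρ, ρ.2, by rw [htab ρ]; exact h⟩

/-- As `1 - p ≤ exp (-p)` and `p` times the number of rounds is at least `c * n ≥ c * log n`, all
rounds fail with probability at most `n^(-c)`. -/
theorem amplify {p : ℝ} {c n : ℕ} (hn : 1 ≤ n) (hp : 1 / (4 * n ^ (c + 1)) ≤ p) (hp1 : p ≤ 1) :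
    1 - 1 / (n : ℝ) ^ c ≤ 1 - (1 - p) ^ numRounds c n := by
  have hn' : (0 : ℝ) < n := by exact_mod_cast hn
  have h1 : (1 - p) ^ numRounds c n ≤ Real.exp (-p * numRounds c n) := by
    rw [mul_comm, Real.exp_nat_mul]
    gcongr
    linarith [Real.add_one_le_exp (-p)]
  have h2 : (c : ℝ) * Real.log n ≤ p * numRounds c n := by
    have h3 : (numRounds c n : ℝ) = 4 * c * n ^ (c + 2) := by unfold numRounds; push_cast; ring
    calc (c : ℝ) * Real.log n ≤ c * n := by gcongr; exact Real.log_le_self hn'.le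
      _ = 1 / (4 * n ^ (c + 1)) * (4 * c * n ^ (c + 2)) := by field_simp; ring
      _ ≤ _ := by rw [h3]; gcongr
  have h3 : Real.exp (-p * numRounds c n) ≤ 1 / (n : ℝ) ^ c := by
    calc Real.exp (-p * numRounds c n) ≤ Real.exp (-(c * Real.log n)) := by
          gcongr; linarith
      _ = 1 / (n : ℝ) ^ c := by
        rw [Real.exp_neg, Real.exp_nat_mul, Real.exp_log hn', one_div]
  linarith

end
end ArrProg

/-! ### Assembling the algorithmic statement -/

namespace ArrProg
open RandRAM Resampling

theorem card_eq_mul {n l b : ℕ} {blk : Fin n → Fin l} (hb : ∀ i, #{v | blk v = i} = b) :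
    n = l * b := by
  have h := Finset.card_eq_sum_card_fiberwise (s := (univ : Finset (Fin n))) (t := univ) (f := blk)
    (fun _ _ => by simp)
  simpa [hb] using h

/-- Ensures that the tape of length `T` contains all the coins of all the rounds. -/
theorem coins_le_mainCost (c n l b Z : ℕ) :
    numRounds c n * l * (numSteps c n + 1) * numCoins c n ≤ mainCost c n l b Z := by
  set S := numSteps c n
  set m := numCoins c n
  have h1 : l * ((S + 1) * m) ≤ fillCost l b S m := by
    unfold fillCost
    calc l * ((S + 1) * m) ≤ l * ((S + 1) * (9 * (2 * l + 4 * b + S) + 30 * m + 500 + 10)) := by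
          gcongr; omega
      _ ≤ l * (3 + 7 + (S + 1) * (9 * (2 * l + 4 * b + S) + 30 * m + 500 + 10) + 10) := by
          gcongr; omega
      _ ≤ _ := by omega
  have h2 : fillCost l b S m ≤ roundCost n l b S m := by unfold roundCost; omega
  calc numRounds c n * l * (S + 1) * m = numRounds c n * (l * ((S + 1) * m)) := by ring
    _ ≤ numRounds c n * (roundCost n l b S m + 10) := by gcongr; omega
    _ ≤ 10 + numRounds c n * (roundCost n l b S m + 10) := by omega
    _ ≤ mainCost c n l b Z := (Nat.le_add_left _ _).trans (Nat.le_add_right _ _)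

/-- Every denominator divides the product of all of them, so the integer division is exact and the
weights are scaled by one common factor. -/
theorem scaled_eq {n : ℕ} (w : Fin n → ℚ≥0) (v : Fin n) :
    (scaled (fun v => (w v).num) (fun v => (w v).den) v : ℝ) =
      (w v : ℝ) * (∏ u, (w u).den : ℕ) := by
  have hd : ((w v).den : ℝ) ≠ 0 := by exact_mod_cast (w v).den_ne_zero
  obtain ⟨k, hk⟩ := Finset.dvd_prod_of_mem (fun u => (w u).den) (mem_univ v)
  have h1 : (∏ u, (w u).den) / (w v).den = k := by
    rw [hk]; exact Nat.mul_div_cancel_left _ (w v).den_pos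
  rw [scaled, h1, hk, NNRat.cast_def]
  push_cast
  field_simp

/-- The block size, or one if there are no blocks. -/
theorem exists_size {n l b : ℕ} {blk : Fin n → Fin l} (hb1 : 1 ≤ b)
    (hb : ∀ i, #{v | blk v = i} = b) {X : ℕ} (hX : 1 ≤ X) (hn : n ≤ X) :
    ∃ b', 1 ≤ b' ∧ (∀ i, #{v | blk v = i} = b') ∧ b' = n / l + (1 - l) ∧ l ≤ X ∧ b' ≤ X ∧
      (1 ≤ n → b' = b ∧ l ≤ n ∧ b' ≤ n) := by
  have h := card_eq_mul hb
  rcases Nat.eq_zero_or_pos l with rfl | hl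
  · have : n = 0 := by simpa using h
    exact ⟨1, le_rfl, fun i => i.elim0, by simp, by omega, hX, by omega⟩
  · have h1 : l ≤ n := h ▸ Nat.le_mul_of_pos_right l hb1
    have h2 : b ≤ n := h ▸ Nat.le_mul_of_pos_left b hl
    refine ⟨b, hb1, hb, ?_, by omega, by omega, fun _ => ⟨rfl, h1, h2⟩⟩
    rw [h, Nat.mul_div_cancel_left _ hl]; omega

section
variable {n l b : ℕ} {G : SimpleGraph (Fin n)} {blk : Fin n → Fin l} {w : Fin n → ℚ≥0}

/-- The data of a run: it halts in time, and it succeeds if one of the rounds is good. -/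
theorem exists_run [DecidableRel G.Adj] (c : ℕ) (hb1 : 1 ≤ b)
    (hb : ∀ i, #{v | blk v = i} = b) {T : ℕ}
    (hT : T = mainCost c (inputSize (encodeInstance G blk w)) (inputSize (encodeInstance G blk w))
      (inputSize (encodeInstance G blk w)) (inputSize (encodeInstance G blk w)) +
        2 * inputSize (encodeInstance G blk w) + 20) :
    ∃ ord : Fin l → ℕ → Fin n,
      (1 ≤ n → IsRanking blk b
        (fun v => (scaled (fun v => (w v).num) (fun v => (w v).den) v : ℝ))
        (rank blk (fun u => (scaled (fun v => (w v).num) (fun v => (w v).den) u : ℝ))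
          fun u => (u : ℕ)) ord) ∧
      numRounds c n * l * (numSteps c n + 1) * numCoins c n ≤ T ∧
      ∀ ω : ℕ → Bool, ∃ s t, Exec ω (prog c) (init (encodeInstance G blk w)) s t ∧ t ≤ T ∧
        (1 ≤ n → ∀ β : ℝ, (∃ ρ < numRounds c n, Good G blk (numSteps c n)
            (scaled (fun v => (w v).num) (fun v => (w v).den)) β
            (table ω (slots b G.maxDegree) (numSteps c n) (numCoins c n) ord ρ)) →
          ∃ cur : Fin l → Fin n, (∀ i, blk (cur i) = i) ∧ (∀ i j, ¬ G.Adj (cur i) (cur j)) ∧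
            (∀ v : Fin n, s.mem v ≠ 0 ↔ ∃ i, cur i = v) ∧
            β ≤ ∑ i, (scaled (fun v => (w v).num) (fun v => (w v).den) (cur i) : ℝ)) := by
  set X := inputSize (encodeInstance G blk w) with hX
  have hlen := length_le_inputSize (encodeInstance G blk w)
  rw [length_encodeInstance, ← hX] at hlen
  obtain ⟨b', h1, h2, h3, hl, hbX, h4⟩ := exists_size hb1 hb (X := X) (by omega) (by omega)
  obtain ⟨ord, hord⟩ := exists_isRanking h1 h2
    (fun v => (scaled (fun v => (w v).num) (fun v => (w v).den) v : ℝ)) Fin.val_injective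
  have hcost := mainCost_mono c (show n ≤ X by omega) hl hbX le_rfl
  refine ⟨ord, fun hn => (h4 hn).1 ▸ hord, ?_, fun ω => ?_⟩
  · have := coins_le_mainCost c n l b' X
    omega
  · obtain ⟨s, t, e, hm, ht⟩ := exec_prog (G := G) (blk := blk) (w := w) ω c
    obtain ⟨m1, m2⟩ := run_main (ω := ω) c (enc_initState (G := G) (blk := blk) (w := w)) rfl h3 h1
      (Z := X) sum_size_den_le size_num_le hord
    refine ⟨s, t, e, by omega, fun hn β hβ => ?_⟩
    obtain ⟨cur, c1, c2, c3, c4⟩ := m1 β ((h4 hn).1 ▸ hβ)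
    exact ⟨cur, c1, c2, by rw [hm]; exact c3, c4⟩

theorem outputsTransversal {cur : Fin l → Fin n} {mem : ℕ → ℕ} {B : ℝ}
    (hblk : ∀ i, blk (cur i) = i) (hadj : ∀ i j, ¬ G.Adj (cur i) (cur j))
    (hmem : ∀ v : Fin n, mem v ≠ 0 ↔ ∃ i, cur i = v)
    (hB : B * (∏ u, (w u).den : ℕ) ≤
      ∑ i, (scaled (fun v => (w v).num) (fun v => (w v).den) (cur i) : ℝ)) :
    OutputsTransversal G blk w B mem := by
  have hset : outputSet n mem =
      @Finset.image _ _ (fun _ _ => Classical.propDecidable _) cur univ := by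
    ext v; simpa [outputSet] using hmem v
  rw [OutputsTransversal, hset]
  refine ⟨isIndepTransversal_image hblk hadj, ?_⟩
  rw [sum_image_cur hblk]
  have hD : (0 : ℝ) < (∏ u, (w u).den : ℕ) := by
    exact_mod_cast Finset.prod_pos fun u _ => (w u).den_pos
  refine le_of_mul_le_mul_right (hB.trans (le_of_eq ?_)) hD
  rw [sum_mul]
  exact sum_congr rfl fun i _ => scaled_eq w (cur i)

theorem le_successProb [DecidableRel G.Adj] (c : ℕ) (hb1 : 1 ≤ b)
    (hb : ∀ i, #{v | blk v = i} = b) (h4 : 4 * G.maxDegree ≤ b) {T : ℕ}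
    (hT : T = mainCost c (inputSize (encodeInstance G blk w)) (inputSize (encodeInstance G blk w))
      (inputSize (encodeInstance G blk w)) (inputSize (encodeInstance G blk w)) +
        2 * inputSize (encodeInstance G blk w) + 20) {τ : ℝ} (hτ : 1 / (2 * b : ℝ) ≤ τ)
    (hτb : τ * b ≤ 1) (hτθ : τ ≤ theta (2 / slots b G.maxDegree) G.maxDegree) :
    1 - 1 / (n : ℝ) ^ c ≤ successProb (prog c) (encodeInstance G blk w) T
      (OutputsTransversal G blk w ((1 - 1 / (n : ℝ) ^ c) * ((∑ v, (w v : ℝ)) * τ))) := by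
  obtain ⟨ord, hord, hcoins, hrun⟩ := exists_run (G := G) (w := w) c hb1 hb hT
  set B : ℝ := (1 - 1 / (n : ℝ) ^ c) * ((∑ v, (w v : ℝ)) * τ) with hBdef
  have hsp : successProb (prog c) (encodeInstance G blk w) T (OutputsTransversal G blk w B) =
      prob fun ω : Fin T → Bool => ∃ s t, Exec (tape ω) (prog c) (init (encodeInstance G blk w)) s t ∧
        t ≤ T ∧ OutputsTransversal G blk w B s.mem := by
    unfold successProb prob
    simp
  rw [hsp]
  rcases Nat.eq_zero_or_pos n with rfl | hn
  -- Without vertices there are no blocks, as `b ≥ 1`; the empty set is then a transversal and the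
  -- required weight is zero.
  · have hall : ∀ ω : Fin T → Bool, ∃ s t, Exec (tape ω) (prog c)
        (init (encodeInstance G blk w)) s t ∧ t ≤ T ∧ OutputsTransversal G blk w B s.mem := by
      intro ω
      obtain ⟨s, t, e, ht, -⟩ := hrun (tape ω)
      refine ⟨s, t, e, ht, ⟨fun i => ?_, fun v => v.elim0⟩, ?_⟩
      · have := hb i
        simp at this
        omega
      · rw [show B = 0 by simp [hBdef]]
        exact sum_nonneg fun v _ => NNRat.cast_nonneg _
    have h1 : prob (fun ω : Fin T → Bool => ∃ s t, Exec (tape ω) (prog c)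
        (init (encodeInstance G blk w)) s t ∧ t ≤ T ∧ OutputsTransversal G blk w B s.mem) = 1 := by
      classical
      rw [prob_eq, filter_true_of_mem fun ω _ => hall ω, card_univ]
      exact div_self (by simp)
    rw [h1]
    have : (0 : ℝ) ≤ 1 / ((0 : ℕ) : ℝ) ^ c := by positivity
    linarith
  · have hl : 1 ≤ l := by
      by_contra hl
      obtain rfl : l = 0 := by omega
      exact (blk ⟨0, hn⟩).elim0
    have hnlb := card_eq_mul hb
    have hln : l ≤ n := hnlb ▸ Nat.le_mul_of_pos_right l hb1
    have hbn : b ≤ n := hnlb ▸ Nat.le_mul_of_pos_left b hl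
    have hp := le_prob_good_table c (hord hn) hb1 hb h4 hn hln hbn hτ hτb hτθ
    have hr := prob_rounds (ord := ord) hcoins (slots b G.maxDegree)
      (Good G blk (numSteps c n) (scaled (fun v => (w v).num) (fun v => (w v).den))
        ((1 - 1 / (n : ℝ) ^ c) *
          (τ * ∑ v, (scaled (fun v => (w v).num) (fun v => (w v).den) v : ℝ))))
    refine (amplify hn hp (prob_le_one _)).trans (hr.ge.trans (prob_mono fun ω hω => ?_))
    obtain ⟨s, t, e, ht, hs⟩ := hrun (tape ω)
    obtain ⟨cur, c1, c2, c3, c4⟩ := hs hn _ hω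
    refine ⟨s, t, e, ht, outputsTransversal c1 c2 c3 (le_trans (le_of_eq ?_) c4)⟩
    simp only [scaled_eq, ← sum_mul, hBdef]
    ring

end
end ArrProg

theorem theorem4p3 :
    -- existence
    (∀ (V ι : Type*) [Fintype V] [Fintype ι] [DecidableEq ι]
      (G : SimpleGraph V) [DecidableRel G.Adj] (blk : V → ι) (w : V → ℝ) (b Δ : ℕ),
      1 ≤ b → (∀ i, #{v | blk v = i} = b) → G.maxDegree = Δ → (∀ v, 0 ≤ w v) →
      (4 * (Δ : ℝ) ≤ b → (b : ℝ) ≤ 4.5 * Δ →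
        (∃ I : Finset V, IsIndepTransversal G blk I ∧
          (∑ v, w v) * factorSmall b Δ ≤ ∑ v ∈ I, w v) ∧
        (∑ v, w v) / (8 * (Δ : ℝ) - 1) ≤ (∑ v, w v) * factorSmall b Δ) ∧
      (4.5 * (Δ : ℝ) ≤ b →
        ∃ I : Finset V, IsIndepTransversal G blk I ∧
          (∑ v, w v) * factorLarge b Δ ≤ ∑ v ∈ I, w v)) ∧
    -- randomized polynomial-time construction
    (∀ c : ℕ, ∃ (p : RandRAM.Prog) (P : Polynomial ℕ),
      ∀ (n l b Δ : ℕ) (G : SimpleGraph (Fin n)) [DecidableRel G.Adj] (blk : Fin n → Fin l)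
        (w : Fin n → ℚ≥0) (x : List ℕ) (T : ℕ),
      1 ≤ b → (∀ i, #{v | blk v = i} = b) → G.maxDegree = Δ → 4 * (Δ : ℝ) ≤ b →
      x = encodeInstance G blk w → T = P.eval (RandRAM.inputSize x) →
      RandRAM.HaltsWithin p x T ∧
      ((b : ℝ) ≤ 4.5 * Δ →
        1 - 1 / (n : ℝ) ^ c ≤ RandRAM.successProb p x T (OutputsTransversal G blk w
          ((1 - 1 / (n : ℝ) ^ c) * ((∑ v, (w v : ℝ)) * factorSmall b Δ)))) ∧
      (4.5 * (Δ : ℝ) ≤ b →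
        1 - 1 / (n : ℝ) ^ c ≤ RandRAM.successProb p x T (OutputsTransversal G blk w
          ((1 - 1 / (n : ℝ) ^ c) * ((∑ v, (w v : ℝ)) * factorLarge b Δ))))) := by
  refine ⟨fun V ι _ _ _ G _ blk w b Δ hb1 hb hΔ hw =>
    Resampling.existence G blk w b Δ hb1 hb hΔ hw, fun c => ?_⟩
  obtain ⟨P, hP⟩ := ArrProg.isPoly_mainCost c
  refine ⟨ArrProg.prog c, P, ?_⟩
  intro n l b Δ G _ blk w x T hb1 hb hΔ h4 hx hT
  subst hx hΔ
  rw [hP] at hT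
  have h4' : 4 * G.maxDegree ≤ b := by exact_mod_cast h4
  refine ⟨fun ω => ?_, fun h45 => ?_, fun h45 => ?_⟩
  · obtain ⟨_, -, -, h⟩ := ArrProg.exists_run (G := G) (w := w) c hb1 hb hT
    obtain ⟨s, t, e, ht, -⟩ := h (RandRAM.tape ω)
    exact ⟨s, t, e, ht⟩
  · exact ArrProg.le_successProb c hb1 hb h4' hT (Resampling.one_div_le_factorSmall hb1 h4)
      (Resampling.factorSmall_mul_le hb1 h4) (Resampling.factorSmall_eq_theta hb1 h4 h45).le
  · exact ArrProg.le_successProb c hb1 hb h4' hT (Resampling.one_div_le_factorLarge hb1 h45)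
      (Resampling.factorLarge_mul_le hb1) (Resampling.factorLarge_le_theta hb1 h45)
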